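/- **Setting.** A wireless computing network has $N\ge 1$ nodes and one service, a chain of $M\ge 1$ functions; commodity $(d,m)$, $0\le m\le M$, is the output of function $m$ (the source data if $m=0$) for destination $d$. Function $m$ needs $r^{(m)}>0$ operations per input unit and outputs $\xi^{(m)}>0$ units per input unit. In each slot $t=0,1,\dots$ node $i$ allocates $k\in\{0,\dots,K^{\rm pr}_i\}$ processing units (cost $w^{\rm pr}_{i,k}\ge 0$, processing rate $R_{i,k}\ge 0$) and $k\in\{0,\dots,K^{\rm tr}_i\}$ transmission units (cost $w^{\rm tr}_{i,k}\ge 0$); $h(t)$ is the total cost. The network state ${\bf S}(t)$ (all channel gains) is a finite-state Markov chain with a unique stationary distribution and known transition probabilities; it is revealed only after the transmission of slot $t$. With $k$ transmission units node $i$ uses a superposition code (a continuum of layers, or finitely many), by which a receiver $j$ decodes at rate $R_{ij,k}({\bf s})$, non-decreasing in its channel gain ($R_{ij,0}=0$). If $q_{i,1},\dots,q_{i,N-1}$ are the other nodes by non-decreasing gain, the transmission of node $i$ splits into partitions $n=1,\dots,N-1$, where partition $n$ has maximum rate $R_{iq_{i,n},k}-R_{iq_{i,n-1},k}$ (with $R_{iq_{i,0},k}=0$)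 and is decoded exactly by $\Omega_{i,n}=\{q_{i,n},\dots,q_{i,N-1}\}$. The arrivals $a_i^{(d,m)}(t)\ge 0$ are i.i.d. over slots and independent of the past, have means $\lambda_i^{(d,m)}$ and satisfy $\mathbb E(\sum_{(d,m)}a_i^{(d,m)}(t))^4\le A_{\max}^4$. Commodity $(d,M)$ leaves the network at node $d$, so $Q_d^{(d,M)}=0$, where $Q_i^{(d,m)}(t)$ is the queue backlog. A *control algorithm* chooses, before ${\bf S}(t)$ is revealed, the resource units and the division of the transmission time of each node among the commodities; it may let several receivers keep copies of the same information, and may discard duplicates but never the last copy of undelivered information. It stabilizes the network if $Q_i^{(d,m)}(t)/t\to 0$ with probability 1 for all $i,d,m$. The capacity region $\Lambda$ is the closure of the set of rate matrices $\boldsymbol\lambda$ that some control algorithm stabilizes (for some arrivals with rates $\boldsymbol\lambda$ as above), and $\overline h^*(\boldsymbol\lambda)$ is the infimum of $\limsup_t\frac1t\sum_{\tau<t}\mathbb E\,h(\tau)$ over the control algorithms that do so. **DWCNC with parameter $V\ge 0$.** In slot $t$, node $i$ picks $(k,(d,m))$, $m<M$, maximizing $R_{i,k}W_i^{(d,m)}(t)-Vw^{\rm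 pr}_{i,k}$, where $W_i^{(d,m)}=\frac{1}{r^{(m+1)}}[Q_i^{(d,m)}-\xi^{(m+1)}Q_i^{(d,m+1)}]^+$, and processes this commodity at rate $R_{i,k}/r^{(m+1)}$ (at rate $0$ if $W_i^{(d,m)}(t)=0$). It also picks $(k,(d,m))$ maximizing $W^{(d,m)}_{i,k,{\rm tr}}(t)-Vw^{\rm tr}_{i,k}$, where $W_{ij}^{(d,m)}=[Q_i^{(d,m)}-Q_j^{(d,m)}]^+$ and $$W^{(d,m)}_{i,k,{\rm tr}}(t)=\sum_{\bf s}\Pr({\bf S}(t)={\bf s}\mid{\bf S}(t-1))\sum_{n=1}^{N-1}\bigl[R_{iq_{i,n},k}({\bf s})-R_{iq_{i,n-1},k}({\bf s})\bigr]\max_{j\in\Omega_{i,n}({\bf s})}W_{ij}^{(d,m)}(t),$$ and transmits this commodity; afterwards each partition $n$ is handed to the receiver in $\Omega_{i,n}({\bf S}(t))$ with the largest positive $W_{ij}^{(d,m)}(t)$, and stays at $i$ if there is none. Actual flows are cut down to the available backlog. **Theorem 2.** For every such network and every $A_{\max}\ge 0$ there is a constant $B$, depending only on these (the rates, $\xi^{(m)}$,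 $r^{(m)}$, $A_{\max}$ and the law of the network state) and not on the costs, $V$, $\boldsymbol\lambda$ or $\epsilon$, such that for every $V\ge0$ and all arrivals whose rate matrix $\boldsymbol\lambda$ is strictly interior to $\Lambda$ (that is, $\boldsymbol\lambda+\epsilon{\bf 1}\in\Lambda$ for some $\epsilon>0$), DWCNC stabilizes the network and, with probability 1, $$\limsup_{t\to\infty}\frac1t\sum_{\tau=0}^{t-1}h(\tau)\le\overline h^*(\boldsymbol\lambda)+\frac{NB}{V}\quad(V>0),$$ $$\limsup_{t\to\infty}\frac1t\sum_{\tau=0}^{t-1}\sum_{i,d,m}Q_i^{(d,m)}(\tau)\le\frac{NB+V[\overline h^*(\boldsymbol\lambda+\epsilon{\bf 1})-\overline h^*(\boldsymbol\lambda)]}{\epsilon}\quad\text{for every }\epsilon>0\text{ with }\boldsymbol\lambda+\epsilon{\bf 1}\in\Lambda,$$ an $[O(1/V),O(V)]$ cost–delay tradeoff. If the network state is i.i.d. over the slots, this holds with $$B=\tfrac12\max_i\Bigl\{\bigl(\max_{j\ne i,{\bf s},k}R_{ij,k}({\bf s})+\tfrac{\max_kR_{i,k}}{r_{\min}}\bigr)^2+\bigl(\max_{\bf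 s}\sum_{j\ne i}\max_kR_{ji,k}({\bf s})+\tfrac{\xi_{\max}\max_kR_{i,k}}{r_{\min}}+A_{\max}\bigr)^2\Bigr\},$$ where a maximum over an empty set is $0$. -/

import Mathlib

open MeasureTheory ProbabilityTheory Filter Topology

noncomputable section

namespace WirelessComputing

/-! ### Superposition codes and the broadcast approach -/

/-- A superposition code used with the broadcast approach: either a continuum of layers with a
power density over the layers, or finitely many layers with powers and channel gain thresholds. -/
inductive SuperpositionCode : Type
  | continuum (p : ℝ → ℝ) (p_nonneg : ∀ a, 0 ≤ p a)
      (p_integrable : IntegrableOn p (Set.Ioi 0)) : SuperpositionCode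
  | discrete (L : ℕ) (power threshold : Fin L → ℝ) (power_nonneg : ∀ l, 0 ≤ power l)
      (threshold_nonneg : ∀ l, 0 ≤ threshold l)
      (threshold_mono : Monotone threshold) : SuperpositionCode

/-- Maximum rate that a receiver with channel gain `g` can decode. -/
def SuperpositionCode.rate : SuperpositionCode → ℝ → ℝ
  | .continuum p _ _, g => ∫ a in (0 : ℝ)..g, a * p a / (1 + a * ∫ s in Set.Ioi a, p s)
  | .discrete L power threshold _ _ _, g =>
      ∑ l : Fin L, if threshold l ≤ g then
        Real.log (1 + power l * threshold l /
          (1 + threshold l * ∑ l' ∈ Finset.Ioi l, power l')) else 0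

/-! ### The network -/

/-- Nodes: there are `N = n + 1` of them. -/
abbrev Node (n : ℕ) : Type := Fin (n + 1)

/-- A commodity `(d, m)`: destination `d`, stage `m ∈ {0, …, M}` of the service chain. -/
abbrev Commodity (n M : ℕ) : Type := Node n × Fin (M + 1)

/-- A pair (destination `d`, function): the function with index `m : Fin M` turns commodity
`(d, m)` (that is, `(d, m.castSucc)`) into commodity `(d, m + 1)` (that is, `(d, m.succ)`). -/
abbrev Job (n M : ℕ) : Type := Node n × Fin M

/-- A matrix of input rates, or of queue backlogs, by node and commodity. -/
abbrev RateMatrix (n M : ℕ) : Type := Node n → Commodity n M → ℝ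

/-- A wireless computing network with `n + 1` nodes, one service made of a chain of `M` functions,
and a finite set `𝒮` of network states. -/
structure Network (n M : ℕ) (𝒮 : Type) [Fintype 𝒮] where
  /-- the service chain is not empty -/
  M_pos : 0 < M
  /-- numbers of transmission and processing resource units -/
  Ktr : Node n → ℕ
  Kpr : Node n → ℕ
  /-- processing complexity factor of each function -/
  r : Fin M → ℝ
  r_pos : ∀ m, 0 < r m
  /-- scaling factor of each function -/
  ξ : Fin M → ℝ
  ξ_pos : ∀ m, 0 < ξ m
  /-- processing rate of a node, in operations per slot, with `k` processing resource units -/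
  Rpr : ∀ i, Fin (Kpr i + 1) → ℝ
  Rpr_nonneg : ∀ i k, 0 ≤ Rpr i k
  /-- channel gain of each link in each network state -/
  gain : 𝒮 → Node n → Node n → ℝ
  gain_nonneg : ∀ s i j, 0 ≤ gain s i j
  /-- superposition code used by node `i` with `k + 1` transmission resource units -/
  code : ∀ i, Fin (Ktr i) → SuperpositionCode
  /-- transition probabilities of the network state -/
  P : 𝒮 → 𝒮 → ℝ
  P_nonneg : ∀ s s', 0 ≤ P s s'
  P_sum : ∀ s, ∑ s', P s s' = 1
  /-- the steady-state distribution exists (and does not depend on the initial state) -/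
  steady : ∃! π : 𝒮 → ℝ, (∀ s, 0 ≤ π s) ∧ ∑ s, π s = 1 ∧ ∀ s', ∑ s, π s * P s s' = π s'

namespace Network

variable {n M : ℕ} {𝒮 : Type} [Fintype 𝒮] (net : Network n M 𝒮)

/-- `R_{ij,k}(s)`: maximum rate over link `(i, j)` in state `s` with `k` transmission resource
units at node `i`; nothing is transmitted with zero units. -/
def txRate (i j : Node n) (k : Fin (net.Ktr i + 1)) (s : 𝒮) : ℝ :=
  Fin.cases (motive := fun _ => ℝ) 0 (fun k' => (net.code i k').rate (net.gain s i j)) k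

/-- `q_{i,u}(s)`: the receivers of node `i`, sorted by non-decreasing channel gain in state `s`
(indices start at `0`). -/
def receiver (i : Node n) (s : 𝒮) (u : Fin n) : Node n :=
  i.succAbove (Tuple.sort (fun v : Fin n => net.gain s i (i.succAbove v)) u)

/-- `Ω_{i,v}(s)`: the receivers that decode partition `v` of the information sent by node `i`. -/
def receiverSet (i : Node n) (s : 𝒮) (v : Fin n) : Finset (Node n) :=
  (Finset.Ici v).image (net.receiver i s)

theorem receiverSet_nonempty (i : Node n) (s : 𝒮) (v : Fin n) :
    (net.receiverSet i s v).Nonempty :=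
  ⟨net.receiver i s v, Finset.mem_image_of_mem _ (Finset.mem_Ici.2 le_rfl)⟩

/-- Maximum rate of partition `v`: the rate of receiver `q_{i,v}` minus that of the receiver
before it (minus `0` for the first partition). -/
def partitionRate (i : Node n) (k : Fin (net.Ktr i + 1)) (s : 𝒮) (v : Fin n) : ℝ :=
  net.txRate i (net.receiver i s v) k s -
    if h : 0 < (v : ℕ) then net.txRate i (net.receiver i s ⟨v - 1, by omega⟩) k s else 0

/-- Size, at stage `m`, of a piece of information whose size at stage `0` is (or would have been)
one. -/
def scale (m : Fin (M + 1)) : ℝ := ∏ l : Fin M, if l.castSucc < m then net.ξ l else 1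

/-- The network state is independent and identically distributed over the slots. -/
def MemorylessChannel : Prop := ∀ s₁ s₂ s, net.P s₁ s = net.P s₂ s

/-- Largest transmission rate out of node `i`. -/
def maxOut (i : Node n) : ℝ :=
  ⨆ p : {j : Node n // j ≠ i} × 𝒮 × Fin (net.Ktr i + 1), net.txRate i p.1 p.2.2 p.2.1

/-- Largest total transmission rate into node `i`. -/
def maxIn (i : Node n) : ℝ :=
  ⨆ s : 𝒮, ∑ j ∈ Finset.univ.erase i, ⨆ k : Fin (net.Ktr j + 1), net.txRate j i k s

/-- Largest processing rate of node `i`. -/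
def maxProc (i : Node n) : ℝ := ⨆ k : Fin (net.Kpr i + 1), net.Rpr i k

/-- The explicit constant
`½ maxᵢ {(maxOutᵢ + maxProcᵢ / r_min)² + (maxInᵢ + ξ_max maxProcᵢ / r_min + A_max)²}`. -/
def driftConstant (A : ℝ) : ℝ :=
  (1 / 2) * ⨆ i : Node n,
    ((net.maxOut i + net.maxProc i / ⨅ m, net.r m) ^ 2 +
      (net.maxIn i + (⨆ m, net.ξ m) * net.maxProc i / (⨅ m, net.r m) + A) ^ 2)

/-- Resource costs of allocating `k` processing or transmission resource units. -/
structure Cost where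
  pr : ∀ i, Fin (net.Kpr i + 1) → ℝ
  tr : ∀ i, Fin (net.Ktr i + 1) → ℝ
  pr_nonneg : ∀ i k, 0 ≤ pr i k
  tr_nonneg : ∀ i k, 0 ≤ tr i k

variable {net} in
/-- Total cost of an allocation of resources to all nodes. -/
def Cost.total (w : net.Cost) (kpr : ∀ i, Fin (net.Kpr i + 1)) (ktr : ∀ i, Fin (net.Ktr i + 1)) :
    ℝ :=
  ∑ i, (w.pr i (kpr i) + w.tr i (ktr i))

end Network

/-! ### Channel and exogenous arrivals -/

/-- The randomness that the network is exposed to.  `ℱ t` is what is known at the beginning of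
slot `t` (possibly including randomization of the control).  The network state *during* slot `t` is
`S (t + 1)`; the state known through feedback at the beginning of slot `t`, that is, the state
during the slot before, is `S t`.  `a t` are the exogenous arrivals of slot `t`, with mean `lam`
and with fourth moments bounded by `A ^ 4`. -/
structure Environment {n M : ℕ} {𝒮 : Type} [Fintype 𝒮] (net : Network n M 𝒮) (A : ℝ)
    (lam : RateMatrix n M) {Ω : Type*} [mΩ : MeasurableSpace Ω] (μ : Measure Ω) where
  ℱ : Filtration ℕ mΩ
  S : ℕ → Ω → 𝒮
  S_adapted : ∀ t s, MeasurableSet[ℱ t] {ω | S t ω = s}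
  /-- Markov property -/
  S_markov : ∀ t s, μ[({ω | S (t + 1) ω = s}).indicator (fun _ => (1 : ℝ)) | ℱ t]
    =ᵐ[μ] fun ω => net.P (S t ω) s
  a : ℕ → Ω → RateMatrix n M
  a_nonneg : ∀ t ω i c, 0 ≤ a t ω i c
  a_adapted : ∀ t, Measurable[ℱ (t + 1)] (a t)
  /-- arrivals are i.i.d. over the slots, and independent of the past -/
  a_indep : ∀ t, Indep (MeasurableSpace.comap (a t) inferInstance) (ℱ t) μ
  a_ident : ∀ t, IdentDistrib (a t) (a 0) μ μ
  a_fourth_integrable : ∀ t i, Integrable (fun ω => (∑ c, a t ω i c) ^ 4) μ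
  a_fourth : ∀ t i, ∫ ω, (∑ c, a t ω i c) ^ 4 ∂μ ≤ A ^ 4
  a_mean : ∀ t i c, ∫ ω, a t ω i c ∂μ = lam i c

/-! ### Control algorithms, capacity region, minimum cost -/

section Control

variable {n M : ℕ} {𝒮 : Type} [Fintype 𝒮] {net : Network n M 𝒮} {A : ℝ} {lam : RateMatrix n M}
  {Ω : Type*} [mΩ : MeasurableSpace Ω] {μ : Measure Ω}

/-- A control algorithm in operation, multi-copy routing included.

Pieces of information, of arbitrarily fine granularity, are labelled by real numbers. A label stays
the same when the information is copied, forwarded or processed, so copies of the same information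
(at whatever stages) share their label.  A set `E` of labels stands for an amount
`net.scale m * volume E` of information at stage `m`. -/
structure ControlAlgorithm (env : Environment net A lam μ) where
  /-- allocated resource units: exactly one `k` (possibly `0`) for each node and slot -/
  kpr : ℕ → Ω → ∀ i, Fin (net.Kpr i + 1)
  ktr : ℕ → Ω → ∀ i, Fin (net.Ktr i + 1)
  /-- fraction of the transmission time of node `i` that is given to commodity `c` -/
  share : ℕ → Ω → Node n → Commodity n M → ℝ
  /-- these decisions are taken before the network state of the slot is revealed -/
  kpr_adapted : ∀ t i, Measurable[env.ℱ t] fun ω => kpr t ω i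
  ktr_adapted : ∀ t i, Measurable[env.ℱ t] fun ω => ktr t ω i
  share_adapted : ∀ t i c, Measurable[env.ℱ t] fun ω => share t ω i c
  share_nonneg : ∀ t ω i c, 0 ≤ share t ω i c
  share_sum : ∀ t ω i, ∑ c, share t ω i c ≤ 1
  /-- information arriving exogenously in slot `t` -/
  arrived : ℕ → Ω → Node n → Commodity n M → Set ℝ
  /-- information held by a node at the beginning of slot `t` -/
  held : ℕ → Ω → Node n → Commodity n M → Set ℝ
  /-- information that falls in partition `v` of the transmission of a node -/
  sent : ℕ → Ω → Node n → Commodity n M → Fin n → Set ℝ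
  /-- `retained t ω i j c`: information received from `i` that `j` retains -/
  retained : ℕ → Ω → Node n → Node n → Commodity n M → Set ℝ
  /-- information that a node processes in slot `t` -/
  processed : ℕ → Ω → Node n → Job n M → Set ℝ
  /-- information delivered before slot `t` -/
  delivered : ℕ → Ω → Set ℝ
  arrived_meas : ∀ t ω i c, MeasurableSet (arrived t ω i c)
  held_meas : ∀ t ω i c, MeasurableSet (held t ω i c)
  sent_meas : ∀ t ω i c v, MeasurableSet (sent t ω i c v)
  retained_meas : ∀ t ω i j c, MeasurableSet (retained t ω i j c)
  processed_meas : ∀ t ω i b, MeasurableSet (processed t ω i b)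
  arrived_size : ∀ t ω i c,
    volume (arrived t ω i c) = ENNReal.ofReal (env.a t ω i c / net.scale c.2)
  arrived_disjoint : ∀ ω, Pairwise (Function.onFun Disjoint
    fun p : ℕ × Node n × Commodity n M => arrived p.1 ω p.2.1 p.2.2)
  /-- transmission -/
  sent_subset : ∀ t ω i c v, sent t ω i c v ⊆ held t ω i c
  sent_size : ∀ t ω i c v, net.scale c.2 * volume.real (sent t ω i c v) ≤
    share t ω i c * net.partitionRate i (ktr t ω i) (env.S (t + 1) ω) v
  retained_subset : ∀ t ω i j c, retained t ω i j c ⊆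
    ⋃ v ∈ {v : Fin n | j ∈ net.receiverSet i (env.S (t + 1) ω) v}, sent t ω i c v
  /-- processing -/
  processed_subset : ∀ t ω i b, processed t ω i b ⊆ held t ω i (b.1, b.2.castSucc)
  processed_size : ∀ t ω i,
    ∑ b : Job n M, net.scale b.2.castSucc * volume.real (processed t ω i b) * net.r b.2 ≤
      net.Rpr i (kpr t ω i)
  /-- all that node `i` can have of commodity `c` at the end of slot `t` -/
  available : ℕ → Ω → Node n → Commodity n M → Set ℝ
  available_eq : ∀ t ω i c, available t ω i c =
    held t ω i c ∪ (⋃ j, retained t ω j i c) ∪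
      (⋃ m ∈ {m : Fin M | m.succ = c.2}, processed t ω i (c.1, m)) ∪ arrived t ω i c
  held_zero : ∀ ω i c, held 0 ω i c = ∅
  held_succ : ∀ t ω i c, held (t + 1) ω i c ⊆ available t ω i c
  /-- final commodities leave the network at their destination -/
  held_final : ∀ t ω d, held t ω d (d, Fin.last M) = ∅
  delivered_zero : ∀ ω, delivered 0 ω = ∅
  delivered_succ : ∀ t ω, delivered (t + 1) ω =
    delivered t ω ∪ ⋃ d, available t ω d (d, Fin.last M)
  /-- duplicates may be discarded, but information is never lost: what is in the network and has
  not been delivered is still held by some node, at some stage -/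
  no_loss : ∀ t ω i c, held t ω i c ∪ arrived t ω i c ⊆
    delivered (t + 1) ω ∪ ⋃ j, ⋃ c', held (t + 1) ω j c'

namespace ControlAlgorithm

variable {env : Environment net A lam μ} (alg : ControlAlgorithm env)

/-- Queue backlog of commodity `c` at node `i`. -/
def backlog (t : ℕ) (ω : Ω) (i : Node n) (c : Commodity n M) : ℝ :=
  net.scale c.2 * volume.real (alg.held t ω i c)

/-- Rate stability. -/
def RateStable : Prop :=
  ∀ᵐ ω ∂μ, ∀ i c, Tendsto (fun t : ℕ => alg.backlog t ω i c / t) atTop (𝓝 0)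

/-- Time-average expected cost. -/
def averageCost (w : net.Cost) : ℝ :=
  limsup (fun t : ℕ => (∑ τ ∈ Finset.range t,
    ∫ ω, w.total (alg.kpr τ ω) (alg.ktr τ ω) ∂μ) / t) atTop

end ControlAlgorithm

end Control

section Region

variable {n M : ℕ} {𝒮 : Type} [Fintype 𝒮] (net : Network n M 𝒮)

/-- The input rate matrices that some control algorithm stabilizes. -/
def Stabilizable (lam : RateMatrix n M) : Prop :=
  ∃ (Ω : Type) (_ : MeasurableSpace Ω) (μ : Measure Ω) (_ : IsProbabilityMeasure μ) (A : ℝ)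
    (env : Environment net A lam μ) (alg : ControlAlgorithm env), alg.RateStable

/-- The capacity region `Λ`. -/
def capacityRegion : Set (RateMatrix n M) := closure {lam | Stabilizable net lam}

/-- `h*(λ)`: the minimum time-average expected cost required for stability. -/
def minCost (w : net.Cost) (lam : RateMatrix n M) : ℝ :=
  sInf {H | ∃ (Ω : Type) (_ : MeasurableSpace Ω) (μ : Measure Ω) (_ : IsProbabilityMeasure μ)
    (A : ℝ) (env : Environment net A lam μ) (alg : ControlAlgorithm env),
    alg.RateStable ∧ H = alg.averageCost w}

end Region

/-! ### The DWCNC algorithm -/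

section DWCNC

variable {n M : ℕ} {𝒮 : Type} [Fintype 𝒮] (net : Network n M 𝒮)

/-- Processing utility weight. -/
def procWeight (Q : RateMatrix n M) (i : Node n) (b : Job n M) : ℝ :=
  (1 / net.r b.2) * max (Q i (b.1, b.2.castSucc) - net.ξ b.2 * Q i (b.1, b.2.succ)) 0

/-- Differential backlog weight. -/
def diffWeight (Q : RateMatrix n M) (i j : Node n) (c : Commodity n M) : ℝ :=
  max (Q i c - Q j c) 0

/-- Transmission utility weight, given the network state `sprev` of the slot before. -/
def txWeight (Q : RateMatrix n M) (sprev : 𝒮) (i : Node n) (k : Fin (net.Ktr i + 1))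
    (c : Commodity n M) : ℝ :=
  ∑ s, net.P sprev s * ∑ v : Fin n, net.partitionRate i k s v *
    (net.receiverSet i s v).sup' (net.receiverSet_nonempty i s v) (fun j => diffWeight Q i j c)

/-- Processing flow rate assigned to job `b` when `k` units and job `best` have been chosen;
nothing is processed if the chosen job has zero weight. -/
def procAssigned (Q : RateMatrix n M) (i : Node n) (k : Fin (net.Kpr i + 1)) (best b : Job n M) :
    ℝ :=
  if b = best ∧ 0 < procWeight net Q i b then net.Rpr i k / net.r b.2 else 0

/-- Transmission flow rate of commodity `c` assigned to link `(i, j)` when `k` units and commodity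
`best` have been chosen, in network state `s`, where `fwd v` is the receiver that takes over
partition `v`. -/
def txAssigned (i : Node n) (k : Fin (net.Ktr i + 1)) (best : Commodity n M) (s : 𝒮)
    (fwd : Fin n → Option (Node n)) (j : Node n) (c : Commodity n M) : ℝ :=
  if c = best then ∑ v, if fwd v = some j then net.partitionRate i k s v else 0 else 0

/-- Forwarding decision for partition `v` of commodity `c`: a receiver in `Ω_{i,v}(s)` with the
largest positive differential backlog; if there is none, node `i` keeps the information. -/
def IsForwarding (Q : RateMatrix n M) (i : Node n) (c : Commodity n M) (s : 𝒮) (v : Fin n) :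
    Option (Node n) → Prop
  | none => ∀ j ∈ net.receiverSet i s v, diffWeight Q i j c = 0
  | some j => j ∈ net.receiverSet i s v ∧ 0 < diffWeight Q i j c ∧
      ∀ j' ∈ net.receiverSet i s v, diffWeight Q i j' c ≤ diffWeight Q i j c

variable {net} {A : ℝ} {lam : RateMatrix n M} {Ω : Type*} [mΩ : MeasurableSpace Ω] {μ : Measure Ω}

/-- The network under the DWCNC algorithm with control parameter `V` (ties broken in any
non-anticipating way). -/
structure DWCNCRun (env : Environment net A lam μ) (w : net.Cost) (V : ℝ) where
  /-- queue backlogs at the beginning of slot `t` -/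
  Q : ℕ → Ω → RateMatrix n M
  kpr : ℕ → Ω → ∀ i, Fin (net.Kpr i + 1)
  ktr : ℕ → Ω → ∀ i, Fin (net.Ktr i + 1)
  /-- the job that is processed and the commodity that is transmitted -/
  bestPr : ℕ → Ω → Node n → Job n M
  bestTr : ℕ → Ω → Node n → Commodity n M
  /-- forwarding decisions -/
  fwd : ℕ → Ω → Node n → Fin n → Option (Node n)
  /-- amounts of information that are really transmitted and processed -/
  flowTr : ℕ → Ω → Node n → Node n → Commodity n M → ℝ
  flowPr : ℕ → Ω → Node n → Job n M → ℝ
  Q_adapted : ∀ t, Measurable[env.ℱ t] (Q t)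
  kpr_adapted : ∀ t i, Measurable[env.ℱ t] fun ω => kpr t ω i
  ktr_adapted : ∀ t i, Measurable[env.ℱ t] fun ω => ktr t ω i
  bestPr_adapted : ∀ t i, Measurable[env.ℱ t] fun ω => bestPr t ω i
  bestTr_adapted : ∀ t i, Measurable[env.ℱ t] fun ω => bestTr t ω i
  /-- processing decision -/
  pr_max : ∀ t ω i k b,
    net.Rpr i k * procWeight net (Q t ω) i b - V * w.pr i k ≤
      net.Rpr i (kpr t ω i) * procWeight net (Q t ω) i (bestPr t ω i) - V * w.pr i (kpr t ω i)
  /-- transmission decision -/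
  tr_max : ∀ t ω i k c,
    txWeight net (Q t ω) (env.S t ω) i k c - V * w.tr i k ≤
      txWeight net (Q t ω) (env.S t ω) i (ktr t ω i) (bestTr t ω i) - V * w.tr i (ktr t ω i)
  /-- forwarding decision, after the network state of the slot has been revealed -/
  fwd_spec : ∀ t ω i v,
    IsForwarding net (Q t ω) i (bestTr t ω i) (env.S (t + 1) ω) v (fwd t ω i v)
  /-- the flows are the assigned flow rates, cut down if there is not enough in the queue -/
  flowTr_nonneg : ∀ t ω i j c, 0 ≤ flowTr t ω i j c
  flowPr_nonneg : ∀ t ω i b, 0 ≤ flowPr t ω i b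
  flowTr_le : ∀ t ω i j c, flowTr t ω i j c ≤
    txAssigned net i (ktr t ω i) (bestTr t ω i) (env.S (t + 1) ω) (fwd t ω i) j c
  flowPr_le : ∀ t ω i b, flowPr t ω i b ≤
    procAssigned net (Q t ω) i (kpr t ω i) (bestPr t ω i) b
  flow_total : ∀ t ω i (c : Commodity n M),
    ∑ j, flowTr t ω i j c + ∑ m : Fin M, (if m.castSucc = c.2 then flowPr t ω i (c.1, m) else 0) =
      min (Q t ω i c)
        (∑ j, txAssigned net i (ktr t ω i) (bestTr t ω i) (env.S (t + 1) ω) (fwd t ω i) j c +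
          ∑ m : Fin M, if m.castSucc = c.2 then
            procAssigned net (Q t ω) i (kpr t ω i) (bestPr t ω i) (c.1, m) else 0)
  /-- queue dynamics -/
  Q_zero_nonneg : ∀ ω i c, 0 ≤ Q 0 ω i c
  Q_final : ∀ t ω d, Q t ω d (d, Fin.last M) = 0
  Q_succ : ∀ t ω i (c : Commodity n M), ¬ (c = (i, Fin.last M)) →
    Q (t + 1) ω i c = Q t ω i c
      - (∑ j, flowTr t ω i j c +
          ∑ m : Fin M, if m.castSucc = c.2 then flowPr t ω i (c.1, m) else 0)
      + ∑ j, flowTr t ω j i c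
      + (∑ m : Fin M, if m.succ = c.2 then net.ξ m * flowPr t ω i (c.1, m) else 0)
      + env.a t ω i c

namespace DWCNCRun

variable {env : Environment net A lam μ} {w : net.Cost} {V : ℝ} (run : DWCNCRun env w V)

/-- Time-average cost over the first `t` slots. -/
def averageCost (t : ℕ) (ω : Ω) : ℝ :=
  (∑ τ ∈ Finset.range t, w.total (run.kpr τ ω) (run.ktr τ ω)) / t

/-- Time-average total queue backlog over the first `t` slots. -/
def averageBacklog (t : ℕ) (ω : Ω) : ℝ :=
  (∑ τ ∈ Finset.range t, ∑ i, ∑ c, run.Q τ ω i c) / t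

end DWCNCRun

end DWCNC

end WirelessComputing

end

/-!
The proof is a duality argument. A *price* is a matrix `q` of the same kind as the backlogs
(`IsWeight`): nonnegative, and zero for a final commodity at its destination. At prices `q`,
processing and transmitting information changes its price, and `slotValue w V q s` is the largest
expected amount by which a slot can lower the total price, minus `V` times the cost of doing so,
when the last network state is `s`; `meanValue w V q` is its average over the stationary
distribution.

*Converse* (`ControlAlgorithm.pairing_le`). If a control algorithm stabilizes the rates `lam`, then
the price `pairing q lam` of the arrivals of a slot is at most
`meanValue w V q + V * averageCost`, for all prices and all `V ≥ 0`. This is proved label by label: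
every copy of a label is worth at least the price at which the label arrived minus what the
transmissions and the processing that involved this label can have taken off
(`labelArrivals_le_aux`). The label is never lost, and is worth nothing once delivered, so that
keeping several copies gains nothing. Integrating over the labels, and averaging over time with the
ergodic theorem for the network state, gives the inequality; without the cost of the algorithm on
the right-hand side it survives the closure in the definition of the capacity region
(`pairing_le_of_mem_capacityRegion`).

*Drift*. DWCNC chooses in every slot a decision that attains `slotValue` at the prices `q = Q`
(`DWCNCRun.toMaxWeight`). The Lyapunov function `∑ Q ^ 2 / 2`, corrected by a solution of the Poisson
equation to account for the memory of the channel, satisfies on every path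
`potential (t + 1) + V * cost ≤ potential t + N * B + pairing Q lam - meanValue w V Q + noise`
(`MaxWeightProcess.potential_succ_le`). The correction is Lipschitz in `Q` with a constant that does
not depend on the costs or on `V`, and vanishes for a memoryless channel, whence the explicit `B`.
The inequalities of the converse are exactly what bounds `pairing Q lam - meanValue w V Q`. The noise
is a martingale difference with coefficients of the size of the backlogs. As these grow at most
linearly, it is negligible with respect to `t ^ 2`, which gives stability; when
`lam + ε` is in the capacity region, the drift of the square of the Lyapunov function shows
`∑ (Q t) ^ 2 / (t + 1) ^ 2 < ∞` (`ae_summable_sq_of_drift`), so that the noise is negligible with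
respect to `t` and the time averages of costs and backlogs obey the drift bound
(`MaxWeightProcess.exists_average_le`). The initial backlogs need not be integrable for this.

*Achievability* (`exists_averageCost_le`). In the bounds, the cost of comparison must be the minimum
cost, and for the backlogs also a lower bound for the costs of DWCNC along almost every path is
needed. Both follow once the inequalities of the converse are known to characterise the minimum cost
(`minCost_le`). To see this, rates that satisfy the inequalities are stabilized by running the
max-weight decisions on virtual backlogs driven by the network states alone, with constant arrivals;
this is a control algorithm whose real backlogs are at most the virtual ones, and whose
cost exceeds the claimed one by `O(1 / V)`. Hence any cost below the minimum is refuted by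
some prices, and these prices refute it along almost every path of DWCNC
(`DWCNCRun.ae_minCost_lt`).
-/

open MeasureTheory ProbabilityTheory Filter Topology

noncomputable section

namespace WirelessComputing

/-! ### Martingale differences -/

/-- Kronecker's lemma. -/
theorem tendsto_sum_div_of_tendsto_sum {b x : ℕ → ℝ} (hb : Monotone b) (hpos : ∀ t, 0 < b t)
    (hlim : Tendsto b atTop atTop) {y : ℝ}
    (h : Tendsto (fun t => ∑ τ ∈ Finset.range t, x τ / b τ) atTop (𝓝 y)) :
    Tendsto (fun t => (∑ τ ∈ Finset.range t, x τ) / b t) atTop (𝓝 0) := by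
  set Y : ℕ → ℝ := fun t => ∑ τ ∈ Finset.range t, x τ / b τ with hY
  have key : ∀ t, ∑ τ ∈ Finset.range t, x τ = b t * (Y t - y) + b 0 * y -
      ∑ τ ∈ Finset.range t, (b (τ + 1) - b τ) * (Y (τ + 1) - y) := by
    intro t
    induction t with
    | zero => simp [hY]
    | succ t ih =>
      have h1 : Y (t + 1) = Y t + x t / b t := by simp [hY, Finset.sum_range_succ]
      have h2 : b t * (x t / b t) = x t := by field_simp [(hpos t).ne']
      rw [Finset.sum_range_succ, ih, Finset.sum_range_succ, h1]
      linear_combination -h2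
  have hY0 : Tendsto (fun t => Y t - y) atTop (𝓝 0) := by
    simpa using h.sub_const y
  have hsum : Tendsto (fun t => ∑ τ ∈ Finset.range t, (b (τ + 1) - b τ)) atTop atTop := by
    simp_rw [Finset.sum_range_sub]
    exact tendsto_atTop_add_const_right _ _ hlim
  have ho : (fun t => ∑ τ ∈ Finset.range t, (b (τ + 1) - b τ) * (Y (τ + 1) - y)) =o[atTop]
      fun t => ∑ τ ∈ Finset.range t, (b (τ + 1) - b τ) := by
    refine Asymptotics.IsLittleO.sum_range ?_ (fun τ => sub_nonneg.2 (hb (Nat.le_succ τ))) hsum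
    have := (Asymptotics.isLittleO_one_iff (F := ℝ)).2
      (hY0.comp (tendsto_add_atTop_nat 1))
    simpa using (Asymptotics.isBigO_refl (fun τ => b (τ + 1) - b τ) atTop).mul_isLittleO this
  have ho' : (fun t => ∑ τ ∈ Finset.range t, (b (τ + 1) - b τ) * (Y (τ + 1) - y)) =o[atTop] b := by
    refine ho.trans_isBigO (Asymptotics.IsBigO.of_bound 1 (Eventually.of_forall fun t => ?_))
    rw [Finset.sum_range_sub, Real.norm_of_nonneg (sub_nonneg.2 (hb (Nat.zero_le t))),
      Real.norm_of_nonneg (hpos t).le]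
    linarith [hpos 0]
  have h3 := ho'.tendsto_div_nhds_zero
  have h4 : Tendsto (fun t => b 0 * y / b t) atTop (𝓝 0) := hlim.const_div_atTop _
  have := (hY0.add h4).sub h3
  simp only [add_zero, sub_zero] at this
  refine this.congr fun t => ?_
  rw [key t]
  field_simp [(hpos t).ne']

/-- `ξ t` is a martingale difference, revealed between the times `t` and `t + 1`, whose
conditional variance given the past is at most `v`. -/
structure IsNoise {Ω : Type*} [mΩ : MeasurableSpace Ω] (μ : Measure Ω) (ℱ : Filtration ℕ mΩ)
    (ξ : ℕ → Ω → ℝ) (v : ℝ) : Prop where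
  meas : ∀ t, StronglyMeasurable[ℱ (t + 1)] (ξ t)
  memLp : ∀ t, MemLp (ξ t) 2 μ
  condExp : ∀ t, μ[ξ t | ℱ t] =ᵐ[μ] 0
  condExp_sq : ∀ t, μ[fun ω => ξ t ω ^ 2 | ℱ t] ≤ᵐ[μ] fun _ => v

namespace IsNoise

variable {Ω : Type*} [mΩ : MeasurableSpace Ω] {μ : Measure Ω} [IsProbabilityMeasure μ]
  {ℱ : Filtration ℕ mΩ} {ξ : ℕ → Ω → ℝ} {v : ℝ}

theorem nonneg (h : IsNoise μ ℱ ξ v) : 0 ≤ v := by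
  have h1 : 0 ≤ᵐ[μ] μ[fun ω => ξ 0 ω ^ 2 | ℱ 0] :=
    condExp_nonneg (Eventually.of_forall fun ω => sq_nonneg _)
  obtain ⟨ω, h2, h3⟩ := (h1.and (h.condExp_sq 0)).exists
  exact h2.trans h3

theorem integrable (h : IsNoise μ ℱ ξ v) (t : ℕ) : Integrable (ξ t) μ :=
  (h.memLp t).integrable (by norm_num)

theorem integrable_mul (h : IsNoise μ ℱ ξ v) {t : ℕ} {c : Ω → ℝ} (hc : StronglyMeasurable[ℱ t] c)
    {K : ℝ} (hK : ∀ ω, |c ω| ≤ K) : Integrable (fun ω => c ω * ξ t ω) μ :=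
  (h.integrable t).bdd_mul (hc.mono (ℱ.le t)).aestronglyMeasurable
    (Eventually.of_forall hK)

theorem integral_mul_eq_zero (h : IsNoise μ ℱ ξ v) {t : ℕ} {c : Ω → ℝ}
    (hc : StronglyMeasurable[ℱ t] c) (hi : Integrable (fun ω => c ω * ξ t ω) μ) :
    ∫ ω, c ω * ξ t ω ∂μ = 0 := by
  have h1 : μ[c * ξ t | ℱ t] =ᵐ[μ] 0 := by
    filter_upwards [condExp_mul_of_stronglyMeasurable_left hc hi (h.integrable t), h.condExp t]
      with ω h1 h2
    rw [h1, Pi.mul_apply, h2]; simp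
  calc ∫ ω, c ω * ξ t ω ∂μ = ∫ ω, (c * ξ t) ω ∂μ := rfl
    _ = ∫ ω, (μ[c * ξ t | ℱ t]) ω ∂μ := (integral_condExp (ℱ.le t)).symm
    _ = 0 := by rw [integral_congr_ae h1]; simp

omit [IsProbabilityMeasure μ] in
theorem integrable_sq_mul (h : IsNoise μ ℱ ξ v) {t : ℕ} {c : Ω → ℝ}
    (hc : StronglyMeasurable[ℱ t] c) {K : ℝ} (hK : ∀ ω, |c ω| ≤ K) :
    Integrable (fun ω => c ω ^ 2 * ξ t ω ^ 2) μ := by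
  refine (h.memLp t).integrable_sq.bdd_mul (c := K ^ 2)
    ((hc.mono (ℱ.le t)).aestronglyMeasurable.pow 2) (Eventually.of_forall fun ω => ?_)
  rw [Real.norm_eq_abs, abs_pow]
  exact pow_le_pow_left₀ (abs_nonneg _) (hK ω) 2

theorem integral_sq_mul_le (h : IsNoise μ ℱ ξ v) {t : ℕ} {c : Ω → ℝ}
    (hc : StronglyMeasurable[ℱ t] c) {K : ℝ} (hK : ∀ ω, |c ω| ≤ K) :
    ∫ ω, c ω ^ 2 * ξ t ω ^ 2 ∂μ ≤ v * ∫ ω, c ω ^ 2 ∂μ := by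
  have hi := h.integrable_sq_mul hc hK
  have hc2 : StronglyMeasurable[ℱ t] fun ω => c ω ^ 2 := hc.pow 2
  have hci : Integrable (fun ω => c ω ^ 2) μ := by
    refine Integrable.of_bound (hc2.mono (ℱ.le t)).aestronglyMeasurable (K ^ 2)
      (Eventually.of_forall fun ω => ?_)
    rw [Real.norm_eq_abs, abs_pow]
    exact pow_le_pow_left₀ (abs_nonneg _) (hK ω) 2
  have h1 : μ[fun ω => c ω ^ 2 * ξ t ω ^ 2 | ℱ t] ≤ᵐ[μ] fun ω => v * c ω ^ 2 := by
    filter_upwards [condExp_mul_of_stronglyMeasurable_left (g := fun ω => ξ t ω ^ 2) hc2 hi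
      (h.memLp t).integrable_sq, h.condExp_sq t] with ω h1 h2
    refine h1.le.trans ?_
    rw [Pi.mul_apply, mul_comm]
    exact mul_le_mul_of_nonneg_right h2 (sq_nonneg _)
  calc ∫ ω, c ω ^ 2 * ξ t ω ^ 2 ∂μ
      = ∫ ω, (μ[fun ω => c ω ^ 2 * ξ t ω ^ 2 | ℱ t]) ω ∂μ := (integral_condExp (ℱ.le t)).symm
    _ ≤ ∫ ω, v * c ω ^ 2 ∂μ := integral_mono_ae integrable_condExp (hci.const_mul v) h1
    _ = v * ∫ ω, c ω ^ 2 ∂μ := integral_const_mul _ _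

/-- A martingale transform with square summable coefficients converges almost surely. -/
theorem exists_tendsto_sum (h : IsNoise μ ℱ ξ v) {c : ℕ → Ω → ℝ}
    (hc : ∀ t, StronglyMeasurable[ℱ t] (c t)) {K : ℝ}
    (hK : ∀ t ω, ∑ τ ∈ Finset.range t, c τ ω ^ 2 ≤ K) :
    ∀ᵐ ω ∂μ, ∃ y, Tendsto (fun t => ∑ τ ∈ Finset.range t, c τ ω * ξ τ ω) atTop (𝓝 y) := by
  have hcK : ∀ t ω, |c t ω| ≤ √K := fun t ω => by
    refine Real.abs_le_sqrt (le_trans ?_ (hK (t + 1) ω))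
    exact Finset.single_le_sum (f := fun τ => c τ ω ^ 2) (fun _ _ => sq_nonneg _)
      (Finset.self_mem_range_succ t)
  have hK0 : 0 ≤ K := by
    obtain ⟨ω⟩ : Nonempty Ω := nonempty_of_isProbabilityMeasure μ
    simpa using hK 0 ω
  set Y : ℕ → Ω → ℝ := fun t ω => ∑ τ ∈ Finset.range t, c τ ω * ξ τ ω with hYdef
  have hYs : ∀ t, Y (t + 1) = fun ω => Y t ω + c t ω * ξ t ω := fun t => by
    ext ω; simp [hYdef, Finset.sum_range_succ]
  have hYm : ∀ t, StronglyMeasurable[ℱ t] (Y t) := by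
    intro t
    refine Finset.stronglyMeasurable_fun_sum _ fun τ hτ => ?_
    have hτ' := Finset.mem_range.1 hτ
    exact ((hc τ).mono (ℱ.mono hτ'.le)).mul ((h.meas τ).mono (ℱ.mono hτ'))
  have hcL : ∀ t, MemLp (fun ω => c t ω * ξ t ω) 2 μ := fun t => by
    refine (h.memLp t).of_le_mul (c := √K) (((hc t).mono (ℱ.le _)).mul
      ((h.meas t).mono (ℱ.le _))).aestronglyMeasurable (Eventually.of_forall fun ω => ?_)
    rw [norm_mul]
    exact mul_le_mul_of_nonneg_right (hcK t ω) (norm_nonneg _)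
  have hYL : ∀ t, MemLp (Y t) 2 μ := fun t => memLp_finsetSum _ fun τ _ => hcL τ
  have hYi : ∀ t, Integrable (Y t) μ := fun t => (hYL t).integrable (by norm_num)
  have hmart : Martingale Y ℱ μ := by
    refine martingale_of_condExp_sub_eq_zero_nat hYm hYi fun t => ?_
    have h1 : Y (t + 1) - Y t = c t * ξ t := by
      rw [hYs]; ext ω; simp
    rw [h1]
    filter_upwards [condExp_mul_of_stronglyMeasurable_left (hc t)
      (h.integrable_mul (hc t) (hcK t)) (h.integrable t), h.condExp t] with ω h1 h2
    rw [h1, Pi.mul_apply, h2]; simp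
  have hci : ∀ t, Integrable (fun ω => c t ω ^ 2) μ := fun t => by
    refine Integrable.of_bound (((hc t).pow 2).mono (ℱ.le t)).aestronglyMeasurable (√K ^ 2)
      (Eventually.of_forall fun ω => ?_)
    rw [Real.norm_eq_abs, abs_pow]
    exact pow_le_pow_left₀ (abs_nonneg _) (hcK t ω) 2
  have hsq : ∀ t, ∫ ω, Y t ω ^ 2 ∂μ ≤ v * ∫ ω, ∑ τ ∈ Finset.range t, c τ ω ^ 2 ∂μ := by
    intro t
    induction t with
    | zero => simp [hYdef]
    | succ t ih =>
      have hYc : Integrable (fun ω => (2 * Y t ω * c t ω) * ξ t ω) μ := by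
        have := ((hYL t).const_mul 2).integrable_mul (hcL t)
        refine this.congr (Eventually.of_forall fun ω => ?_)
        simp only [Pi.mul_apply]; ring
      have h0 := h.integral_mul_eq_zero
        ((stronglyMeasurable_const (β := ℝ) (b := 2)).mul (hYm t) |>.mul (hc t)) hYc
      have h0' : ∫ ω, 2 * Y t ω * c t ω * ξ t ω ∂μ = 0 := h0
      have h1 : ∀ ω, Y (t + 1) ω ^ 2 =
          Y t ω ^ 2 + 2 * Y t ω * c t ω * ξ t ω + c t ω ^ 2 * ξ t ω ^ 2 := fun ω => by
        rw [hYs]; ring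
      simp_rw [h1, Finset.sum_range_succ]
      have i1 := (hYL t).integrable_sq
      have i2 := h.integrable_sq_mul (hc t) (hcK t)
      have i12 : Integrable (fun ω => Y t ω ^ 2 + 2 * Y t ω * c t ω * ξ t ω) μ := i1.add hYc
      rw [integral_add i12 i2, integral_add i1 hYc, h0',
        integral_add (integrable_finsetSum _ fun τ _ => hci τ) (hci t), mul_add]
      linarith [h.integral_sq_mul_le (hc t) (hcK t)]
  have hbd : ∀ t, ∫ ω, ‖Y t ω‖ ∂μ ≤ 1 + v * K := by
    intro t
    have h1 : ∫ ω, ‖Y t ω‖ ∂μ ≤ ∫ ω, (1 + Y t ω ^ 2) ∂μ := by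
      refine integral_mono (hYi t).norm ((integrable_const _).add (hYL t).integrable_sq) fun ω => ?_
      rw [Real.norm_eq_abs]
      nlinarith [sq_abs (Y t ω), sq_nonneg (|Y t ω| - 1), abs_nonneg (Y t ω)]
    have h2 : ∫ ω, ∑ τ ∈ Finset.range t, c τ ω ^ 2 ∂μ ≤ K := by
      calc _ ≤ ∫ _ω, K ∂μ := integral_mono (integrable_finsetSum _ fun τ _ => hci τ)
            (integrable_const _) fun ω => hK t ω
        _ = K := by simp
    rw [integral_add (integrable_const _) (hYL t).integrable_sq] at h1
    have h3 := (hsq t).trans (mul_le_mul_of_nonneg_left h2 h.nonneg)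
    simp at h1
    simp only [Real.norm_eq_abs]
    linarith
  have := hmart.submartingale.ae_tendsto_limitProcess (R := (1 + v * K).toNNReal) fun t => by
    rw [eLpNorm_one_eq_lintegral_enorm, ← ofReal_integral_norm_eq_lintegral_enorm (hYi t)]
    exact ENNReal.ofReal_le_ofReal (hbd t)
  filter_upwards [this] with ω hω
  exact ⟨_, hω⟩

/-- Strong law of large numbers for martingale transforms, with normalising sequence `b`. -/
theorem tendsto_sum_div (h : IsNoise μ ℱ ξ v) {β : ℕ → Ω → ℝ}
    (hβ : ∀ t, StronglyMeasurable[ℱ t] (β t)) {b : ℕ → ℝ} (hb : Monotone b) (hpos : ∀ t, 0 < b t)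
    (hlim : Tendsto b atTop atTop) (hs : ∀ᵐ ω ∂μ, Summable fun t => (β t ω / b t) ^ 2) :
    ∀ᵐ ω ∂μ, Tendsto (fun t => (∑ τ ∈ Finset.range t, β τ ω * ξ τ ω) / b t) atTop (𝓝 0) := by
  classical
  set P : ℕ → Ω → ℝ := fun t ω => ∑ τ ∈ Finset.range (t + 1), (β τ ω / b τ) ^ 2 with hP
  have hPm : ∀ t, StronglyMeasurable[ℱ t] (P t) := fun t =>
    Finset.stronglyMeasurable_fun_sum _ fun τ hτ =>
      (((hβ τ).mono (ℱ.mono (Nat.lt_succ_iff.1 (Finset.mem_range.1 hτ)))).div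
        stronglyMeasurable_const).pow 2
  -- coefficients switched off once their running sum of squares exceeds `K`
  set c : ℕ → ℕ → Ω → ℝ := fun K t => {ω | P t ω ≤ K}.indicator fun ω => β t ω / b t with hc
  have hcm : ∀ K t, StronglyMeasurable[ℱ t] (c K t) := fun K t =>
    ((hβ t).div stronglyMeasurable_const).indicator
      (measurableSet_le (hPm t).measurable measurable_const)
  have hcK : ∀ (K t : ℕ) ω, ∑ τ ∈ Finset.range t, c K τ ω ^ 2 ≤ K := by
    intro K t ω
    induction t with
    | zero => simp
    | succ t ih =>
      by_cases hk : P t ω ≤ K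
      · refine le_trans (Finset.sum_le_sum fun τ _ => ?_) hk
        simp only [hc, Set.indicator_apply]
        split_ifs
        · exact le_rfl
        · simpa using sq_nonneg (β τ ω / b τ)
      · rw [Finset.sum_range_succ]
        simpa [hc, hk] using ih
  have hall : ∀ᵐ ω ∂μ, ∀ K : ℕ, ∃ y, Tendsto
      (fun t => ∑ τ ∈ Finset.range t, c K τ ω * ξ τ ω) atTop (𝓝 y) :=
    ae_all_iff.2 fun K => h.exists_tendsto_sum (hcm K) (hcK K)
  filter_upwards [hall, hs] with ω hω hsum
  obtain ⟨K, hK⟩ := exists_nat_ge (∑' t, (β t ω / b t) ^ 2)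
  obtain ⟨y, hy⟩ := hω K
  have hcβ : ∀ t, c K t ω = β t ω / b t := fun t => by
    have : P t ω ≤ K := (hsum.sum_le_tsum _ fun _ _ => sq_nonneg _).trans hK
    simp [hc, this]
  refine tendsto_sum_div_of_tendsto_sum hb hpos hlim (y := y) (hy.congr fun t => ?_)
  refine Finset.sum_congr rfl fun τ _ => ?_
  rw [hcβ]; ring

end IsNoise

/-- The cubic term wins: the scalar inequality behind the drift of the square of a Lyapunov
function. -/
theorem exists_sq_drift_bound {C ε : ℝ} (hC : 0 < C) (hε : 0 < ε) {D : ℝ} (hD : 0 ≤ D) :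
    ∃ C' : ℝ, 0 ≤ C' ∧ ∀ x u : ℝ, 0 ≤ x → x ^ 2 ≤ C * u → u ≤ C * (1 + x ^ 2) →
      2 * u * (C - ε * x) + 2 * (C - ε * x) ^ 2 + D * (1 + x) ^ 2 ≤ C' - x ^ 2 := by
  set p : ℝ := 2 * C ^ 2 + 4 * C ^ 2 + 4 * ε ^ 2 + 2 * D + 1 with hp
  have hp0 : 0 < p := by positivity
  set k : ℝ := 2 * ε / C with hk
  have hk0 : 0 < k := by positivity
  refine ⟨p + p ^ 3 / k ^ 2, by positivity, fun x u hx h1 h2 => ?_⟩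
  have hu : k * x ^ 3 ≤ 2 * ε * x * u := by
    have : k * x ^ 3 = 2 * ε * x * (x ^ 2 / C) := by rw [hk]; field_simp
    rw [this]
    exact mul_le_mul_of_nonneg_left ((div_le_iff₀' hC).2 h1) (by positivity)
  have hcub : p * x ^ 2 - k * x ^ 3 ≤ p ^ 3 / k ^ 2 := by
    by_cases hxk : p ≤ k * x
    · have : p * x ^ 2 - k * x ^ 3 ≤ 0 := by nlinarith [sq_nonneg x]
      exact this.trans (by positivity)
    · have hx' : x ≤ p / k := (le_div_iff₀' hk0).2 (le_of_not_ge hxk)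
      have h3 : x ^ 2 ≤ (p / k) ^ 2 := pow_le_pow_left₀ hx hx' 2
      have h4 : p * (p / k) ^ 2 = p ^ 3 / k ^ 2 := by field_simp
      have h5 : 0 ≤ k * x ^ 3 := by positivity
      nlinarith
  have h6 : 2 * u * C ≤ 2 * C ^ 2 * (1 + x ^ 2) := by nlinarith
  have h7 : 2 * (C - ε * x) ^ 2 ≤ 4 * C ^ 2 + 4 * ε ^ 2 * x ^ 2 := by
    nlinarith [sq_nonneg (C + ε * x)]
  have h8 : D * (1 + x) ^ 2 ≤ D * (2 + 2 * x ^ 2) :=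
    mul_le_mul_of_nonneg_left (by nlinarith [sq_nonneg (1 - x)]) hD
  have h9 : 0 ≤ C ^ 2 * x ^ 2 := by positivity
  have h10 : 0 ≤ ε ^ 2 := by positivity
  nlinarith

/-- A process `X` whose quadratic Lyapunov function `U` has drift `C - ε X` and noise of size `X`
satisfies `∑ X_t² / (t + 1)² < ∞`, whatever the distribution of `X_0`. The reason is that the
drift of `U²` is at most `C' - X²`. -/
theorem ae_summable_sq_of_drift {Ω κ : Type*} [mΩ : MeasurableSpace Ω] {μ : Measure Ω}
    [IsProbabilityMeasure μ] {ℱ : Filtration ℕ mΩ} [Fintype κ] {ξ : κ → ℕ → Ω → ℝ} {v : κ → ℝ}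
    (hξ : ∀ k, IsNoise μ ℱ (ξ k) (v k)) {X U : ℕ → Ω → ℝ} {β : κ → ℕ → Ω → ℝ}
    (hX : ∀ t, StronglyMeasurable[ℱ t] (X t)) (hU : ∀ t, StronglyMeasurable[ℱ t] (U t))
    (hβ : ∀ k t, StronglyMeasurable[ℱ t] (β k t)) {C ε : ℝ} (hC : 0 < C) (hε : 0 < ε)
    (hX0 : ∀ t ω, 0 ≤ X t ω) (hβX : ∀ k t ω, |β k t ω| ≤ C * (1 + X t ω))
    (hXU : ∀ t ω, X t ω ^ 2 ≤ C * U t ω) (hUX : ∀ t ω, U t ω ≤ C * (1 + X t ω ^ 2))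
    (hdrift : ∀ t ω, U (t + 1) ω ≤ U t ω + (C - ε * X t ω) + ∑ k, β k t ω * ξ k t ω) :
    ∀ᵐ ω ∂μ, Summable fun t : ℕ => (X t ω / (t + 1)) ^ 2 := by
  classical
  have hU0 : ∀ t ω, 0 ≤ U t ω := fun t ω =>
    nonneg_of_mul_nonneg_right ((sq_nonneg _).trans (hXU t ω)) hC
  have hv : ∀ k, 0 ≤ v k := fun k => (hξ k).nonneg
  set m : ℝ := (Fintype.card κ : ℝ) with hm
  obtain ⟨C', hC', hbound⟩ := exists_sq_drift_bound hC hε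
    (D := 2 * m * (∑ k, v k) * C ^ 2)
    (mul_nonneg (mul_nonneg (by positivity) (Finset.sum_nonneg fun k _ => hv k)) (sq_nonneg _))
  -- `s` normalises away the initial condition, `I K t` stops the process when it exceeds `K`
  set s : Ω → ℝ := fun ω => 1 / (1 + U 0 ω) with hs
  have hs0 : ∀ ω, 0 < s ω := fun ω => by have := hU0 0 ω; simp only [hs]; positivity
  have hs1 : ∀ ω, s ω ≤ 1 := fun ω => by
    have := hU0 0 ω
    exact (div_le_one (by positivity)).2 (by linarith)
  have hsm : ∀ t, StronglyMeasurable[ℱ t] s := fun t =>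
    stronglyMeasurable_const.div (stronglyMeasurable_const.add ((hU 0).mono (ℱ.mono (Nat.zero_le t))))
  set G : ℕ → ℕ → Set Ω := fun K t => {ω | ∀ τ ∈ Finset.range (t + 1), X τ ω ≤ K} with hG
  have hGm : ∀ K t, MeasurableSet[ℱ t] (G K t) := fun K t => by
    have : G K t = ⋂ τ ∈ Finset.range (t + 1), {ω | X τ ω ≤ K} := by ext; simp [hG]
    rw [this]
    refine Finset.measurableSet_biInter _ fun τ hτ => ?_
    exact measurableSet_le (((hX τ).mono
      (ℱ.mono (Nat.lt_succ_iff.1 (Finset.mem_range.1 hτ)))).measurable) measurable_const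
  set I : ℕ → ℕ → Ω → ℝ := fun K t => (G K t).indicator fun _ => 1 with hI
  have hIm : ∀ K t, StronglyMeasurable[ℱ t] (I K t) := fun K t =>
    stronglyMeasurable_const.indicator (hGm K t)
  have hI01 : ∀ K t ω, I K t ω = 0 ∨ (I K t ω = 1 ∧ X t ω ≤ K) := fun K t ω => by
    by_cases h : ω ∈ G K t
    · right; exact ⟨by simp [hI, h], h t (by simp)⟩
    · left; simp [hI, h]
  have hIanti : ∀ K t ω, I K (t + 1) ω ≤ I K t ω := fun K t ω => by
    by_cases h : ω ∈ G K (t + 1)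
    · have h' : ω ∈ G K t := fun τ hτ =>
        h τ (Finset.mem_range.2 ((Finset.mem_range.1 hτ).trans (Nat.lt_succ_self _)))
      simp [hI, h, h']
    · simp only [hI, Set.indicator_of_notMem h]
      exact Set.indicator_nonneg (fun _ _ => zero_le_one) _
  have hUb : ∀ K t ω, X t ω ≤ (K : ℕ) → U t ω ≤ C * (1 + (K : ℝ) ^ 2) := fun K t ω h =>
    (hUX t ω).trans (mul_le_mul_of_nonneg_left
      (by linarith [pow_le_pow_left₀ (hX0 t ω) h 2]) hC.le)
  -- the stopped and normalised `U²`, whose drift is at most `C' - e`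
  set f : ℕ → ℕ → Ω → ℝ := fun K t ω => s ω ^ 2 * I K t ω * U t ω ^ 2 with hf
  set e : ℕ → ℕ → Ω → ℝ := fun K t ω => s ω ^ 2 * I K t ω * X t ω ^ 2 with he
  have hint : ∀ (g : Ω → ℝ) t, StronglyMeasurable[ℱ t] g → ∀ R, (∀ ω, |g ω| ≤ R) →
      Integrable g μ := fun g t hg R hR =>
    Integrable.of_bound (hg.mono (ℱ.le t)).aestronglyMeasurable R (Eventually.of_forall hR)
  have hs2 : ∀ ω, s ω ^ 2 ≤ 1 := fun ω => pow_le_one₀ (hs0 ω).le (hs1 ω)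
  have hfi : ∀ K t, Integrable (f K t) μ := fun K t => by
    refine hint _ t ((((hsm t).pow 2).mul (hIm K t)).mul ((hU t).pow 2))
      ((C * (1 + (K : ℝ) ^ 2)) ^ 2) fun ω => ?_
    rcases hI01 K t ω with h | ⟨h, hx⟩
    · simp only [hf, h, mul_zero, zero_mul, abs_zero]; positivity
    · simp only [hf, h, mul_one]
      rw [abs_of_nonneg (by positivity)]
      exact (mul_le_of_le_one_left (sq_nonneg _) (hs2 ω)).trans
        (pow_le_pow_left₀ (hU0 t ω) (hUb K t ω hx) 2)
  have hei : ∀ K t, Integrable (e K t) μ := fun K t => by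
    refine hint _ t ((((hsm t).pow 2).mul (hIm K t)).mul ((hX t).pow 2))
      ((K : ℝ) ^ 2) fun ω => ?_
    rcases hI01 K t ω with h | ⟨h, hx⟩
    · simp only [he, h, mul_zero, zero_mul, abs_zero]; positivity
    · simp only [he, h, mul_one]
      rw [abs_of_nonneg (by positivity)]
      exact (mul_le_of_le_one_left (sq_nonneg _) (hs2 ω)).trans
        (pow_le_pow_left₀ (hX0 t ω) hx 2)
  -- expand the square of the drift inequality: the terms linear in the noise have mean zero, those
  -- quadratic in the noise are bounded by the second moments
  have hstep : ∀ K t, ∫ ω, f K (t + 1) ω ∂μ ≤ ∫ ω, f K t ω ∂μ + C' - ∫ ω, e K t ω ∂μ := by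
    intro K t
    set c : κ → Ω → ℝ := fun k ω => s ω * I K t ω * β k t ω with hc
    set c' : κ → Ω → ℝ := fun k ω => 2 * (s ω ^ 2 * I K t ω * U t ω) * β k t ω with hc'
    have hcm : ∀ k, StronglyMeasurable[ℱ t] (c k) := fun k =>
      ((hsm t).mul (hIm K t)).mul (hβ k t)
    have hcm' : ∀ k, StronglyMeasurable[ℱ t] (c' k) := fun k =>
      ((stronglyMeasurable_const (b := (2 : ℝ))).mul
        ((((hsm t).pow 2).mul (hIm K t)).mul (hU t))).mul (hβ k t)
    have hβK : ∀ k ω, X t ω ≤ K → |β k t ω| ≤ C * (1 + K) := fun k ω h =>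
      (hβX k t ω).trans (mul_le_mul_of_nonneg_left (by linarith) hC.le)
    have hcb : ∀ k ω, |c k ω| ≤ C * (1 + K) := fun k ω => by
      rcases hI01 K t ω with h | ⟨h, hx⟩
      · simp only [hc, h, mul_zero, zero_mul, abs_zero]; positivity
      · simp only [hc, h, mul_one, abs_mul, abs_of_pos (hs0 ω)]
        exact (mul_le_of_le_one_left (abs_nonneg _) (hs1 ω)).trans (hβK k ω hx)
    have hcb' : ∀ k ω, |c' k ω| ≤ 2 * (C * (1 + (K : ℝ) ^ 2)) * (C * (1 + K)) := fun k ω => by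
      rcases hI01 K t ω with h | ⟨h, hx⟩
      · simp only [hc', h, mul_zero, zero_mul, abs_zero]; positivity
      · simp only [hc', h, mul_one, abs_mul, abs_of_pos (pow_pos (hs0 ω) 2), abs_two,
          abs_of_nonneg (hU0 t ω)]
        have h1 : s ω ^ 2 * U t ω ≤ C * (1 + (K : ℝ) ^ 2) :=
          (mul_le_of_le_one_left (hU0 t ω) (hs2 ω)).trans (hUb K t ω hx)
        exact mul_le_mul (mul_le_mul_of_nonneg_left h1 zero_le_two) (hβK k ω hx) (abs_nonneg _)
          (by positivity)
    have hpt : ∀ ω, f K (t + 1) ω ≤ f K t ω + (s ω ^ 2 * I K t ω * (C' - X t ω ^ 2)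
        - s ω ^ 2 * I K t ω * (2 * m * (∑ k, v k) * C ^ 2 * (1 + X t ω) ^ 2))
        + ∑ k, c' k ω * ξ k t ω + 2 * m * ∑ k, c k ω ^ 2 * ξ k t ω ^ 2 := by
      intro ω
      have h0 : f K (t + 1) ω ≤ s ω ^ 2 * I K t ω * U (t + 1) ω ^ 2 :=
        mul_le_mul_of_nonneg_right (mul_le_mul_of_nonneg_left (hIanti K t ω) (sq_nonneg _))
          (sq_nonneg _)
      refine h0.trans ?_
      rcases hI01 K t ω with h | ⟨h, hx⟩
      · simp [hf, hc, hc', h]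
      · set Dn : ℝ := ∑ k, β k t ω * ξ k t ω with hDn
        have hD2 : Dn ^ 2 ≤ m * ∑ k, (β k t ω * ξ k t ω) ^ 2 := by
          have := sq_sum_le_card_mul_sum_sq (s := Finset.univ)
            (f := fun k => β k t ω * ξ k t ω)
          simpa [hDn, hm] using this
        have e1 : ∑ k, c' k ω * ξ k t ω = 2 * s ω ^ 2 * U t ω * Dn := by
          simp only [hc', h, hDn, Finset.mul_sum]
          exact Finset.sum_congr rfl fun k _ => by ring
        have e2 : ∑ k, c k ω ^ 2 * ξ k t ω ^ 2 = s ω ^ 2 * ∑ k, (β k t ω * ξ k t ω) ^ 2 := by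
          simp only [hc, h, Finset.mul_sum]
          exact Finset.sum_congr rfl fun k _ => by ring
        rw [e1, e2]
        simp only [hf, h, mul_one]
        have h1 : U (t + 1) ω ^ 2 ≤ (U t ω + ((C - ε * X t ω) + Dn)) ^ 2 :=
          pow_le_pow_left₀ (hU0 _ ω) (by linarith [hdrift t ω]) 2
        have h2 := hbound (X t ω) (U t ω) (hX0 t ω) (hXU t ω) (hUX t ω)
        have h3 : ((C - ε * X t ω) + Dn) ^ 2 ≤ 2 * (C - ε * X t ω) ^ 2 + 2 * Dn ^ 2 := by
          nlinarith [sq_nonneg ((C - ε * X t ω) - Dn)]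
        have h4 : U (t + 1) ω ^ 2 ≤ U t ω ^ 2 + ((C' - X t ω ^ 2)
            - 2 * m * (∑ k, v k) * C ^ 2 * (1 + X t ω) ^ 2) + 2 * U t ω * Dn
            + 2 * m * ∑ k, (β k t ω * ξ k t ω) ^ 2 := by nlinarith
        have := mul_le_mul_of_nonneg_left h4 (sq_nonneg (s ω))
        linarith
    have hIb : ∀ (y : Ω → ℝ), StronglyMeasurable[ℱ t] y → ∀ R : ℝ, 0 ≤ R →
        (∀ ω, X t ω ≤ K → |y ω| ≤ R) → Integrable (fun ω => s ω ^ 2 * I K t ω * y ω) μ := by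
      intro y hy R hR0 hR
      refine hint _ t ((((hsm t).pow 2).mul (hIm K t)).mul hy) R fun ω => ?_
      rcases hI01 K t ω with h | ⟨h, hx⟩
      · simp only [h, mul_zero, zero_mul, abs_zero]; exact hR0
      · rw [h, mul_one, abs_mul, abs_of_nonneg (sq_nonneg _)]
        exact (mul_le_of_le_one_left (abs_nonneg _) (hs2 ω)).trans (hR ω hx)
    have i1 : Integrable (fun ω => s ω ^ 2 * I K t ω * (C' - X t ω ^ 2)) μ := by
      refine hIb _ (stronglyMeasurable_const.sub ((hX t).pow 2)) (C' + K ^ 2) (by positivity)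
        fun ω hx => ?_
      have := pow_le_pow_left₀ (hX0 t ω) hx 2
      rw [abs_le]; constructor <;> nlinarith [sq_nonneg (X t ω), sq_nonneg (K : ℝ)]
    have i2 : Integrable (fun ω => s ω ^ 2 * I K t ω * (1 + X t ω) ^ 2) μ := by
      refine hIb _ ((stronglyMeasurable_const.add (hX t)).pow 2) ((1 + K) ^ 2) (by positivity)
        fun ω hx => ?_
      rw [abs_of_nonneg (sq_nonneg _)]
      have := hX0 t ω
      exact pow_le_pow_left₀ (by linarith) (by linarith) 2
    have i3 : ∀ k, Integrable (fun ω => c' k ω * ξ k t ω) μ := fun k =>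
      (hξ k).integrable_mul (hcm' k) (hcb' k)
    have i4 : ∀ k, Integrable (fun ω => c k ω ^ 2 * ξ k t ω ^ 2) μ := fun k =>
      (hξ k).integrable_sq_mul (hcm k) (hcb k)
    set D : ℝ := 2 * m * (∑ k, v k) * C ^ 2 with hD
    have i5 : Integrable (fun ω => s ω ^ 2 * I K t ω * (C' - X t ω ^ 2)
        - s ω ^ 2 * I K t ω * (D * (1 + X t ω) ^ 2)) μ :=
      i1.sub ((i2.const_mul D).congr (Eventually.of_forall fun ω => by ring))
    have i6 : Integrable (fun ω => ∑ k, c' k ω * ξ k t ω) μ :=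
      integrable_finsetSum _ fun k _ => i3 k
    have i7 : Integrable (fun ω => 2 * m * ∑ k, c k ω ^ 2 * ξ k t ω ^ 2) μ :=
      (integrable_finsetSum _ fun k _ => i4 k).const_mul _
    have i8 : Integrable (fun ω => s ω ^ 2 * I K t ω * (D * (1 + X t ω) ^ 2)) μ :=
      (i2.const_mul D).congr (Eventually.of_forall fun ω => by ring)
    have := integral_mono (hfi K (t + 1)) (((hfi K t).add i5).add i6 |>.add i7) hpt
    rw [integral_add' (((hfi K t).add i5).add i6) i7, integral_add' ((hfi K t).add i5) i6,
      integral_add' (hfi K t) i5,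
      integral_finsetSum _ fun k _ => i3 k, integral_const_mul,
      integral_finsetSum _ fun k _ => i4 k,
      Finset.sum_eq_zero fun k _ => (hξ k).integral_mul_eq_zero (hcm' k) (i3 k),
      integral_sub i1 i8] at this
    have h5 : ∑ k, ∫ ω, c k ω ^ 2 * ξ k t ω ^ 2 ∂μ ≤
        (∑ k, v k) * (C ^ 2 * ∫ ω, s ω ^ 2 * I K t ω * (1 + X t ω) ^ 2 ∂μ) := by
      rw [Finset.sum_mul]
      refine Finset.sum_le_sum fun k _ => ((hξ k).integral_sq_mul_le (hcm k) (hcb k)).trans ?_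
      refine mul_le_mul_of_nonneg_left ?_ (hv k)
      rw [← integral_const_mul]
      refine integral_mono (hint _ t ((hcm k).pow 2) ((C * (1 + K)) ^ 2) fun ω => ?_)
        (i2.const_mul _) fun ω => ?_
      · rw [abs_pow]; exact pow_le_pow_left₀ (abs_nonneg _) (hcb k ω) 2
      · simp only [hc]
        rcases hI01 K t ω with h | ⟨h, hx⟩
        · simp [h]
        · have : β k t ω ^ 2 ≤ (C * (1 + X t ω)) ^ 2 := by
            rw [← sq_abs]; exact pow_le_pow_left₀ (abs_nonneg _) (hβX k t ω) 2
          rw [h]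
          nlinarith [sq_nonneg (s ω)]
    have h6 : ∫ ω, s ω ^ 2 * I K t ω * (D * (1 + X t ω) ^ 2) ∂μ =
        D * ∫ ω, s ω ^ 2 * I K t ω * (1 + X t ω) ^ 2 ∂μ := by
      rw [← integral_const_mul]; exact integral_congr_ae (Eventually.of_forall fun ω => by
        simp only; ring)
    have h7 : ∫ ω, s ω ^ 2 * I K t ω * (C' - X t ω ^ 2) ∂μ ≤ C' - ∫ ω, e K t ω ∂μ := by
      have : ∫ ω, s ω ^ 2 * I K t ω * (C' - X t ω ^ 2) ∂μ ≤ ∫ ω, (C' - e K t ω) ∂μ := by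
        refine integral_mono i1 ((integrable_const _).sub (hei K t)) fun ω => ?_
        have h8 : s ω ^ 2 * I K t ω ≤ 1 := by
          rcases hI01 K t ω with h | ⟨h, hx⟩
          · simp [h]
          · simpa [h] using hs2 ω
        simp only [he]
        nlinarith
      rwa [integral_sub (integrable_const _) (hei K t), integral_const, probReal_univ,
        one_smul] at this
    have h8 : 2 * m * ∑ k, ∫ ω, c k ω ^ 2 * ξ k t ω ^ 2 ∂μ ≤
        D * ∫ ω, s ω ^ 2 * I K t ω * (1 + X t ω) ^ 2 ∂μ := by
      have := mul_le_mul_of_nonneg_left h5 (show 0 ≤ 2 * m by positivity)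
      rw [hD]; linarith
    linarith
  -- telescope with decreasing summable weights: `∑ w t * E (e K t) ≤ 1 + C' * ∑ w t` for every `K`
  set w : ℕ → ℝ := fun t => 1 / ((t : ℝ) + 1) ^ 2 with hw
  have hw0 : ∀ t, 0 < w t := fun t => by simp only [hw]; positivity
  have hwanti : ∀ t, w (t + 1) ≤ w t := fun t => by
    simp only [hw]
    exact one_div_le_one_div_of_le (by positivity)
      (pow_le_pow_left₀ (by positivity) (by push_cast; linarith) 2)
  have hwsum : Summable w := by
    have h1 := (Real.summable_one_div_nat_pow (p := 2)).2 (by norm_num)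
    have := (summable_nat_add_iff 1).2 h1
    simpa [hw] using this
  have hf0 : ∀ K t, 0 ≤ ∫ ω, f K t ω ∂μ := fun K t => integral_nonneg fun ω => by
    rcases hI01 K t ω with h | ⟨h, hx⟩
    · simp [hf, h]
    · simp only [hf, h]; positivity
  have hweighted : ∀ K T, ∑ t ∈ Finset.range T, w t * ∫ ω, e K t ω ∂μ ≤
      1 + C' * ∑' t, w t := by
    intro K T
    have h1 : ∀ T, ∑ t ∈ Finset.range T, w t * ∫ ω, e K t ω ∂μ + w T * ∫ ω, f K T ω ∂μ ≤
        1 + C' * ∑ t ∈ Finset.range T, w t := by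
      intro T
      induction T with
      | zero =>
        simp only [Finset.range_zero, Finset.sum_empty, zero_add, mul_zero, add_zero]
        have h2 : ∫ ω, f K 0 ω ∂μ ≤ ∫ _ω, (1 : ℝ) ∂μ := by
          refine integral_mono (hfi K 0) (integrable_const _) fun ω => ?_
          have h3 : (s ω * U 0 ω) ^ 2 ≤ 1 := by
            have := hU0 0 ω
            refine pow_le_one₀ (mul_nonneg (hs0 ω).le this) ?_
            rw [hs]; simp only
            rw [one_div_mul_eq_div]
            exact (div_le_one (by positivity)).2 (by linarith)
          rcases hI01 K 0 ω with h | ⟨h, hx⟩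
          · simp [hf, h]
          · simp only [hf, h, mul_one]; rwa [mul_pow] at h3
        simp only [integral_const, probReal_univ, one_smul] at h2
        simpa [hw] using h2
      | succ T ih =>
        rw [Finset.sum_range_succ, Finset.sum_range_succ]
        have h2 := mul_le_mul_of_nonneg_left (hstep K T) (hw0 T).le
        have h3 := mul_le_mul_of_nonneg_right (hwanti T) (hf0 K (T + 1))
        nlinarith
    have h2 := h1 T
    have h3 := mul_nonneg (hw0 T).le (hf0 K T)
    have h4 := mul_le_mul_of_nonneg_left (hwsum.sum_le_tsum (Finset.range T)
      fun t _ => (hw0 t).le) hC'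
    linarith
  -- let the level and the number of terms grow together, so that monotone convergence applies
  set F : ℕ → Ω → ℝ := fun T ω => ∑ t ∈ Finset.range T, w t * e T t ω with hF
  have he0 : ∀ K t ω, 0 ≤ e K t ω := fun K t ω => by
    rcases hI01 K t ω with h | ⟨h, hx⟩
    · simp [he, h]
    · simp only [he, h]; positivity
  have hFi : ∀ T, Integrable (F T) μ := fun T =>
    integrable_finsetSum _ fun t _ => (hei T t).const_mul _
  have hF0 : ∀ T ω, 0 ≤ F T ω := fun T ω =>
    Finset.sum_nonneg fun t _ => mul_nonneg (hw0 t).le (he0 T t ω)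
  have hIK : ∀ K K' t ω, K ≤ K' → I K t ω ≤ I K' t ω := fun K K' t ω h => by
    refine Set.indicator_le_indicator_of_subset (fun ω hω τ hτ => (hω τ hτ).trans ?_)
      (fun _ => zero_le_one) ω
    exact_mod_cast h
  have hFmono : Monotone F := by
    refine monotone_nat_of_le_succ fun T ω => ?_
    simp only [hF]
    rw [Finset.sum_range_succ]
    refine le_add_of_le_of_nonneg (Finset.sum_le_sum fun t _ => ?_)
      (mul_nonneg (hw0 T).le (he0 _ T ω))
    refine mul_le_mul_of_nonneg_left ?_ (hw0 t).le
    simp only [he]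
    exact mul_le_mul_of_nonneg_right (mul_le_mul_of_nonneg_left
      (hIK T (T + 1) t ω (Nat.le_succ T)) (sq_nonneg _)) (sq_nonneg _)
  have hFbd : ∫⁻ ω, ⨆ T, ENNReal.ofReal (F T ω) ∂μ < ⊤ := by
    rw [lintegral_iSup' (fun T => (hFi T).aestronglyMeasurable.aemeasurable.ennreal_ofReal)
      (Eventually.of_forall fun ω T T' h => ENNReal.ofReal_le_ofReal (hFmono h ω))]
    refine lt_of_le_of_lt (iSup_le fun T => ?_)
      (ENNReal.ofReal_lt_top (r := 1 + C' * ∑' t, w t))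
    rw [← ofReal_integral_eq_lintegral_ofReal (hFi T) (Eventually.of_forall (hF0 T))]
    refine ENNReal.ofReal_le_ofReal ?_
    simp only [hF]
    rw [integral_finsetSum _ fun t _ => (hei T t).const_mul _]
    simp_rw [integral_const_mul]
    exact hweighted T T
  have hFm : AEMeasurable (fun ω => ⨆ T, ENNReal.ofReal (F T ω)) μ :=
    AEMeasurable.iSup fun T => (hFi T).aestronglyMeasurable.aemeasurable.ennreal_ofReal
  filter_upwards [ae_lt_top' hFm hFbd.ne] with ω hω
  set b : ℝ := (⨆ T, ENNReal.ofReal (F T ω)).toReal with hb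
  have hFb : ∀ T, F T ω ≤ b := fun T => by
    rw [hb, ← ENNReal.ofReal_le_iff_le_toReal hω.ne]
    exact le_iSup (fun T => ENNReal.ofReal (F T ω)) T
  refine summable_of_sum_range_le (c := b / s ω ^ 2) (fun t => sq_nonneg _) fun T => ?_
  -- up to time `T` the path stays below a level `K`, where nothing has been stopped
  obtain ⟨K, hK⟩ := exists_nat_ge (∑ t ∈ Finset.range T, X t ω)
  rw [le_div_iff₀ (pow_pos (hs0 ω) 2)]
  refine le_trans ?_ (hFb (max K T))
  simp only [hF]
  rw [Finset.sum_mul]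
  refine le_trans (Finset.sum_le_sum fun t ht => ?_) (Finset.sum_le_sum_of_subset_of_nonneg
    (Finset.range_mono (le_max_right K T)) fun t _ _ => mul_nonneg (hw0 t).le (he0 _ t ω))
  have hmem : ω ∈ G (max K T) t := fun τ hτ => by
    have h1 : X τ ω ≤ K := (Finset.single_le_sum (f := fun t => X t ω) (fun t _ => hX0 t ω)
      (Finset.mem_range.2 ((Nat.lt_succ_iff.1 (Finset.mem_range.1 hτ)).trans_lt
        (Finset.mem_range.1 ht)))).trans hK
    exact h1.trans (by exact_mod_cast le_max_left K T)
  have hI1 : I (max K T) t ω = 1 := by simp [hI, hmem]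
  simp only [he, hI1, hw, div_pow]
  apply le_of_eq
  field_simp

/-! ### Rates of superposition codes and of their partitions -/

theorem SuperpositionCode.rate_mono (C : SuperpositionCode) {g g' : ℝ} (hg : 0 ≤ g)
    (h : g ≤ g') : C.rate g ≤ C.rate g' := by
  cases C with
  | continuum p p0 pi =>
    simp only [SuperpositionCode.rate]
    have htail0 : ∀ a, 0 ≤ ∫ s in Set.Ioi a, p s := fun a => integral_nonneg fun s => p0 s
    have hf0 : ∀ a, 0 ≤ a → 0 ≤ a * p a / (1 + a * ∫ s in Set.Ioi a, p s) := fun a ha =>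
      div_nonneg (mul_nonneg ha (p0 a)) (add_nonneg zero_le_one (mul_nonneg ha (htail0 a)))
    have hanti : AntitoneOn (fun a => ∫ s in Set.Ioi a, p s) (Set.Ioi 0) := by
      intro a ha b hb hab
      exact setIntegral_mono_set (pi.mono_set (Set.Ioi_subset_Ioi (le_of_lt ha)))
        (Eventually.of_forall fun s => p0 s) (Set.Ioi_subset_Ioi hab).eventuallyLE
    have hm : AEMeasurable (fun a => ∫ s in Set.Ioi a, p s) (volume.restrict (Set.Ioi 0)) :=
      aemeasurable_restrict_of_antitoneOn measurableSet_Ioi hanti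
    have hfm : AEStronglyMeasurable (fun a => a * p a / (1 + a * ∫ s in Set.Ioi a, p s))
        (volume.restrict (Set.Ioc 0 g')) := by
      have h1 : AEMeasurable (fun a => a * p a / (1 + a * ∫ s in Set.Ioi a, p s))
          (volume.restrict (Set.Ioi 0)) :=
        (aemeasurable_id.mul pi.aestronglyMeasurable.aemeasurable).div
          (aemeasurable_const.add (aemeasurable_id.mul hm))
      exact (h1.mono_measure (Measure.restrict_mono Set.Ioc_subset_Ioi_self le_rfl)).aestronglyMeasurable
    have hpI : IntegrableOn p (Set.Ioc 0 g') := pi.mono_set Set.Ioc_subset_Ioi_self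
    have hfI : IntegrableOn (fun a => a * p a / (1 + a * ∫ s in Set.Ioi a, p s))
        (Set.Ioc 0 g') := by
      refine Integrable.mono' (hpI.const_mul g') hfm
        ((ae_restrict_iff' measurableSet_Ioc).2 (Eventually.of_forall fun a ha => ?_))
      rw [Real.norm_of_nonneg (hf0 a ha.1.le)]
      refine (div_le_self (mul_nonneg ha.1.le (p0 a)) ?_).trans
        (mul_le_mul_of_nonneg_right ha.2 (p0 a))
      linarith [mul_nonneg ha.1.le (htail0 a)]
    rw [intervalIntegral.integral_of_le hg, intervalIntegral.integral_of_le (hg.trans h)]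
    exact setIntegral_mono_set hfI
      ((ae_restrict_iff' measurableSet_Ioc).2 (Eventually.of_forall fun a ha => hf0 a ha.1.le))
      (Set.Ioc_subset_Ioc_right h).eventuallyLE
  | discrete L power threshold pow0 th0 thm =>
    simp only [SuperpositionCode.rate]
    refine Finset.sum_le_sum fun l _ => ?_
    have hlog : 0 ≤ Real.log (1 + power l * threshold l /
        (1 + threshold l * ∑ l' ∈ Finset.Ioi l, power l')) := by
      refine Real.log_nonneg (le_add_of_nonneg_right ?_)
      exact div_nonneg (mul_nonneg (pow0 l) (th0 l)) (add_nonneg zero_le_one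
        (mul_nonneg (th0 l) (Finset.sum_nonneg fun _ _ => pow0 _)))
    split_ifs with h1 h2
    · exact le_rfl
    · exact absurd (h1.trans h) h2
    · exact hlog
    · exact le_rfl

theorem SuperpositionCode.rate_nonneg (C : SuperpositionCode) {g : ℝ} (hg : 0 ≤ g) :
    0 ≤ C.rate g := by
  cases C with
  | continuum p p0 pi =>
    simp only [SuperpositionCode.rate]
    refine intervalIntegral.integral_nonneg hg fun a ha => ?_
    exact div_nonneg (mul_nonneg ha.1 (p0 a)) (add_nonneg zero_le_one
      (mul_nonneg ha.1 (integral_nonneg fun s => p0 s)))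
  | discrete L power threshold pow0 th0 thm =>
    simp only [SuperpositionCode.rate]
    refine Finset.sum_nonneg fun l _ => ?_
    split_ifs
    · refine Real.log_nonneg (le_add_of_nonneg_right ?_)
      exact div_nonneg (mul_nonneg (pow0 l) (th0 l)) (add_nonneg zero_le_one
        (mul_nonneg (th0 l) (Finset.sum_nonneg fun _ _ => pow0 _)))
    · exact le_rfl

namespace Network

variable {n M : ℕ} {𝒮 : Type} [Fintype 𝒮] (net : Network n M 𝒮)

theorem txRate_nonneg (i j : Node n) (k : Fin (net.Ktr i + 1)) (s : 𝒮) :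
    0 ≤ net.txRate i j k s := by
  refine Fin.cases ?_ (fun k' => ?_) k
  · simp [txRate]
  · simpa [txRate] using (net.code i k').rate_nonneg (net.gain_nonneg s i j)

theorem txRate_mono (i : Node n) {j j' : Node n} (k : Fin (net.Ktr i + 1)) (s : 𝒮)
    (h : net.gain s i j ≤ net.gain s i j') : net.txRate i j k s ≤ net.txRate i j' k s := by
  refine Fin.cases ?_ (fun k' => ?_) k
  · simp [txRate]
  · simpa [txRate] using (net.code i k').rate_mono (net.gain_nonneg s i j) h

theorem gain_receiver_mono (i : Node n) (s : 𝒮) {u v : Fin n} (h : u ≤ v) :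
    net.gain s i (net.receiver i s u) ≤ net.gain s i (net.receiver i s v) :=
  Tuple.monotone_sort (fun v : Fin n => net.gain s i (i.succAbove v)) h

theorem receiver_injective (i : Node n) (s : 𝒮) : Function.Injective (net.receiver i s) :=
  fun _ _ h => (Tuple.sort _).injective (Fin.succAbove_right_injective h)

theorem receiver_ne (i : Node n) (s : 𝒮) (u : Fin n) : net.receiver i s u ≠ i :=
  Fin.succAbove_ne _ _

theorem exists_receiver_eq {i j : Node n} (s : 𝒮) (h : j ≠ i) : ∃ u, net.receiver i s u = j := by
  obtain ⟨v, hv⟩ := Fin.exists_succAbove_eq h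
  exact ⟨(Tuple.sort fun v : Fin n => net.gain s i (i.succAbove v)).symm v, by
    simp [receiver, hv]⟩

theorem receiver_mem_receiverSet {i : Node n} {s : 𝒮} {u v : Fin n} :
    net.receiver i s u ∈ net.receiverSet i s v ↔ v ≤ u := by
  simp [receiverSet, (net.receiver_injective i s).eq_iff]

theorem ne_of_mem_receiverSet {i j : Node n} {s : 𝒮} {v : Fin n}
    (h : j ∈ net.receiverSet i s v) : j ≠ i := by
  obtain ⟨u, -, rfl⟩ := Finset.mem_image.1 h
  exact net.receiver_ne i s u

theorem partitionRate_nonneg (i : Node n) (k : Fin (net.Ktr i + 1)) (s : 𝒮) (v : Fin n) :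
    0 ≤ net.partitionRate i k s v := by
  rw [partitionRate]
  split_ifs with h
  · refine sub_nonneg.2 (net.txRate_mono i k s (net.gain_receiver_mono i s ?_))
    exact Fin.le_def.2 (Nat.sub_le _ _)
  · simpa using net.txRate_nonneg i _ k s

/-- The partitions that a receiver decodes make up all that it can receive. -/
theorem sum_partitionRate_le (i : Node n) (k : Fin (net.Ktr i + 1)) (s : 𝒮) (u : Fin n) :
    ∑ v ∈ Finset.Iic u, net.partitionRate i k s v = net.txRate i (net.receiver i s u) k s := by
  obtain ⟨u, hu⟩ := u
  induction u with
  | zero =>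
    have : Finset.Iic (⟨0, hu⟩ : Fin n) = {⟨0, hu⟩} := by
      ext v; simp [Fin.le_def, Fin.ext_iff]
    rw [this, Finset.sum_singleton, partitionRate]
    simp
  | succ u ih =>
    have : Finset.Iic (⟨u + 1, hu⟩ : Fin n) =
        insert ⟨u + 1, hu⟩ (Finset.Iic (⟨u, by omega⟩ : Fin n)) := by
      ext v; simp [Fin.le_def, Fin.ext_iff]; omega
    rw [this, Finset.sum_insert (by simp [Fin.le_def]), ih (by omega), partitionRate]
    simp

theorem sum_partitionRate_decoded {i j : Node n} (k : Fin (net.Ktr i + 1)) (s : 𝒮) (h : j ≠ i) :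
    ∑ v, (if j ∈ net.receiverSet i s v then net.partitionRate i k s v else 0) =
      net.txRate i j k s := by
  obtain ⟨u, rfl⟩ := net.exists_receiver_eq s h
  simp_rw [receiver_mem_receiverSet]
  rw [← Finset.sum_filter, ← net.sum_partitionRate_le i k s u]
  congr 1
  ext v; simp

theorem sum_partitionRate_le_maxOut (i : Node n) (k : Fin (net.Ktr i + 1)) (s : 𝒮) :
    ∑ v, net.partitionRate i k s v ≤ net.maxOut i := by
  rcases Nat.eq_zero_or_pos n with rfl | hn
  · simp only [Finset.univ_eq_empty, Finset.sum_empty]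
    exact Real.iSup_nonneg fun p => net.txRate_nonneg _ _ _ _
  · have h1 := net.sum_partitionRate_le i k s ⟨n - 1, by omega⟩
    have h2 : Finset.Iic (⟨n - 1, by omega⟩ : Fin n) = Finset.univ := by
      ext v; simp [Fin.le_def]; omega
    rw [← h2, h1]
    exact le_ciSup (f := fun p : {j : Node n // j ≠ i} × 𝒮 × Fin (net.Ktr i + 1) =>
      net.txRate i p.1 p.2.2 p.2.1) (Set.finite_range _).bddAbove
      (⟨net.receiver i s ⟨n - 1, by omega⟩, net.receiver_ne i s _⟩, s, k)

theorem sum_txRate_le_maxIn (i : Node n) (s : 𝒮) (k : ∀ j, Fin (net.Ktr j + 1)) :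
    ∑ j ∈ Finset.univ.erase i, net.txRate j i (k j) s ≤ net.maxIn i := by
  refine le_trans (Finset.sum_le_sum fun j _ => ?_) (le_ciSup (f := fun s : 𝒮 =>
    ∑ j ∈ Finset.univ.erase i, ⨆ k : Fin (net.Ktr j + 1), net.txRate j i k s)
    (Set.finite_range _).bddAbove s)
  exact le_ciSup (f := fun k : Fin (net.Ktr j + 1) => net.txRate j i k s)
    (Set.finite_range _).bddAbove (k j)

theorem maxOut_nonneg (i : Node n) : 0 ≤ net.maxOut i :=
  Real.iSup_nonneg fun _ => net.txRate_nonneg _ _ _ _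

theorem maxIn_nonneg (i : Node n) : 0 ≤ net.maxIn i :=
  Real.iSup_nonneg fun _ => Finset.sum_nonneg fun _ _ =>
    Real.iSup_nonneg fun _ => net.txRate_nonneg _ _ _ _

theorem Rpr_le_maxProc (i : Node n) (k : Fin (net.Kpr i + 1)) : net.Rpr i k ≤ net.maxProc i :=
  le_ciSup (f := fun k => net.Rpr i k) (Set.finite_range _).bddAbove k

theorem maxProc_nonneg (i : Node n) : 0 ≤ net.maxProc i :=
  Real.iSup_nonneg fun _ => net.Rpr_nonneg _ _

theorem iInf_r_le (m : Fin M) : ⨅ m, net.r m ≤ net.r m :=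
  ciInf_le (Set.finite_range _).bddBelow m

theorem iInf_r_pos : 0 < ⨅ m, net.r m := by
  have : Nonempty (Fin M) := ⟨⟨0, net.M_pos⟩⟩
  obtain ⟨m, hm⟩ := exists_eq_ciInf_of_finite (f := net.r)
  rw [← hm]; exact net.r_pos m

theorem ξ_le_iSup (m : Fin M) : net.ξ m ≤ ⨆ m, net.ξ m :=
  le_ciSup (Set.finite_range _).bddAbove m

theorem iSup_ξ_nonneg : 0 ≤ ⨆ m, net.ξ m := Real.iSup_nonneg fun m => (net.ξ_pos m).le

theorem Rpr_div_r_le (i : Node n) (k : Fin (net.Kpr i + 1)) (m : Fin M) :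
    net.Rpr i k / net.r m ≤ net.maxProc i / ⨅ m, net.r m :=
  div_le_div₀ (net.maxProc_nonneg i) (net.Rpr_le_maxProc i k) net.iInf_r_pos (net.iInf_r_le m)

/-- Largest total rate at which a node is assigned to remove information from its queues. -/
def outBound (i : Node n) : ℝ := net.maxOut i + net.maxProc i / ⨅ m, net.r m

/-- Largest total rate at which a node receives and produces information. -/
def inBound (i : Node n) : ℝ :=
  net.maxIn i + (⨆ m, net.ξ m) * net.maxProc i / (⨅ m, net.r m)

theorem outBound_nonneg (i : Node n) : 0 ≤ net.outBound i :=
  add_nonneg (net.maxOut_nonneg i) (div_nonneg (net.maxProc_nonneg i) net.iInf_r_pos.le)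

theorem inBound_nonneg (i : Node n) : 0 ≤ net.inBound i :=
  add_nonneg (net.maxIn_nonneg i) (div_nonneg (mul_nonneg net.iSup_ξ_nonneg
    (net.maxProc_nonneg i)) net.iInf_r_pos.le)

theorem sum_sq_le_driftConstant (A : ℝ) :
    ∑ i, (1 / 2) * (net.outBound i ^ 2 + (net.inBound i + A) ^ 2) ≤
      (n + 1) * net.driftConstant A := by
  have : ∀ i : Node n, (1 / 2) * (net.outBound i ^ 2 + (net.inBound i + A) ^ 2) ≤
      net.driftConstant A := fun i => by
    refine mul_le_mul_of_nonneg_left ?_ (by norm_num)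
    exact le_ciSup (f := fun i : Node n => ((net.maxOut i + net.maxProc i / ⨅ m, net.r m) ^ 2 +
      (net.maxIn i + (⨆ m, net.ξ m) * net.maxProc i / (⨅ m, net.r m) + A) ^ 2))
      (Set.finite_range _).bddAbove i
  calc _ ≤ ∑ _i : Node n, net.driftConstant A := Finset.sum_le_sum fun i _ => this i
    _ = _ := by simp

theorem scale_pos (m : Fin (M + 1)) : 0 < net.scale m :=
  Finset.prod_pos fun l _ => by split_ifs; exacts [net.ξ_pos l, one_pos]

theorem scale_succ (m : Fin M) : net.scale m.succ = net.ξ m * net.scale m.castSucc := by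
  unfold scale
  have h1 : ∀ l : Fin M, (if l.castSucc < m.succ then net.ξ l else 1) =
      (if l = m then net.ξ m else 1) * (if l.castSucc < m.castSucc then net.ξ l else 1) := by
    intro l
    by_cases h : l = m
    · subst h; simp
    · have : l.castSucc < m.succ ↔ l.castSucc < m.castSucc := by
        simp only [Fin.lt_def, Fin.val_castSucc, Fin.val_succ]
        have : (l : ℕ) ≠ m := fun e => h (Fin.ext e)
        omega
      simp [h, this]
  simp_rw [h1, Finset.prod_mul_distrib]
  simp

end Network

/-! ### The value of a slot -/

section Value

variable {n M : ℕ}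

/-- Sum of the products of the entries of two matrices. -/
def pairing (q x : RateMatrix n M) : ℝ := ∑ i, ∑ c, q i c * x i c

/-- Sum of the absolute values of the entries of a matrix. -/
def size (q : RateMatrix n M) : ℝ := ∑ i, ∑ c, |q i c|

/-- Matrices that are possible values of the queue backlogs: nonnegative, and zero for a final
commodity at its destination. They also serve as the prices in the dual description of the
capacity region. -/
structure IsWeight (q : RateMatrix n M) : Prop where
  nonneg : ∀ i c, 0 ≤ q i c
  final : ∀ d, q d (d, Fin.last M) = 0

theorem size_nonneg (q : RateMatrix n M) : 0 ≤ size q :=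
  Finset.sum_nonneg fun _ _ => Finset.sum_nonneg fun _ _ => abs_nonneg _

theorem abs_le_size (q : RateMatrix n M) (i : Node n) (c : Commodity n M) : |q i c| ≤ size q :=
  (Finset.single_le_sum (f := fun c => |q i c|) (fun _ _ => abs_nonneg _)
    (Finset.mem_univ c)).trans (Finset.single_le_sum (f := fun i => ∑ c, |q i c|)
      (fun _ _ => Finset.sum_nonneg fun _ _ => abs_nonneg _) (Finset.mem_univ i))

theorem IsWeight.size_eq {q : RateMatrix n M} (hq : IsWeight q) : size q = ∑ i, ∑ c, q i c :=
  Finset.sum_congr rfl fun i _ => Finset.sum_congr rfl fun c _ => abs_of_nonneg (hq.nonneg i c)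

@[fun_prop]
theorem continuous_size : Continuous (size : RateMatrix n M → ℝ) := by
  unfold size; fun_prop

theorem continuous_of_abs_sub_le {f : RateMatrix n M → ℝ} {K : ℝ}
    (h : ∀ q q', |f q - f q'| ≤ K * size (q - q')) : Continuous f := by
  refine continuous_iff_continuousAt.2 fun q' => ?_
  refine tendsto_iff_norm_sub_tendsto_zero.2 (squeeze_zero (fun _ => norm_nonneg _)
    (fun q => h q q') ?_)
  have : Continuous fun q : RateMatrix n M => K * size (q - q') := by fun_prop
  simpa [size] using this.tendsto q'

end Value

namespace Network

variable {n M : ℕ} {𝒮 : Type} [Fintype 𝒮] (net : Network n M 𝒮)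

/-- Value of partition `v` of commodity `c`: the largest differential backlog among the receivers
that decode it. -/
def partitionValue (q : RateMatrix n M) (i : Node n) (c : Commodity n M) (s : 𝒮) (v : Fin n) : ℝ :=
  (net.receiverSet i s v).sup' (net.receiverSet_nonempty i s v) fun j => diffWeight q i j c

/-- Value of transmitting commodity `c` from node `i` with `k` resource units in state `s`. -/
def txValue (q : RateMatrix n M) (i : Node n) (k : Fin (net.Ktr i + 1)) (s : 𝒮)
    (c : Commodity n M) : ℝ :=
  ∑ v, net.partitionRate i k s v * net.partitionValue q i c s v

theorem txWeight_eq (q : RateMatrix n M) (s : 𝒮) (i : Node n) (k : Fin (net.Ktr i + 1))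
    (c : Commodity n M) : txWeight net q s i k c = ∑ s', net.P s s' * net.txValue q i k s' c := rfl

/-- Largest expected value of a slot at backlogs `q`, minus `V` times the cost, given the network
state `s` of the slot before. -/
def slotValue (w : net.Cost) (V : ℝ) (q : RateMatrix n M) (s : 𝒮) : ℝ :=
  ∑ i, ((⨆ p : Fin (net.Kpr i + 1) × Job n M, (net.Rpr i p.1 * procWeight net q i p.2
      - V * w.pr i p.1)) +
    ⨆ p : Fin (net.Ktr i + 1) × Commodity n M, (txWeight net q s i p.1 p.2 - V * w.tr i p.1))

theorem diffWeight_nonneg (q : RateMatrix n M) (i j : Node n) (c : Commodity n M) :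
    0 ≤ diffWeight q i j c := le_max_right _ _

theorem procWeight_nonneg (q : RateMatrix n M) (i : Node n) (b : Job n M) :
    0 ≤ procWeight net q i b :=
  mul_nonneg (one_div_nonneg.2 (net.r_pos _).le) (le_max_right _ _)

theorem diffWeight_le_partitionValue (q : RateMatrix n M) {i j : Node n} (c : Commodity n M)
    {s : 𝒮} {v : Fin n} (hj : j ∈ net.receiverSet i s v) :
    diffWeight q i j c ≤ net.partitionValue q i c s v :=
  Finset.le_sup' (fun j => diffWeight q i j c) hj

theorem partitionValue_nonneg (q : RateMatrix n M) (i : Node n) (c : Commodity n M) (s : 𝒮)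
    (v : Fin n) : 0 ≤ net.partitionValue q i c s v := by
  obtain ⟨j, hj⟩ := net.receiverSet_nonempty i s v
  exact (diffWeight_nonneg q i j c).trans (net.diffWeight_le_partitionValue q c hj)

theorem txValue_nonneg (q : RateMatrix n M) (i : Node n) (k : Fin (net.Ktr i + 1)) (s : 𝒮)
    (c : Commodity n M) : 0 ≤ net.txValue q i k s c :=
  Finset.sum_nonneg fun v _ =>
    mul_nonneg (net.partitionRate_nonneg i k s v) (net.partitionValue_nonneg q i c s v)

theorem txWeight_nonneg (q : RateMatrix n M) (s : 𝒮) (i : Node n) (k : Fin (net.Ktr i + 1))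
    (c : Commodity n M) : 0 ≤ txWeight net q s i k c :=
  Finset.sum_nonneg fun s' _ => mul_nonneg (net.P_nonneg s s') (net.txValue_nonneg q i k s' c)

theorem nonempty_job (net : Network n M 𝒮) : Nonempty (Job n M) := ⟨(0, ⟨0, net.M_pos⟩)⟩

/-- No choice of resources and of shares of the transmission time has an expected value above
`slotValue` plus `V` times its cost. -/
theorem le_slotValue (w : net.Cost) (V : ℝ) (q : RateMatrix n M) (s : 𝒮)
    (kpr : ∀ i, Fin (net.Kpr i + 1)) (ktr : ∀ i, Fin (net.Ktr i + 1))
    (share : Node n → Commodity n M → ℝ) (h0 : ∀ i c, 0 ≤ share i c)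
    (h1 : ∀ i, ∑ c, share i c ≤ 1) :
    ∑ i, (net.Rpr i (kpr i) * (⨆ b, procWeight net q i b) +
      ∑ c, share i c * txWeight net q s i (ktr i) c) ≤
      net.slotValue w V q s + V * w.total kpr ktr := by
  rw [slotValue, Cost.total, Finset.mul_sum, ← Finset.sum_add_distrib]
  refine Finset.sum_le_sum fun i _ => ?_
  have := net.nonempty_job
  obtain ⟨b, hb⟩ := exists_eq_ciSup_of_finite (f := fun b => procWeight net q i b)
  have h2 := le_ciSup (f := fun p : Fin (net.Kpr i + 1) × Job n M =>
    net.Rpr i p.1 * procWeight net q i p.2 - V * w.pr i p.1) (Set.finite_range _).bddAbove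
    (kpr i, b)
  obtain ⟨c, -, hc⟩ := Finset.exists_max_image Finset.univ
    (fun c => txWeight net q s i (ktr i) c) ⟨(0, 0), Finset.mem_univ _⟩
  have h3 := le_ciSup (f := fun p : Fin (net.Ktr i + 1) × Commodity n M =>
    txWeight net q s i p.1 p.2 - V * w.tr i p.1) (Set.finite_range _).bddAbove (ktr i, c)
  have h4 : ∑ c, share i c * txWeight net q s i (ktr i) c ≤ txWeight net q s i (ktr i) c := by
    calc ∑ c', share i c' * txWeight net q s i (ktr i) c'
        ≤ ∑ c', share i c' * txWeight net q s i (ktr i) c :=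
          Finset.sum_le_sum fun c' _ => mul_le_mul_of_nonneg_left (hc c' (Finset.mem_univ _))
            (h0 i c')
      _ = (∑ c', share i c') * txWeight net q s i (ktr i) c := by rw [Finset.sum_mul]
      _ ≤ _ := mul_le_of_le_one_left (net.txWeight_nonneg q s i _ c) (h1 i)
  rw [← hb]
  simp only at h2 h3
  linarith

/-- Decisions that maximise the value minus `V` times the cost at every node attain `slotValue`. -/
theorem slotValue_eq (w : net.Cost) (V : ℝ) (q : RateMatrix n M) (s : 𝒮)
    (kpr : ∀ i, Fin (net.Kpr i + 1)) (ktr : ∀ i, Fin (net.Ktr i + 1)) (bp : Node n → Job n M)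
    (bt : Node n → Commodity n M)
    (hp : ∀ i k b, net.Rpr i k * procWeight net q i b - V * w.pr i k ≤
      net.Rpr i (kpr i) * procWeight net q i (bp i) - V * w.pr i (kpr i))
    (ht : ∀ i k c, txWeight net q s i k c - V * w.tr i k ≤
      txWeight net q s i (ktr i) (bt i) - V * w.tr i (ktr i)) :
    net.slotValue w V q s = ∑ i, (net.Rpr i (kpr i) * procWeight net q i (bp i) +
      txWeight net q s i (ktr i) (bt i)) - V * w.total kpr ktr := by
  rw [slotValue, Cost.total, Finset.mul_sum, ← Finset.sum_sub_distrib]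
  refine Finset.sum_congr rfl fun i _ => ?_
  have := net.nonempty_job
  have h1 : (⨆ p : Fin (net.Kpr i + 1) × Job n M, (net.Rpr i p.1 * procWeight net q i p.2
      - V * w.pr i p.1)) =
      net.Rpr i (kpr i) * procWeight net q i (bp i) - V * w.pr i (kpr i) :=
    le_antisymm (ciSup_le fun p => hp i p.1 p.2)
      (le_ciSup (f := fun p : Fin (net.Kpr i + 1) × Job n M =>
        net.Rpr i p.1 * procWeight net q i p.2 - V * w.pr i p.1) (Set.finite_range _).bddAbove
        (kpr i, bp i))
  have h2 : (⨆ p : Fin (net.Ktr i + 1) × Commodity n M,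
      (txWeight net q s i p.1 p.2 - V * w.tr i p.1)) =
      txWeight net q s i (ktr i) (bt i) - V * w.tr i (ktr i) :=
    le_antisymm (ciSup_le fun p => ht i p.1 p.2)
      (le_ciSup (f := fun p : Fin (net.Ktr i + 1) × Commodity n M =>
        txWeight net q s i p.1 p.2 - V * w.tr i p.1) (Set.finite_range _).bddAbove
        (ktr i, bt i))
  rw [h1, h2]; ring

/-- Lipschitz constant of the value of a slot, and of its ingredients, in the backlogs. -/
def valueLip : ℝ :=
  ∑ i, ((net.maxProc i / ⨅ m, net.r m) * (1 + ⨆ m, net.ξ m) + net.maxOut i * 2)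

theorem valueLip_nonneg : 0 ≤ net.valueLip :=
  Finset.sum_nonneg fun i _ => add_nonneg (mul_nonneg (div_nonneg (net.maxProc_nonneg i)
    net.iInf_r_pos.le) (add_nonneg zero_le_one net.iSup_ξ_nonneg))
    (mul_nonneg (net.maxOut_nonneg i) zero_le_two)

theorem diffWeight_le_add (q q' : RateMatrix n M) (i j : Node n) (c : Commodity n M) :
    diffWeight q i j c ≤ diffWeight q' i j c + 2 * size (q - q') := by
  have h1 := abs_le_size (q - q') i c
  have h2 := abs_le_size (q - q') j c
  simp only [Pi.sub_apply, abs_le] at h1 h2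
  have h3 := le_max_left (q' i c - q' j c) 0
  have h4 := le_max_right (q' i c - q' j c) 0
  unfold diffWeight
  exact max_le (by linarith) (by linarith [size_nonneg (q - q')])

theorem txValue_le_add (q q' : RateMatrix n M) (i : Node n) (k : Fin (net.Ktr i + 1)) (s : 𝒮)
    (c : Commodity n M) :
    net.txValue q i k s c ≤ net.txValue q' i k s c + net.maxOut i * 2 * size (q - q') := by
  have h1 : ∀ v, net.partitionValue q i c s v ≤
      net.partitionValue q' i c s v + 2 * size (q - q') := fun v =>
    Finset.sup'_le _ _ fun j hj => (diffWeight_le_add q q' i j c).trans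
      (add_le_add_left (net.diffWeight_le_partitionValue q' c hj) _)
  calc net.txValue q i k s c
      ≤ ∑ v, net.partitionRate i k s v * (net.partitionValue q' i c s v + 2 * size (q - q')) :=
        Finset.sum_le_sum fun v _ =>
          mul_le_mul_of_nonneg_left (h1 v) (net.partitionRate_nonneg i k s v)
    _ = net.txValue q' i k s c + (∑ v, net.partitionRate i k s v) * (2 * size (q - q')) := by
        simp only [mul_add, Finset.sum_add_distrib, Finset.sum_mul, txValue]
    _ ≤ _ := by
        have := mul_le_mul_of_nonneg_right (net.sum_partitionRate_le_maxOut i k s)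
          (mul_nonneg zero_le_two (size_nonneg (q - q')))
        linarith

theorem txWeight_le_add (q q' : RateMatrix n M) (s : 𝒮) (i : Node n) (k : Fin (net.Ktr i + 1))
    (c : Commodity n M) :
    txWeight net q s i k c ≤ txWeight net q' s i k c + net.maxOut i * 2 * size (q - q') := by
  rw [txWeight_eq, txWeight_eq]
  calc _ ≤ ∑ s', net.P s s' * (net.txValue q' i k s' c + net.maxOut i * 2 * size (q - q')) :=
        Finset.sum_le_sum fun s' _ =>
          mul_le_mul_of_nonneg_left (net.txValue_le_add q q' i k s' c) (net.P_nonneg s s')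
    _ = _ := by
        simp only [mul_add, Finset.sum_add_distrib]
        rw [← Finset.sum_mul, net.P_sum, one_mul]

theorem Rpr_mul_procWeight_le_add (q q' : RateMatrix n M) (i : Node n)
    (k : Fin (net.Kpr i + 1)) (b : Job n M) :
    net.Rpr i k * procWeight net q i b ≤ net.Rpr i k * procWeight net q' i b +
      (net.maxProc i / ⨅ m, net.r m) * (1 + ⨆ m, net.ξ m) * size (q - q') := by
  have h0 := size_nonneg (q - q')
  have hξ := net.ξ_le_iSup b.2
  have hξ0 := (net.ξ_pos b.2).le
  set x := q i (b.1, b.2.castSucc) - net.ξ b.2 * q i (b.1, b.2.succ)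
  set x' := q' i (b.1, b.2.castSucc) - net.ξ b.2 * q' i (b.1, b.2.succ)
  have h1 : max x 0 ≤ max x' 0 + (1 + ⨆ m, net.ξ m) * size (q - q') := by
    have h2 := abs_le_size (q - q') i (b.1, b.2.castSucc)
    have h3 := abs_le_size (q - q') i (b.1, b.2.succ)
    simp only [Pi.sub_apply] at h2 h3
    have h4 := (le_abs_self _).trans h2
    have h5 := (neg_le_abs _).trans h3
    have h6 := mul_le_mul_of_nonneg_left h5 hξ0
    have h7 := mul_le_mul_of_nonneg_right hξ h0
    have h8 := le_max_left x' 0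
    have h9 := le_max_right x' 0
    have h10 : 0 ≤ (1 + ⨆ m, net.ξ m) * size (q - q') :=
      mul_nonneg (add_nonneg zero_le_one net.iSup_ξ_nonneg) h0
    refine max_le ?_ (by linarith)
    simp only [x, x'] at *
    linarith
  have h2 : ∀ y, net.Rpr i k * ((1 / net.r b.2) * y) = net.Rpr i k / net.r b.2 * y := fun y => by
    ring
  unfold procWeight
  rw [h2, h2]
  have h3 := mul_le_mul_of_nonneg_left h1
    (div_nonneg (net.Rpr_nonneg i k) (net.r_pos b.2).le)
  have h4 := mul_le_mul_of_nonneg_right (net.Rpr_div_r_le i k b.2)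
    (mul_nonneg (add_nonneg zero_le_one net.iSup_ξ_nonneg) h0)
  linarith

theorem size_sub_comm (q q' : RateMatrix n M) : size (q - q') = size (q' - q) := by
  simp [size, abs_sub_comm]

theorem abs_slotValue_sub_le (w : net.Cost) (V : ℝ) (q q' : RateMatrix n M) (s : 𝒮) :
    |net.slotValue w V q s - net.slotValue w V q' s| ≤ net.valueLip * size (q - q') := by
  have key : ∀ q q' : RateMatrix n M,
      net.slotValue w V q s ≤ net.slotValue w V q' s + net.valueLip * size (q - q') := by
    intro q q'
    rw [slotValue, slotValue, valueLip, Finset.sum_mul, ← Finset.sum_add_distrib]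
    refine Finset.sum_le_sum fun i _ => ?_
    have := net.nonempty_job
    have h1 := ciSup_le fun p : Fin (net.Kpr i + 1) × Job n M =>
      (sub_le_sub_right (net.Rpr_mul_procWeight_le_add q q' i p.1 p.2) (V * w.pr i p.1)).trans
        ((add_sub_right_comm _ _ _).le.trans (add_le_add_left
          (le_ciSup (f := fun p : Fin (net.Kpr i + 1) × Job n M =>
            net.Rpr i p.1 * procWeight net q' i p.2 - V * w.pr i p.1)
            (Set.finite_range _).bddAbove p) _))
    have h2 := ciSup_le fun p : Fin (net.Ktr i + 1) × Commodity n M =>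
      (sub_le_sub_right (net.txWeight_le_add q q' s i p.1 p.2) (V * w.tr i p.1)).trans
        ((add_sub_right_comm _ _ _).le.trans (add_le_add_left
          (le_ciSup (f := fun p : Fin (net.Ktr i + 1) × Commodity n M =>
            txWeight net q' s i p.1 p.2 - V * w.tr i p.1)
            (Set.finite_range _).bddAbove p) _))
    linarith
  rw [abs_le]
  have h1 := key q q'
  have h2 := key q' q
  rw [size_sub_comm] at h2
  constructor <;> linarith

theorem continuous_txValue (i : Node n) (k : Fin (net.Ktr i + 1)) (s : 𝒮) (c : Commodity n M) :
    Continuous fun q => net.txValue q i k s c :=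
  continuous_of_abs_sub_le (K := net.maxOut i * 2) fun q q' => by
    have h1 := net.txValue_le_add q q' i k s c
    have h2 := net.txValue_le_add q' q i k s c
    rw [size_sub_comm] at h2
    rw [abs_le]
    constructor <;> linarith

theorem txValue_zero (i : Node n) (k : Fin (net.Ktr i + 1)) (s : 𝒮) (c : Commodity n M) :
    net.txValue (0 : RateMatrix n M) i k s c = 0 := by
  simp [txValue, partitionValue, diffWeight]

theorem txValue_le (q : RateMatrix n M) (i : Node n) (k : Fin (net.Ktr i + 1)) (s : 𝒮)
    (c : Commodity n M) : net.txValue q i k s c ≤ net.maxOut i * 2 * size q := by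
  have := net.txValue_le_add q 0 i k s c
  rwa [txValue_zero, zero_add, sub_zero] at this

/-! ### The stationary distribution and the Poisson equation -/

/-- The steady-state distribution of the network state. -/
def stationary : 𝒮 → ℝ := net.steady.choose

theorem sum_stationary : ∑ s, net.stationary s = 1 := net.steady.choose_spec.1.2.1

theorem eq_stationary {ν : 𝒮 → ℝ} (h0 : ∀ s, 0 ≤ ν s) (h1 : ∑ s, ν s = 1)
    (h : ∀ s', ∑ s, ν s * net.P s s' = ν s') : ν = net.stationary :=
  net.steady.choose_spec.2 ν ⟨h0, h1, h⟩

theorem eq_mul_stationary_of_nonneg {ν : 𝒮 → ℝ} (h0 : ∀ s, 0 ≤ ν s)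
    (h : ∀ s', ∑ s, ν s * net.P s s' = ν s') (s : 𝒮) : ν s = (∑ s, ν s) * net.stationary s := by
  set m := ∑ s, ν s with hm
  have hm0 : 0 ≤ m := Finset.sum_nonneg fun s _ => h0 s
  rcases hm0.eq_or_lt with h2 | h2
  · have := (Finset.sum_eq_zero_iff_of_nonneg fun s _ => h0 s).1 (hm.symm.trans h2.symm) s
      (Finset.mem_univ s)
    rw [this, ← h2, zero_mul]
  · have := net.eq_stationary (ν := fun s => ν s / m) (fun s => div_nonneg (h0 s) hm0)
      (by rw [← Finset.sum_div, ← hm, div_self h2.ne'])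
      (fun s' => by
        rw [← h s', Finset.sum_div]
        exact Finset.sum_congr rfl fun s _ => by ring)
    rw [← this]
    field_simp

/-- The stationary distribution spans the signed invariant measures: the absolute value of a signed
invariant measure is invariant. -/
theorem eq_mul_stationary {ν : 𝒮 → ℝ} (h : ∀ s', ∑ s, ν s * net.P s s' = ν s') :
    ∃ a : ℝ, ∀ s, ν s = a * net.stationary s := by
  have hle : ∀ s', |ν s'| ≤ ∑ s, |ν s| * net.P s s' := fun s' => by
    rw [← h s']
    refine (Finset.abs_sum_le_sum_abs _ _).trans (le_of_eq (Finset.sum_congr rfl fun s _ => ?_))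
    rw [abs_mul, abs_of_nonneg (net.P_nonneg s s')]
  have hsum : ∑ s', ∑ s, |ν s| * net.P s s' = ∑ s', |ν s'| := by
    rw [Finset.sum_comm]
    exact Finset.sum_congr rfl fun s _ => by rw [← Finset.mul_sum, net.P_sum, mul_one]
  have habs : ∀ s', ∑ s, |ν s| * net.P s s' = |ν s'| := fun s' =>
    ((Finset.sum_eq_sum_iff_of_le fun s' _ => hle s').1 hsum.symm s' (Finset.mem_univ _)).symm
  have h1 := net.eq_mul_stationary_of_nonneg (ν := fun s => |ν s|) (fun s => abs_nonneg _) habs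
  have h2 := net.eq_mul_stationary_of_nonneg (ν := fun s => |ν s| + ν s)
    (fun s => by linarith [neg_abs_le (ν s)])
    (fun s' => by simp only [add_mul, Finset.sum_add_distrib, habs, h])
  refine ⟨(∑ s, (|ν s| + ν s)) - ∑ s, |ν s|, fun s => ?_⟩
  have h3 := h1 s
  have h4 := h2 s
  rw [sub_mul, ← h4, ← h3]; ring

/-- The operator `f ↦ f - P f`. -/
def generator : (𝒮 → ℝ) →ₗ[ℝ] (𝒮 → ℝ) where
  toFun f s := f s - ∑ s', net.P s s' * f s'
  map_add' f g := by ext s; simp [mul_add, Finset.sum_add_distrib]; ring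
  map_smul' a f := by
    ext s; simp only [Pi.smul_apply, smul_eq_mul, RingHom.id_apply, mul_sub, Finset.mul_sum]
    congr 1; exact Finset.sum_congr rfl fun _ _ => by ring

/-- Solvability of the Poisson equation: the left null space of `1 - P` is spanned by the
stationary distribution. -/
theorem exists_generator_eq (g : 𝒮 → ℝ) (hg : ∑ s, net.stationary s * g s = 0) :
    ∃ f, net.generator f = g := by
  classical
  by_contra hne
  have hmem : g ∉ LinearMap.range net.generator := fun ⟨f, hf⟩ => hne ⟨f, hf⟩
  obtain ⟨φ, hφ, hle⟩ := Submodule.exists_le_ker_of_notMem hmem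
  have hrep : ∀ f : 𝒮 → ℝ, φ f = ∑ s, φ (fun j => if s = j then 1 else 0) * f s := fun f => by
    rw [LinearMap.pi_apply_eq_sum_univ φ f]
    exact Finset.sum_congr rfl fun s _ => by rw [smul_eq_mul, mul_comm]
  have hinv : ∀ s', ∑ s, φ (fun j => if s = j then 1 else 0) * net.P s s' =
      φ (fun j => if s' = j then 1 else 0) := fun s' => by
    have h1 : φ (net.generator fun j => if s' = j then 1 else 0) = 0 := hle ⟨_, rfl⟩
    rw [hrep] at h1
    simp [generator, mul_sub, Finset.sum_sub_distrib] at h1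
    linarith
  obtain ⟨a, ha⟩ := net.eq_mul_stationary hinv
  apply hφ
  rw [hrep]
  simp_rw [ha, mul_assoc, ← Finset.mul_sum, hg, mul_zero]

/-- There is a deviation matrix `D`: it satisfies `(1 - P) D = 1 - Π`, where all rows of `Π` are the
stationary distribution, so that `D f` solves the Poisson equation for `f`. -/
theorem exists_deviation : ∃ D : 𝒮 → 𝒮 → ℝ, ∀ (f : 𝒮 → ℝ) s,
    ∑ s', D s s' * f s' - ∑ u, net.P s u * ∑ s', D u s' * f s' =
      f s - ∑ s', net.stationary s' * f s' := by
  classical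
  have h : ∀ s', ∃ f, net.generator f = fun s => (if s = s' then 1 else 0) - net.stationary s' :=
    fun s' => net.exists_generator_eq _ (by
      simp [mul_sub, Finset.sum_sub_distrib, ← Finset.sum_mul, net.sum_stationary])
  choose D hD using h
  refine ⟨fun s s' => D s' s, fun f s => ?_⟩
  have h1 : ∀ s', D s' s - ∑ u, net.P s u * D s' u =
      (if s = s' then 1 else 0) - net.stationary s' := fun s' => congrFun (hD s') s
  have h2 : ∑ u, net.P s u * ∑ s', D s' u * f s' = ∑ s', (∑ u, net.P s u * D s' u) * f s' := by
    simp_rw [Finset.mul_sum, Finset.sum_mul]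
    rw [Finset.sum_comm]
    exact Finset.sum_congr rfl fun _ _ => Finset.sum_congr rfl fun _ _ => by ring
  rw [h2, ← Finset.sum_sub_distrib]
  simp_rw [← sub_mul, h1, sub_mul, Finset.sum_sub_distrib]
  simp

/-- Kernel solving the Poisson equation for the values of a slot. It vanishes for a memoryless
channel, where the value does not depend on the last state. -/
def correction : 𝒮 → 𝒮 → ℝ :=
  open Classical in if net.MemorylessChannel then 0 else net.exists_deviation.choose

/-- Mean value of a slot in steady state. -/
def meanValue (w : net.Cost) (V : ℝ) (q : RateMatrix n M) : ℝ :=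
  ∑ s, net.stationary s * net.slotValue w V q s

/-- Correction of the Lyapunov function for the memory of the channel. -/
def corrector (w : net.Cost) (V : ℝ) (q : RateMatrix n M) (s : 𝒮) : ℝ :=
  ∑ s', net.correction s s' * net.slotValue w V q s'

/-- The corrector solves the Poisson equation. A memoryless channel needs no correction, since
`slotValue` is then constant in the state. -/
theorem corrector_poisson (w : net.Cost) (V : ℝ) (q : RateMatrix n M) (s : 𝒮) :
    net.corrector w V q s - ∑ u, net.P s u * net.corrector w V q u =
      net.slotValue w V q s - net.meanValue w V q := by
  unfold corrector correction
  split_ifs with h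
  · have h1 : ∀ s', net.slotValue w V q s' = net.slotValue w V q s := fun s' => by
      simp only [slotValue, txWeight_eq, h s' s]
    simp only [meanValue, h1]
    simp [← Finset.sum_mul, net.sum_stationary]
  · exact net.exists_deviation.choose_spec _ s

/-- Lipschitz constant of the corrector in the backlogs. -/
def correctorLip : ℝ := (∑ s, ∑ s', |net.correction s s'|) * net.valueLip

theorem correctorLip_nonneg : 0 ≤ net.correctorLip :=
  mul_nonneg (Finset.sum_nonneg fun _ _ => Finset.sum_nonneg fun _ _ => abs_nonneg _)
    net.valueLip_nonneg

theorem correctorLip_eq_zero (h : net.MemorylessChannel) : net.correctorLip = 0 := by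
  simp [correctorLip, correction, h]

theorem abs_corrector_sub_le (w : net.Cost) (V : ℝ) (q q' : RateMatrix n M) (s : 𝒮) :
    |net.corrector w V q s - net.corrector w V q' s| ≤ net.correctorLip * size (q - q') := by
  rw [corrector, corrector, ← Finset.sum_sub_distrib]
  refine (Finset.abs_sum_le_sum_abs _ _).trans ?_
  have h1 : ∑ s', |net.correction s s'| ≤ ∑ s, ∑ s', |net.correction s s'| :=
    Finset.single_le_sum (f := fun s => ∑ s', |net.correction s s'|)
      (fun _ _ => Finset.sum_nonneg fun _ _ => abs_nonneg _) (Finset.mem_univ s)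
  calc _ ≤ ∑ s', |net.correction s s'| * (net.valueLip * size (q - q')) :=
        Finset.sum_le_sum fun s' _ => by
          rw [← mul_sub, abs_mul]
          exact mul_le_mul_of_nonneg_left (net.abs_slotValue_sub_le w V q q' s') (abs_nonneg _)
    _ = (∑ s', |net.correction s s'|) * (net.valueLip * size (q - q')) := by rw [Finset.sum_mul]
    _ ≤ _ := by
        rw [correctorLip, mul_assoc]
        exact mul_le_mul_of_nonneg_right h1 (mul_nonneg net.valueLip_nonneg (size_nonneg _))

theorem continuous_corrector (w : net.Cost) (V : ℝ) (s : 𝒮) :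
    Continuous fun q => net.corrector w V q s :=
  continuous_of_abs_sub_le fun q q' => net.abs_corrector_sub_le w V q q' s

theorem exists_abs_corrector_le (w : net.Cost) (V : ℝ) :
    ∃ K, 0 < K ∧ ∀ q s, |net.corrector w V q s| ≤ K * (1 + size q) := by
  refine ⟨1 + net.correctorLip + ∑ s, |net.corrector w V 0 s|, ?_, fun q s => ?_⟩
  · have := net.correctorLip_nonneg
    have : 0 ≤ ∑ s, |net.corrector w V 0 s| := Finset.sum_nonneg fun _ _ => abs_nonneg _
    linarith
  · have h1 := net.abs_corrector_sub_le w V q 0 s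
    rw [sub_zero] at h1
    have h2 : |net.corrector w V 0 s| ≤ ∑ s, |net.corrector w V 0 s| :=
      Finset.single_le_sum (f := fun s => |net.corrector w V 0 s|) (fun _ _ => abs_nonneg _)
        (Finset.mem_univ s)
    have h3 := abs_sub_abs_le_abs_sub (net.corrector w V q s) (net.corrector w V 0 s)
    have h4 := size_nonneg q
    have h5 := net.correctorLip_nonneg
    have h6 : 0 ≤ ∑ s, |net.corrector w V 0 s| := Finset.sum_nonneg fun _ _ => abs_nonneg _
    nlinarith [mul_nonneg h6 h4]

end Network

/-! ### Averages of the noise of the environment -/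

theorem tendsto_div_of_tendsto_div_succ {x : ℕ → ℝ} {l : ℝ}
    (h : Tendsto (fun t : ℕ => x t / ((t : ℝ) + 1)) atTop (𝓝 l)) :
    Tendsto (fun t : ℕ => x t / (t : ℝ)) atTop (𝓝 l) := by
  have h1 : Tendsto (fun t : ℕ => ((t : ℝ) + 1) / t) atTop (𝓝 1) := by
    have := (tendsto_const_nhds (x := (1 : ℝ))).add tendsto_one_div_atTop_nhds_zero_nat
    rw [add_zero] at this
    refine this.congr' ?_
    filter_upwards [eventually_gt_atTop 0] with t ht
    field_simp
  have h2 := h.mul h1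
  rw [mul_one] at h2
  refine h2.congr' ?_
  filter_upwards [eventually_gt_atTop 0] with t ht
  field_simp

theorem monotone_add_one_pow (p : ℕ) : Monotone fun t : ℕ => ((t : ℝ) + 1) ^ p := fun s t h =>
  pow_le_pow_left₀ (by positivity) (by simpa using h) p

theorem tendsto_add_one_pow {p : ℕ} (hp : p ≠ 0) :
    Tendsto (fun t : ℕ => ((t : ℝ) + 1) ^ p) atTop atTop :=
  (tendsto_pow_atTop hp).comp (tendsto_atTop_add_const_right _ _ tendsto_natCast_atTop_atTop)

theorem summable_one_div_add_one_sq : Summable fun t : ℕ => 1 / ((t : ℝ) + 1) ^ 2 := by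
  have h1 := (Real.summable_one_div_nat_pow (p := 2)).2 (by norm_num)
  simpa using (summable_nat_add_iff 1).2 h1

section Averages

variable {Ω : Type*} [mΩ : MeasurableSpace Ω] {μ : Measure Ω} [IsProbabilityMeasure μ]
  {ℱ : Filtration ℕ mΩ} {ξ : ℕ → Ω → ℝ} {v : ℝ}

theorem IsNoise.tendsto_avg (h : IsNoise μ ℱ ξ v) {β : ℕ → Ω → ℝ}
    (hβ : ∀ t, StronglyMeasurable[ℱ t] (β t))
    (hs : ∀ᵐ ω ∂μ, Summable fun t : ℕ => (β t ω / ((t : ℝ) + 1)) ^ 2) :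
    ∀ᵐ ω ∂μ, Tendsto (fun t : ℕ => (∑ τ ∈ Finset.range t, β τ ω * ξ τ ω) / (t : ℝ)) atTop
      (𝓝 0) := by
  have hm : Monotone fun t : ℕ => (t : ℝ) + 1 := by simpa using monotone_add_one_pow 1
  have hl : Tendsto (fun t : ℕ => (t : ℝ) + 1) atTop atTop := by
    simpa using tendsto_add_one_pow one_ne_zero
  filter_upwards [h.tendsto_sum_div hβ hm (fun t => by positivity) hl hs] with ω hω
  exact tendsto_div_of_tendsto_div_succ hω

theorem IsNoise.tendsto_avg_of_bounded (h : IsNoise μ ℱ ξ v) {β : ℕ → Ω → ℝ}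
    (hβ : ∀ t, StronglyMeasurable[ℱ t] (β t)) {K : ℝ} (hK : ∀ t ω, |β t ω| ≤ K) :
    ∀ᵐ ω ∂μ, Tendsto (fun t : ℕ => (∑ τ ∈ Finset.range t, β τ ω * ξ τ ω) / (t : ℝ)) atTop
      (𝓝 0) := by
  refine h.tendsto_avg hβ (Eventually.of_forall fun ω => ?_)
  refine (summable_one_div_add_one_sq.mul_left (K ^ 2)).of_nonneg_of_le (fun t => sq_nonneg _)
    fun t => ?_
  rw [div_pow, ← sq_abs, mul_one_div]
  exact div_le_div_of_nonneg_right (pow_le_pow_left₀ (abs_nonneg _) (hK t ω) 2) (by positivity)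

theorem IsNoise.tendsto_avg_one (h : IsNoise μ ℱ ξ v) :
    ∀ᵐ ω ∂μ, Tendsto (fun t : ℕ => (∑ τ ∈ Finset.range t, ξ τ ω) / (t : ℝ)) atTop (𝓝 0) := by
  filter_upwards [h.tendsto_avg_of_bounded (β := fun _ _ => 1) (K := 1)
    (fun t => stronglyMeasurable_const) (by simp)] with ω hω
  simpa using hω

end Averages

namespace Environment

variable {n M : ℕ} {𝒮 : Type} [Fintype 𝒮] {net : Network n M 𝒮} {A : ℝ} {lam : RateMatrix n M}
  {Ω : Type*} [mΩ : MeasurableSpace Ω] {μ : Measure Ω} (env : Environment net A lam μ)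

theorem measurable_a (t : ℕ) : Measurable (env.a t) := (env.a_adapted t).mono (env.ℱ.le _) le_rfl

theorem stronglyMeasurable_a (t : ℕ) {φ : RateMatrix n M → ℝ} (hφ : Measurable φ) :
    StronglyMeasurable[env.ℱ (t + 1)] fun ω => φ (env.a t ω) :=
  (hφ.comp (env.a_adapted t)).stronglyMeasurable

/-- A function of the last state and of what is known is known. -/
theorem stronglyMeasurable_state {t u : ℕ} (hut : u ≤ t) {h : 𝒮 → Ω → ℝ}
    (hh : ∀ s, StronglyMeasurable[env.ℱ t] (h s)) :
    StronglyMeasurable[env.ℱ t] fun ω => h (env.S u ω) ω := by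
  classical
  have : (fun ω => h (env.S u ω) ω) =
      fun ω => ∑ s, ({ω | env.S u ω = s}.indicator (h s)) ω := by
    ext ω
    rw [Finset.sum_eq_single (env.S u ω)]
    · simp
    · intro s _ hs; simp [Ne.symm hs]
    · simp
  rw [this]
  exact Finset.stronglyMeasurable_fun_sum _ fun s _ =>
    (hh s).indicator (env.ℱ.mono hut _ (env.S_adapted u s))

theorem sum_nonneg (t : ℕ) (ω : Ω) (i : Node n) : 0 ≤ ∑ c, env.a t ω i c :=
  Finset.sum_nonneg fun c _ => env.a_nonneg t ω i c

theorem lam_nonneg (env : Environment net A lam μ) (i : Node n) (c : Commodity n M) :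
    0 ≤ lam i c := by
  rw [← env.a_mean 0 i c]
  exact integral_nonneg fun ω => env.a_nonneg 0 ω i c

theorem measurable_sum_entries (i : Node n) :
    Measurable fun x : RateMatrix n M => ∑ c, x i c := by fun_prop

/-- The indicator of the next state minus its conditional probability. -/
def stateNoise (s : 𝒮) (t : ℕ) (ω : Ω) : ℝ :=
  {ω | env.S (t + 1) ω = s}.indicator (fun _ => (1 : ℝ)) ω - net.P (env.S t ω) s

/-- The deviation of a statistic of the arrivals of a slot from its mean. -/
def arrivalNoise (φ : RateMatrix n M → ℝ) (t : ℕ) (ω : Ω) : ℝ :=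
  φ (env.a t ω) - ∫ ω, φ (env.a 0 ω) ∂μ

theorem stateNoise_eq [DecidableEq 𝒮] (s : 𝒮) (t : ℕ) (ω : Ω) : env.stateNoise s t ω =
    (if env.S (t + 1) ω = s then 1 else 0) - net.P (env.S t ω) s := by
  simp [stateNoise, Set.indicator_apply]

/-- The noise that the next state brings into the expectation of a function. -/
theorem sum_mul_stateNoise (h : 𝒮 → ℝ) (t : ℕ) (ω : Ω) :
    ∑ s, h s * env.stateNoise s t ω =
      h (env.S (t + 1) ω) - ∑ s, net.P (env.S t ω) s * h s := by
  classical
  simp_rw [stateNoise_eq, mul_sub, Finset.sum_sub_distrib]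
  simp [mul_comm]

variable [IsProbabilityMeasure μ]

theorem isNoise_state (s : 𝒮) : IsNoise μ env.ℱ (env.stateNoise s) 1 := by
  classical
  have hP1 : ∀ s', net.P s' s ≤ 1 := fun s' => by
    rw [← net.P_sum s']
    exact Finset.single_le_sum (fun u _ => net.P_nonneg s' u) (Finset.mem_univ s)
  have habs : ∀ t ω, |env.stateNoise s t ω| ≤ 1 := fun t ω => by
    rw [stateNoise_eq, abs_le]
    have h1 := hP1 (env.S t ω)
    have h2 := net.P_nonneg (env.S t ω) s
    split_ifs <;> constructor <;> linarith
  have hmP : ∀ t, StronglyMeasurable[env.ℱ t] fun ω => net.P (env.S t ω) s := fun t =>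
    env.stronglyMeasurable_state (h := fun u _ => net.P u s) le_rfl
      fun u => stronglyMeasurable_const
  have hmI : ∀ t, StronglyMeasurable[env.ℱ (t + 1)]
      ({ω | env.S (t + 1) ω = s}.indicator (fun _ => (1 : ℝ))) := fun t =>
    stronglyMeasurable_const.indicator (env.S_adapted (t + 1) s)
  have hm : ∀ t, StronglyMeasurable[env.ℱ (t + 1)] (env.stateNoise s t) := fun t =>
    (hmI t).sub ((hmP t).mono (env.ℱ.mono (Nat.le_succ t)))
  have hiI : ∀ t, Integrable ({ω | env.S (t + 1) ω = s}.indicator (fun _ => (1 : ℝ))) μ := fun t =>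
    (integrable_const 1).indicator (env.ℱ.le _ _ (env.S_adapted (t + 1) s))
  have hiP : ∀ t, Integrable (fun ω => net.P (env.S t ω) s) μ := fun t =>
    Integrable.of_bound ((hmP t).mono (env.ℱ.le t)).aestronglyMeasurable 1
      (Eventually.of_forall fun ω => by
        rw [Real.norm_of_nonneg (net.P_nonneg _ _)]; exact hP1 _)
  have hsq : ∀ t, Integrable (fun ω => env.stateNoise s t ω ^ 2) μ := fun t =>
    Integrable.of_bound (((hm t).mono (env.ℱ.le _)).pow 2).aestronglyMeasurable 1
      (Eventually.of_forall fun ω => by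
        rw [Real.norm_eq_abs, abs_pow]; exact pow_le_one₀ (abs_nonneg _) (habs t ω))
  refine ⟨hm, fun t => ?_, fun t => ?_, fun t => ?_⟩
  · exact MemLp.of_bound ((hm t).mono (env.ℱ.le _)).aestronglyMeasurable 1
      (Eventually.of_forall (habs t))
  · have h1 : env.stateNoise s t = {ω | env.S (t + 1) ω = s}.indicator (fun _ => (1 : ℝ)) -
        fun ω => net.P (env.S t ω) s := rfl
    rw [h1]
    filter_upwards [condExp_sub (hiI t) (hiP t) (env.ℱ t), env.S_markov t s] with ω h2 h3
    rw [h2, Pi.sub_apply, h3, condExp_of_stronglyMeasurable (env.ℱ.le t) (hmP t) (hiP t)]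
    simp
  · have h1 : μ[fun ω => env.stateNoise s t ω ^ 2 | env.ℱ t] ≤ᵐ[μ] μ[fun _ => (1 : ℝ) | env.ℱ t] :=
      condExp_mono (hsq t) (integrable_const _) (Eventually.of_forall fun ω => by
        simp only
        rw [← sq_abs]; exact pow_le_one₀ (abs_nonneg _) (habs t ω))
    rwa [condExp_const (env.ℱ.le t)] at h1

theorem isNoise_arrival {φ : RateMatrix n M → ℝ} (hφ : Measurable φ)
    (hL : MemLp (fun ω => φ (env.a 0 ω)) 2 μ) :
    IsNoise μ env.ℱ (env.arrivalNoise φ) (∫ ω, env.arrivalNoise φ 0 ω ^ 2 ∂μ) := by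
  have hid : ∀ t, IdentDistrib (fun ω => φ (env.a t ω)) (fun ω => φ (env.a 0 ω)) μ μ := fun t =>
    (env.a_ident t).comp hφ
  have hLt : ∀ t, MemLp (fun ω => φ (env.a t ω)) 2 μ := fun t => (hid t).memLp_iff.2 hL
  have hcomap : ∀ t, MeasurableSpace.comap (env.a t) inferInstance ≤ mΩ := fun t =>
    (env.measurable_a t).comap_le
  have hm' : ∀ t, StronglyMeasurable[MeasurableSpace.comap (env.a t) inferInstance]
      fun ω => φ (env.a t ω) := fun t =>
    (hφ.comp (comap_measurable (env.a t))).stronglyMeasurable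
  refine ⟨fun t => (env.stronglyMeasurable_a t hφ).sub stronglyMeasurable_const,
    fun t => (hLt t).sub (memLp_const _), fun t => ?_, fun t => ?_⟩
  · have h1 := condExp_indep_eq (hcomap t) (env.ℱ.le t)
      ((hm' t).sub (stronglyMeasurable_const (b := ∫ ω, φ (env.a 0 ω) ∂μ))) (env.a_indep t)
    refine h1.trans (Eventually.of_forall fun ω => ?_)
    simp only [Pi.sub_apply]
    rw [integral_sub ((hLt t).integrable (by norm_num)) (integrable_const _), integral_const,
      probReal_univ, one_smul, (hid t).integral_eq]
    simp
  · have h1 := condExp_indep_eq (hcomap t) (env.ℱ.le t)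
      (((hm' t).sub (stronglyMeasurable_const (b := ∫ ω, φ (env.a 0 ω) ∂μ))).pow 2)
      (env.a_indep t)
    refine (h1.trans (Eventually.of_forall fun ω => ?_)).le
    have h2 : IdentDistrib (fun ω => env.arrivalNoise φ t ω ^ 2)
        (fun ω => env.arrivalNoise φ 0 ω ^ 2) μ μ :=
      (env.a_ident t).comp (u := fun x => (φ x - ∫ ω, φ (env.a 0 ω) ∂μ) ^ 2)
        ((hφ.sub_const _).pow_const 2)
    exact h2.integral_eq

omit [IsProbabilityMeasure μ] in
theorem memLp_sum_sq (i : Node n) : MemLp (fun ω => (∑ c, env.a 0 ω i c) ^ 2) 2 μ := by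
  have hm : AEStronglyMeasurable (fun ω => (∑ c, env.a 0 ω i c) ^ 2) μ :=
    (((measurable_sum_entries i).comp (env.measurable_a 0)).pow_const 2).aestronglyMeasurable
  refine (memLp_two_iff_integrable_sq hm).2 ((env.a_fourth_integrable 0 i).congr
    (Eventually.of_forall fun ω => ?_))
  simp only; ring

theorem memLp_sum (i : Node n) : MemLp (fun ω => ∑ c, env.a 0 ω i c) 2 μ := by
  have hm : AEStronglyMeasurable (fun ω => ∑ c, env.a 0 ω i c) μ :=
    ((measurable_sum_entries i).comp (env.measurable_a 0)).aestronglyMeasurable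
  exact (memLp_two_iff_integrable_sq hm).2 ((env.memLp_sum_sq i).integrable (by norm_num))

theorem memLp_entry (i : Node n) (c : Commodity n M) : MemLp (fun ω => env.a 0 ω i c) 2 μ := by
  have hm : Measurable fun x : RateMatrix n M => x i c := by fun_prop
  refine (env.memLp_sum i).mono (hm.comp (env.measurable_a 0)).aestronglyMeasurable
    (Eventually.of_forall fun ω => ?_)
  rw [Real.norm_of_nonneg (env.a_nonneg 0 ω i c), Real.norm_of_nonneg (env.sum_nonneg 0 ω i)]
  exact Finset.single_le_sum (fun c _ => env.a_nonneg 0 ω i c) (Finset.mem_univ c)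

theorem integral_sum_sq_le (i : Node n) :
    ∫ ω, (∑ c, env.a 0 ω i c) ^ 2 ∂μ ≤ A ^ 2 := by
  have h1 := variance_nonneg (fun ω => (∑ c, env.a 0 ω i c) ^ 2) μ
  rw [variance_eq_sub (env.memLp_sum_sq i)] at h1
  have h2 : μ[(fun ω => (∑ c, env.a 0 ω i c) ^ 2) ^ 2] ≤ A ^ 4 := by
    refine le_trans (le_of_eq (integral_congr_ae (Eventually.of_forall fun ω => ?_)))
      (env.a_fourth 0 i)
    simp only [Pi.pow_apply]; ring
  exact (le_abs_self _).trans (abs_le_of_sq_le_sq (by nlinarith) (sq_nonneg A))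

theorem integral_sum_le (hA : 0 ≤ A) (i : Node n) : ∫ ω, ∑ c, env.a 0 ω i c ∂μ ≤ A := by
  have h1 := variance_nonneg (fun ω => ∑ c, env.a 0 ω i c) μ
  rw [variance_eq_sub (env.memLp_sum i)] at h1
  have h2 : μ[(fun ω => ∑ c, env.a 0 ω i c) ^ 2] ≤ A ^ 2 := env.integral_sum_sq_le i
  exact (le_abs_self _).trans (abs_le_of_sq_le_sq (by linarith) hA)

theorem isNoise_entry (i : Node n) (c : Commodity n M) : IsNoise μ env.ℱ
    (fun t ω => env.a t ω i c - lam i c)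
    (∫ ω, env.arrivalNoise (fun x => x i c) 0 ω ^ 2 ∂μ) := by
  have h := env.isNoise_arrival (φ := fun x => x i c) (by fun_prop) (env.memLp_entry i c)
  have : env.arrivalNoise (fun x => x i c) = fun t ω => env.a t ω i c - lam i c := by
    ext t ω; rw [arrivalNoise, env.a_mean]
  rwa [this] at h ⊢

/-- Law of large numbers for the arrivals. -/
theorem tendsto_avg_pairing (q : RateMatrix n M) : ∀ᵐ ω ∂μ, Tendsto
    (fun t : ℕ => (∑ τ ∈ Finset.range t, pairing q (env.a τ ω)) / (t : ℝ)) atTop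
      (𝓝 (pairing q lam)) := by
  have h : ∀ᵐ ω ∂μ, ∀ i c, Tendsto
      (fun t : ℕ => (∑ τ ∈ Finset.range t, (env.a τ ω i c - lam i c)) / (t : ℝ)) atTop (𝓝 0) :=
    ae_all_iff.2 fun i => ae_all_iff.2 fun c => (env.isNoise_entry i c).tendsto_avg_one
  filter_upwards [h] with ω hω
  have h1 : Tendsto (fun t : ℕ => ∑ i, ∑ c, q i c *
      ((∑ τ ∈ Finset.range t, (env.a τ ω i c - lam i c)) / (t : ℝ) + lam i c)) atTop
      (𝓝 (pairing q lam)) := by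
    unfold pairing
    refine tendsto_finsetSum _ fun i _ => tendsto_finsetSum _ fun c _ => ?_
    simpa using ((hω i c).add_const (lam i c)).const_mul (q i c)
  refine h1.congr' ?_
  filter_upwards [eventually_gt_atTop 0] with t ht
  have ht' : (t : ℝ) ≠ 0 := by positivity
  have h2 : ∀ i c, (∑ τ ∈ Finset.range t, (env.a τ ω i c - lam i c)) / (t : ℝ) + lam i c =
      (∑ τ ∈ Finset.range t, env.a τ ω i c) / t := fun i c => by
    rw [Finset.sum_sub_distrib]
    simp; field_simp; ring
  have h3 : ∑ τ ∈ Finset.range t, pairing q (env.a τ ω) =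
      ∑ i, ∑ c, q i c * ∑ τ ∈ Finset.range t, env.a τ ω i c := by
    simp_rw [pairing, Finset.mul_sum]
    rw [Finset.sum_comm]
    exact Finset.sum_congr rfl fun i _ => Finset.sum_comm
  simp_rw [h2, h3, Finset.sum_div, mul_div_assoc, Finset.sum_div]

/-- Ergodic theorem for the network state. -/
theorem tendsto_avg_state (f : 𝒮 → ℝ) : ∀ᵐ ω ∂μ, Tendsto
    (fun t : ℕ => (∑ τ ∈ Finset.range t, f (env.S τ ω)) / (t : ℝ)) atTop
      (𝓝 (∑ s, net.stationary s * f s)) := by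
  obtain ⟨D, hD⟩ := net.exists_deviation
  set g : 𝒮 → ℝ := fun s => ∑ s', D s s' * f s' with hg
  have hpoi : ∀ s, g s - ∑ u, net.P s u * g u = f s - ∑ s', net.stationary s' * f s' := hD f
  set m : ℝ := ∑ s, net.stationary s * f s
  have h : ∀ᵐ ω ∂μ, ∀ s, Tendsto
      (fun t : ℕ => (∑ τ ∈ Finset.range t, env.stateNoise s τ ω) / (t : ℝ)) atTop (𝓝 0) :=
    ae_all_iff.2 fun s => (env.isNoise_state s).tendsto_avg_one
  filter_upwards [h] with ω hω
  set R : ℝ := ∑ s, |g s| with hR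
  have hgR : ∀ s, |g s| ≤ R := fun s =>
    Finset.single_le_sum (f := fun s => |g s|) (fun _ _ => abs_nonneg _) (Finset.mem_univ s)
  have h0 : Tendsto (fun t : ℕ => (g (env.S 0 ω) - g (env.S t ω)) / (t : ℝ)) atTop (𝓝 0) := by
    refine squeeze_zero_norm (a := fun t : ℕ => 2 * R / (t : ℝ)) (fun t => ?_)
      (tendsto_const_div_atTop_nhds_zero_nat _)
    rw [norm_div, Real.norm_natCast]
    refine div_le_div_of_nonneg_right ?_ (Nat.cast_nonneg t)
    have h1 := hgR (env.S 0 ω)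
    have h2 := hgR (env.S t ω)
    exact (abs_sub _ _).trans (by linarith)
  have h1 : Tendsto (fun t : ℕ => ∑ s, g s * ((∑ τ ∈ Finset.range t, env.stateNoise s τ ω) / (t : ℝ)))
      atTop (𝓝 0) := by
    have := tendsto_finsetSum (Finset.univ : Finset 𝒮) fun s _ => (hω s).const_mul (g s)
    simpa using this
  have h2 := (h0.add h1).add_const m
  rw [add_zero, zero_add] at h2
  refine h2.congr' ?_
  filter_upwards [eventually_gt_atTop 0] with t ht
  have ht' : (t : ℝ) ≠ 0 := by positivity
  have h3 : ∑ τ ∈ Finset.range t, (f (env.S τ ω) - m) =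
      (g (env.S 0 ω) - g (env.S t ω)) + ∑ s, g s * ∑ τ ∈ Finset.range t, env.stateNoise s τ ω := by
    simp_rw [Finset.mul_sum]
    rw [Finset.sum_comm]
    simp_rw [env.sum_mul_stateNoise g]
    have h4 := Finset.sum_range_sub (fun τ => g (env.S τ ω)) t
    rw [show g (env.S 0 ω) - g (env.S t ω) =
      ∑ τ ∈ Finset.range t, (g (env.S τ ω) - g (env.S (τ + 1) ω)) by
        rw [Finset.sum_range_sub' (fun τ => g (env.S τ ω))], ← Finset.sum_add_distrib]
    exact Finset.sum_congr rfl fun τ _ => by rw [← hpoi]; ring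
  rw [Finset.sum_sub_distrib, Finset.sum_const, Finset.card_range, nsmul_eq_mul] at h3
  have h5 : ∑ τ ∈ Finset.range t, f (env.S τ ω) = (g (env.S 0 ω) - g (env.S t ω)) +
      ∑ s, g s * ∑ τ ∈ Finset.range t, env.stateNoise s τ ω + t * m := by linarith
  rw [h5, add_div, add_div, mul_div_cancel_left₀ _ ht', Finset.sum_div]
  simp_rw [mul_div_assoc]

end Environment

/-! ### Drift of a slot -/

theorem sum_sq_le_sq_sum {ι : Type*} [Fintype ι] {f : ι → ℝ} (hf : ∀ i, 0 ≤ f i) :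
    ∑ i, f i ^ 2 ≤ (∑ i, f i) ^ 2 := by
  rw [sq (∑ i, f i), Finset.sum_mul]
  refine Finset.sum_le_sum fun i _ => ?_
  rw [sq]
  exact mul_le_mul_of_nonneg_left
    (Finset.single_le_sum (fun j _ => hf j) (Finset.mem_univ i)) (hf i)

section Decision

variable {n M : ℕ} {𝒮 : Type} [Fintype 𝒮] (net : Network n M 𝒮)

/-- What the nodes decide before the network state of the slot is revealed: resource units, the
job to process and the commodity to transmit. -/
structure Network.Decision where
  kpr : ∀ i, Fin (net.Kpr i + 1)
  ktr : ∀ i, Fin (net.Ktr i + 1)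
  job : Node n → Job n M
  com : Node n → Commodity n M

namespace Network.Decision

variable {net} (δ : net.Decision) (Q : RateMatrix n M) (s : 𝒮)
  (fwd : Node n → Fin n → Option (Node n))

/-- Total rate assigned to the removal of commodity `c` from the queue of node `i`. -/
def out (i : Node n) (c : Commodity n M) : ℝ :=
  ∑ j, txAssigned net i (δ.ktr i) (δ.com i) s (fwd i) j c +
    ∑ m : Fin M, if m.castSucc = c.2 then
      procAssigned net Q i (δ.kpr i) (δ.job i) (c.1, m) else 0

/-- Total rate at which commodity `c` is assigned to enter the queue of node `i`. -/
def inn (i : Node n) (c : Commodity n M) : ℝ :=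
  ∑ j, txAssigned net j (δ.ktr j) (δ.com j) s (fwd j) i c +
    ∑ m : Fin M, if m.succ = c.2 then
      net.ξ m * procAssigned net Q i (δ.kpr i) (δ.job i) (c.1, m) else 0

/-- The value that a decision realises at backlogs `Q` in state `s`. -/
def value : ℝ := ∑ i, (net.txValue Q i (δ.ktr i) s (δ.com i) +
  net.Rpr i (δ.kpr i) * procWeight net Q i (δ.job i))

theorem txAssigned_nonneg (i : Node n) (k : Fin (net.Ktr i + 1)) (best : Commodity n M)
    (f : Fin n → Option (Node n)) (j : Node n) (c : Commodity n M) :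
    0 ≤ txAssigned net i k best s f j c := by
  unfold txAssigned
  split_ifs
  · exact Finset.sum_nonneg fun v _ => by
      split_ifs; exacts [net.partitionRate_nonneg i k s v, le_rfl]
  · exact le_rfl

theorem procAssigned_nonneg (i : Node n) (k : Fin (net.Kpr i + 1)) (best b : Job n M) :
    0 ≤ procAssigned net Q i k best b := by
  unfold procAssigned
  split_ifs
  · exact div_nonneg (net.Rpr_nonneg i k) (net.r_pos _).le
  · exact le_rfl

theorem out_nonneg (i : Node n) (c : Commodity n M) : 0 ≤ δ.out Q s fwd i c :=
  add_nonneg (Finset.sum_nonneg fun _ _ => txAssigned_nonneg _ _ _ _ _ _ _)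
    (Finset.sum_nonneg fun _ _ => by split_ifs; exacts [procAssigned_nonneg _ _ _ _ _, le_rfl])

theorem inn_nonneg (i : Node n) (c : Commodity n M) : 0 ≤ δ.inn Q s fwd i c :=
  add_nonneg (Finset.sum_nonneg fun _ _ => txAssigned_nonneg _ _ _ _ _ _ _)
    (Finset.sum_nonneg fun m _ => by
      split_ifs
      exacts [mul_nonneg (net.ξ_pos m).le (procAssigned_nonneg _ _ _ _ _), le_rfl])

/-- Sums over the commodities of contributions of the functions that concern them are sums over the
jobs. -/
theorem sum_stage {M : ℕ} (g : Fin M → Fin (M + 1)) (F : Commodity n M → Fin M → ℝ) :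
    ∑ c : Commodity n M, ∑ m : Fin M, (if g m = c.2 then F c m else 0) =
      ∑ b : Job n M, F (b.1, g b.2) b.2 := by
  rw [Fintype.sum_prod_type, Fintype.sum_prod_type]
  refine Finset.sum_congr rfl fun d _ => ?_
  rw [Finset.sum_comm]
  exact Finset.sum_congr rfl fun m _ => by simp

theorem sum_procAssigned (i : Node n) (k : Fin (net.Kpr i + 1)) (best : Job n M)
    (x : Job n M → ℝ) : ∑ b, x b * procAssigned net Q i k best b =
      if 0 < procWeight net Q i best then x best * (net.Rpr i k / net.r best.2) else 0 := by
  rw [Finset.sum_eq_single best]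
  · simp [procAssigned]
  · intro b _ hb; simp [procAssigned, hb]
  · simp

theorem sum_txAssigned (i : Node n) (k : Fin (net.Ktr i + 1)) (best : Commodity n M)
    (f : Fin n → Option (Node n)) (j : Node n) (x : Commodity n M → ℝ) :
    ∑ c, x c * txAssigned net i k best s f j c =
      x best * ∑ v, if f v = some j then net.partitionRate i k s v else 0 := by
  rw [Finset.sum_eq_single best]
  · simp [txAssigned]
  · intro b _ hb; simp [txAssigned, hb]
  · simp

theorem sum_out_le (i : Node n) : ∑ c, δ.out Q s fwd i c ≤ net.outBound i := by
  unfold out Network.outBound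
  rw [Finset.sum_add_distrib]
  refine add_le_add ?_ ?_
  · rw [Finset.sum_comm]
    have h1 : ∀ j, ∑ c, txAssigned net i (δ.ktr i) (δ.com i) s (fwd i) j c =
        ∑ v, if fwd i v = some j then net.partitionRate i (δ.ktr i) s v else 0 := fun j => by
      simpa using sum_txAssigned s i (δ.ktr i) (δ.com i) (fwd i) j fun _ => 1
    simp_rw [h1]
    rw [Finset.sum_comm]
    refine le_trans (Finset.sum_le_sum fun v _ => ?_) (net.sum_partitionRate_le_maxOut i
      (δ.ktr i) s)
    cases h : fwd i v with
    | none => simpa using net.partitionRate_nonneg i _ s v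
    | some j => simp
  · rw [sum_stage Fin.castSucc fun c m =>
      procAssigned net Q i (δ.kpr i) (δ.job i) (c.1, m)]
    have := sum_procAssigned Q i (δ.kpr i) (δ.job i) fun _ => 1
    simp only [one_mul] at this
    rw [this]
    split_ifs
    · exact net.Rpr_div_r_le i _ _
    · exact div_nonneg (net.maxProc_nonneg i) net.iInf_r_pos.le

variable {Q s fwd}
variable (hf : ∀ i v, IsForwarding net Q i (δ.com i) s v (fwd i v))

include hf in
theorem mem_receiverSet_of_fwd {i j : Node n} {v : Fin n} (h : fwd i v = some j) :
    j ∈ net.receiverSet i s v := by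
  have := hf i v
  rw [h] at this
  exact this.1

include hf in
theorem sum_inn_le (i : Node n) : ∑ c, δ.inn Q s fwd i c ≤ net.inBound i := by
  unfold inn Network.inBound
  rw [Finset.sum_add_distrib]
  refine add_le_add ?_ ?_
  · rw [Finset.sum_comm]
    have h1 : ∀ j, ∑ c, txAssigned net j (δ.ktr j) (δ.com j) s (fwd j) i c =
        ∑ v, if fwd j v = some i then net.partitionRate j (δ.ktr j) s v else 0 := fun j => by
      simpa using sum_txAssigned s j (δ.ktr j) (δ.com j) (fwd j) i fun _ => 1
    simp_rw [h1]
    refine le_trans ?_ (net.sum_txRate_le_maxIn i s δ.ktr)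
    rw [← Finset.add_sum_erase _ _ (Finset.mem_univ i)]
    have h2 : ∑ v, (if fwd i v = some i then net.partitionRate i (δ.ktr i) s v else 0) = 0 :=
      Finset.sum_eq_zero fun v _ => if_neg fun h =>
        net.ne_of_mem_receiverSet (δ.mem_receiverSet_of_fwd hf h) rfl
    rw [h2, zero_add]
    refine Finset.sum_le_sum fun j hj => ?_
    rw [← net.sum_partitionRate_decoded (δ.ktr j) s (Finset.ne_of_mem_erase hj).symm]
    refine Finset.sum_le_sum fun v _ => ?_
    split_ifs with h3 h4 h4
    · exact le_rfl
    · exact absurd (δ.mem_receiverSet_of_fwd hf h3) h4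
    · exact net.partitionRate_nonneg j _ s v
    · exact le_rfl
  · rw [sum_stage Fin.succ fun c m =>
      net.ξ m * procAssigned net Q i (δ.kpr i) (δ.job i) (c.1, m)]
    have := sum_procAssigned Q i (δ.kpr i) (δ.job i) fun b => net.ξ b.2
    rw [this, mul_div_assoc]
    split_ifs
    · exact mul_le_mul (net.ξ_le_iSup _) (net.Rpr_div_r_le i _ _)
        (div_nonneg (net.Rpr_nonneg i _) (net.r_pos _).le) net.iSup_ξ_nonneg
    · exact mul_nonneg net.iSup_ξ_nonneg (div_nonneg (net.maxProc_nonneg i) net.iInf_r_pos.le)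

include hf in
/-- The assigned rates realise the value of the decision as a decrease of backlog products. -/
theorem sum_mul_out_sub_inn :
    ∑ i, ∑ c, Q i c * (δ.out Q s fwd i c - δ.inn Q s fwd i c) = δ.value Q s := by
  have htx : ∀ i, ∑ j, ∑ c, (Q i c - Q j c) *
      txAssigned net i (δ.ktr i) (δ.com i) s (fwd i) j c =
      net.txValue Q i (δ.ktr i) s (δ.com i) := by
    intro i
    have h1 : ∀ j, ∑ c, (Q i c - Q j c) *
        txAssigned net i (δ.ktr i) (δ.com i) s (fwd i) j c =
        (Q i (δ.com i) - Q j (δ.com i)) *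
          ∑ v, if fwd i v = some j then net.partitionRate i (δ.ktr i) s v else 0 := fun j =>
      sum_txAssigned s i (δ.ktr i) (δ.com i) (fwd i) j fun c => Q i c - Q j c
    simp_rw [h1, Finset.mul_sum]
    rw [Finset.sum_comm, Network.txValue]
    refine Finset.sum_congr rfl fun v _ => ?_
    have h2 := hf i v
    cases h : fwd i v with
    | none =>
      rw [h] at h2
      have h3 : net.partitionValue Q i (δ.com i) s v = 0 :=
        le_antisymm (Finset.sup'_le _ _ fun j hj => (h2 j hj).le)
          (net.partitionValue_nonneg _ _ _ _ _)
      simp [h3]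
    | some j =>
      rw [h] at h2
      obtain ⟨h3, h4, h5⟩ := h2
      have h6 : net.partitionValue Q i (δ.com i) s v = diffWeight Q i j (δ.com i) :=
        le_antisymm (Finset.sup'_le _ _ h5) (net.diffWeight_le_partitionValue _ _ h3)
      have h7 : diffWeight Q i j (δ.com i) = Q i (δ.com i) - Q j (δ.com i) := by
        unfold diffWeight at h4 ⊢
        exact max_eq_left (le_of_lt (by simpa using h4))
      rw [Finset.sum_eq_single j]
      · rw [if_pos rfl, h6, h7, mul_comm]
      · intro j' _ hj'
        rw [if_neg (fun e => hj' (Option.some.inj e).symm), mul_zero]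
      · simp
  have hpr : ∀ i, ∑ b : Job n M, (Q i (b.1, b.2.castSucc) - net.ξ b.2 * Q i (b.1, b.2.succ)) *
      procAssigned net Q i (δ.kpr i) (δ.job i) b =
      net.Rpr i (δ.kpr i) * procWeight net Q i (δ.job i) := by
    intro i
    rw [sum_procAssigned]
    split_ifs with h
    · have h1 : 0 < max (Q i ((δ.job i).1, (δ.job i).2.castSucc) -
          net.ξ (δ.job i).2 * Q i ((δ.job i).1, (δ.job i).2.succ)) 0 :=
        pos_of_mul_pos_right h (one_div_nonneg.2 (net.r_pos _).le)
      have h2 : max (Q i ((δ.job i).1, (δ.job i).2.castSucc) -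
          net.ξ (δ.job i).2 * Q i ((δ.job i).1, (δ.job i).2.succ)) 0 = _ :=
        max_eq_left (le_of_lt (by simpa using h1))
      rw [procWeight, h2]; ring
    · rw [le_antisymm (not_lt.1 h) (net.procWeight_nonneg Q i _), mul_zero]
  have h1 : ∀ i, ∑ c, Q i c * δ.out Q s fwd i c =
      ∑ j, ∑ c, Q i c * txAssigned net i (δ.ktr i) (δ.com i) s (fwd i) j c +
      ∑ b : Job n M, Q i (b.1, b.2.castSucc) *
        procAssigned net Q i (δ.kpr i) (δ.job i) b := fun i => by
    simp only [out, mul_add, Finset.sum_add_distrib, Finset.mul_sum, mul_ite, mul_zero]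
    rw [Finset.sum_comm, sum_stage Fin.castSucc fun c m => Q i c *
      procAssigned net Q i (δ.kpr i) (δ.job i) (c.1, m)]
  have h2 : ∀ i, ∑ c, Q i c * δ.inn Q s fwd i c =
      ∑ j, ∑ c, Q i c * txAssigned net j (δ.ktr j) (δ.com j) s (fwd j) i c +
      ∑ b : Job n M, net.ξ b.2 * Q i (b.1, b.2.succ) *
        procAssigned net Q i (δ.kpr i) (δ.job i) b := fun i => by
    simp only [inn, mul_add, Finset.sum_add_distrib, Finset.mul_sum, mul_ite, mul_zero]
    rw [Finset.sum_comm, sum_stage Fin.succ fun c m => Q i c * (net.ξ m *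
      procAssigned net Q i (δ.kpr i) (δ.job i) (c.1, m))]
    congr 1
    exact Finset.sum_congr rfl fun b _ => by ring
  have h3 : ∑ i, ∑ j, ∑ c, Q i c * txAssigned net j (δ.ktr j) (δ.com j) s (fwd j) i c =
      ∑ i, ∑ j, ∑ c, Q j c * txAssigned net i (δ.ktr i) (δ.com i) s (fwd i) j c :=
    Finset.sum_comm
  simp_rw [mul_sub, Finset.sum_sub_distrib, h1, h2, Finset.sum_add_distrib, h3, value,
    Finset.sum_add_distrib, ← htx, ← hpr, sub_mul, Finset.sum_sub_distrib]
  ring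

end Network.Decision

/-- The quadratic Lyapunov function. -/
def lyap (Q : RateMatrix n M) : ℝ := (1 / 2) * ∑ i, ∑ c, Q i c ^ 2

theorem lyap_nonneg (Q : RateMatrix n M) : 0 ≤ lyap Q :=
  mul_nonneg (by norm_num) (Finset.sum_nonneg fun _ _ => Finset.sum_nonneg fun _ _ => sq_nonneg _)

theorem sq_le_lyap (Q : RateMatrix n M) (i : Node n) (c : Commodity n M) :
    Q i c ^ 2 ≤ 2 * lyap Q := by
  have h1 := Finset.single_le_sum (f := fun c => Q i c ^ 2) (fun _ _ => sq_nonneg _)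
    (Finset.mem_univ c)
  have h2 := Finset.single_le_sum (f := fun i => ∑ c, Q i c ^ 2)
    (fun _ _ => Finset.sum_nonneg fun _ _ => sq_nonneg _) (Finset.mem_univ i)
  unfold lyap
  linarith

theorem lyap_le (Q : RateMatrix n M) : lyap Q ≤ size Q ^ 2 := by
  have h1 : ∀ i, ∑ c, Q i c ^ 2 ≤ (∑ c, |Q i c|) ^ 2 := fun i => by
    simp_rw [← sq_abs (Q i _)]
    exact sum_sq_le_sq_sum fun _ => abs_nonneg _
  have h2 : ∑ i, (∑ c, |Q i c|) ^ 2 ≤ size Q ^ 2 :=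
    sum_sq_le_sq_sum fun _ => Finset.sum_nonneg fun _ _ => abs_nonneg _
  have h3 := (Finset.sum_le_sum fun i _ => h1 i).trans h2
  have : lyap Q ≤ ∑ i, ∑ c, Q i c ^ 2 := by
    have := lyap_nonneg Q
    unfold lyap at *
    linarith
  exact this.trans h3

theorem size_sq_le (Q : RateMatrix n M) :
    size Q ^ 2 ≤ 2 * Fintype.card (Node n × Commodity n M) * lyap Q := by
  have h := sq_sum_le_card_mul_sum_sq (s := Finset.univ)
    (f := fun p : Node n × Commodity n M => |Q p.1 p.2|)
  simp only [sq_abs, Finset.card_univ] at h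
  rw [Fintype.sum_prod_type (f := fun p : Node n × Commodity n M => |Q p.1 p.2|),
    Fintype.sum_prod_type (f := fun p : Node n × Commodity n M => Q p.1 p.2 ^ 2)] at h
  unfold lyap size
  linarith

/-- Squaring a queueing recursion with departures `b` and arrivals `d + a`. -/
theorem half_sq_le_of_le {x x' a b d : ℝ} (hx : 0 ≤ x) (hx' : 0 ≤ x') (hb : 0 ≤ b) (hd : 0 ≤ d)
    (ha : 0 ≤ a) (h : x' ≤ max (x - b) 0 + d + a) :
    x' ^ 2 ≤ x ^ 2 + b ^ 2 + (d + a) ^ 2 + 2 * (x * a) - 2 * (x * (b - d)) := by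
  have h1 : x' ^ 2 ≤ (max (x - b) 0 + d + a) ^ 2 := pow_le_pow_left₀ hx' h 2
  rcases le_total (x - b) 0 with h2 | h2
  · rw [max_eq_right h2] at h1
    nlinarith [sq_nonneg (x - b), mul_nonneg hx (add_nonneg hd ha)]
  · rw [max_eq_left h2] at h1
    nlinarith [mul_nonneg hb (add_nonneg hd ha)]

variable {net} in
/-- One-slot drift of the quadratic Lyapunov function. -/
theorem lyap_step (δ : net.Decision) {Q Q' a : RateMatrix n M} {s : 𝒮}
    {fwd : Node n → Fin n → Option (Node n)} (hQ : ∀ i c, 0 ≤ Q i c) (hQ' : ∀ i c, 0 ≤ Q' i c)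
    (ha : ∀ i c, 0 ≤ a i c)
    (hf : ∀ i v, IsForwarding net Q i (δ.com i) s v (fwd i v))
    (h : ∀ i c, Q' i c ≤ max (Q i c - δ.out Q s fwd i c) 0 + δ.inn Q s fwd i c + a i c) :
    lyap Q' ≤ lyap Q + ∑ i, (1 / 2) * (net.outBound i ^ 2 + (net.inBound i + ∑ c, a i c) ^ 2) +
      pairing Q a - δ.value Q s := by
  have h1 : ∀ i, ∑ c, δ.out Q s fwd i c ^ 2 ≤ net.outBound i ^ 2 := fun i =>
    (sum_sq_le_sq_sum fun c => δ.out_nonneg Q s fwd i c).trans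
      (pow_le_pow_left₀ (Finset.sum_nonneg fun c _ => δ.out_nonneg Q s fwd i c)
        (δ.sum_out_le Q s fwd i) 2)
  have h2 : ∀ i, ∑ c, (δ.inn Q s fwd i c + a i c) ^ 2 ≤ (net.inBound i + ∑ c, a i c) ^ 2 :=
    fun i => by
      have h0 : ∀ c, 0 ≤ δ.inn Q s fwd i c + a i c := fun c =>
        add_nonneg (δ.inn_nonneg Q s fwd i c) (ha i c)
      refine (sum_sq_le_sq_sum fun c => h0 c).trans
        (pow_le_pow_left₀ (Finset.sum_nonneg fun c _ => h0 c) ?_ 2)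
      rw [Finset.sum_add_distrib]
      exact add_le_add_left (δ.sum_inn_le hf i) _
  have h3 : ∀ i, ∑ c, Q' i c ^ 2 ≤ ∑ c, Q i c ^ 2 + net.outBound i ^ 2 +
      (net.inBound i + ∑ c, a i c) ^ 2 + 2 * ∑ c, Q i c * a i c -
      2 * ∑ c, Q i c * (δ.out Q s fwd i c - δ.inn Q s fwd i c) := fun i => by
    have := Finset.sum_le_sum fun c (_ : c ∈ Finset.univ) => half_sq_le_of_le (hQ i c) (hQ' i c)
      (δ.out_nonneg Q s fwd i c) (δ.inn_nonneg Q s fwd i c) (ha i c) (h i c)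
    simp only [Finset.sum_add_distrib, Finset.sum_sub_distrib, ← Finset.mul_sum] at this
    simp only [mul_sub, Finset.sum_sub_distrib] at this ⊢
    linarith [h1 i, h2 i]
  have h4 := Finset.sum_le_sum fun i (_ : i ∈ Finset.univ) => h3 i
  simp only [Finset.sum_add_distrib, Finset.sum_sub_distrib, ← Finset.mul_sum] at h4
  rw [δ.sum_mul_out_sub_inn hf] at h4
  simp only [lyap, pairing, ← Finset.mul_sum, Finset.sum_add_distrib]
  linarith

variable {net} in
theorem size_step_le (δ : net.Decision) {Q Q' a : RateMatrix n M} {s : 𝒮}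
    {fwd : Node n → Fin n → Option (Node n)} (hQ : ∀ i c, 0 ≤ Q i c)
    (ha : ∀ i c, 0 ≤ a i c)
    (hf : ∀ i v, IsForwarding net Q i (δ.com i) s v (fwd i v))
    (h : ∀ i c, Q' i c ≤ max (Q i c - δ.out Q s fwd i c) 0 + δ.inn Q s fwd i c + a i c)
    (h' : ∀ i c, Q i c - δ.out Q s fwd i c ≤ Q' i c) :
    size (Q' - Q) ≤ ∑ i, (net.outBound i + net.inBound i + ∑ c, a i c) := by
  refine Finset.sum_le_sum fun i _ => ?_
  have h1 : ∀ c, |(Q' - Q) i c| ≤ δ.out Q s fwd i c + δ.inn Q s fwd i c + a i c := fun c => by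
    have h2 := δ.out_nonneg Q s fwd i c
    have h3 := δ.inn_nonneg Q s fwd i c
    have h4 : max (Q i c - δ.out Q s fwd i c) 0 ≤ Q i c := max_le (by linarith) (hQ i c)
    have h5 := h i c
    have h6 := h' i c
    have h7 := ha i c
    rw [Pi.sub_apply, Pi.sub_apply, abs_le]
    constructor <;> linarith
  refine (Finset.sum_le_sum fun c _ => h1 c).trans ?_
  rw [Finset.sum_add_distrib, Finset.sum_add_distrib]
  exact add_le_add_left (add_le_add (δ.sum_out_le Q s fwd i) (δ.sum_inn_le hf i)) _

end Decision

/-! ### Processes that maximise the value minus the cost in every slot -/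

section MaxWeight

variable {n M : ℕ} {𝒮 : Type} [Fintype 𝒮] {net : Network n M 𝒮} {A : ℝ} {lam : RateMatrix n M}
  {Ω : Type*} [mΩ : MeasurableSpace Ω] {μ : Measure Ω}

/-- Decisions that maximise the value minus `V` times the cost in every slot, with backlogs `Q`
that obey the queueing inequalities for the assigned rates. The actual flows do not appear, so that
this covers DWCNC as well as queues that may also be fed when the transmitting queue is empty. -/
structure MaxWeightProcess (env : Environment net A lam μ) (w : net.Cost) (V : ℝ) where
  Q : ℕ → Ω → RateMatrix n M
  dec : ℕ → Ω → net.Decision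
  fwd : ℕ → Ω → Node n → Fin n → Option (Node n)
  Q_adapted : ∀ t, Measurable[env.ℱ t] (Q t)
  kpr_adapted : ∀ t i, Measurable[env.ℱ t] fun ω => (dec t ω).kpr i
  ktr_adapted : ∀ t i, Measurable[env.ℱ t] fun ω => (dec t ω).ktr i
  com_adapted : ∀ t i, Measurable[env.ℱ t] fun ω => (dec t ω).com i
  weight : ∀ t ω, IsWeight (Q t ω)
  pr_max : ∀ t ω i k b,
    net.Rpr i k * procWeight net (Q t ω) i b - V * w.pr i k ≤
      net.Rpr i ((dec t ω).kpr i) * procWeight net (Q t ω) i ((dec t ω).job i) -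
        V * w.pr i ((dec t ω).kpr i)
  tr_max : ∀ t ω i k c,
    txWeight net (Q t ω) (env.S t ω) i k c - V * w.tr i k ≤
      txWeight net (Q t ω) (env.S t ω) i ((dec t ω).ktr i) ((dec t ω).com i) -
        V * w.tr i ((dec t ω).ktr i)
  fwd_spec : ∀ t ω i v,
    IsForwarding net (Q t ω) i ((dec t ω).com i) (env.S (t + 1) ω) v (fwd t ω i v)
  Q_succ_le : ∀ t ω i c, Q (t + 1) ω i c ≤
    max (Q t ω i c - (dec t ω).out (Q t ω) (env.S (t + 1) ω) (fwd t ω) i c) 0 +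
      (dec t ω).inn (Q t ω) (env.S (t + 1) ω) (fwd t ω) i c + env.a t ω i c
  le_Q_succ : ∀ t ω i c,
    Q t ω i c - (dec t ω).out (Q t ω) (env.S (t + 1) ω) (fwd t ω) i c ≤ Q (t + 1) ω i c

/-- The constant of the performance bounds. The second term pays for the memory of the channel. -/
def Network.boundConstant (net : Network n M 𝒮) (A : ℝ) : ℝ :=
  net.driftConstant A + net.correctorLip * ∑ i, (net.outBound i + net.inBound i + A)

/-- The contribution of the arrivals `x` of a slot to the drift that does not depend on the
backlogs. -/
def Network.arrivalStat (net : Network n M 𝒮) (x : RateMatrix n M) : ℝ :=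
  ∑ i, ((1 / 2) * (net.outBound i ^ 2 + (net.inBound i + ∑ c, x i c) ^ 2) +
    net.correctorLip * (net.outBound i + net.inBound i + ∑ c, x i c))

theorem Network.measurable_arrivalStat (net : Network n M 𝒮) : Measurable net.arrivalStat := by
  unfold Network.arrivalStat; fun_prop

namespace Environment

variable (env : Environment net A lam μ) [IsProbabilityMeasure μ]

theorem memLp_arrivalStat : MemLp (fun ω => net.arrivalStat (env.a 0 ω)) 2 μ := by
  have h : (fun ω => net.arrivalStat (env.a 0 ω)) = fun ω => ∑ i,
      (((1 / 2) * (net.outBound i ^ 2 + net.inBound i ^ 2) +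
        net.correctorLip * (net.outBound i + net.inBound i)) +
      ((net.inBound i + net.correctorLip) * (∑ c, env.a 0 ω i c) +
        (1 / 2) * (∑ c, env.a 0 ω i c) ^ 2)) := by
    ext ω
    exact Finset.sum_congr rfl fun i _ => by ring
  rw [h]
  refine memLp_finsetSum _ fun i _ => ?_
  have h1 : MemLp (fun ω => (net.inBound i + net.correctorLip) * (∑ c, env.a 0 ω i c)) 2 μ :=
    (env.memLp_sum i).const_mul _
  have h2 : MemLp (fun ω => (1 / 2) * (∑ c, env.a 0 ω i c) ^ 2) 2 μ :=
    (env.memLp_sum_sq i).const_mul _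
  have h3 : MemLp (fun _ : Ω => (1 / 2) * (net.outBound i ^ 2 + net.inBound i ^ 2) +
    net.correctorLip * (net.outBound i + net.inBound i)) 2 μ := memLp_const _
  exact h3.add (h1.add h2)

theorem integral_arrivalStat_le (hA : 0 ≤ A) :
    ∫ ω, net.arrivalStat (env.a 0 ω) ∂μ ≤ (n + 1) * net.boundConstant A := by
  have h1 : ∀ i, Integrable (fun ω => ∑ c, env.a 0 ω i c) μ := fun i =>
    (env.memLp_sum i).integrable (by norm_num)
  have h2 : ∀ i, Integrable (fun ω => (∑ c, env.a 0 ω i c) ^ 2) μ := fun i =>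
    (env.memLp_sum_sq i).integrable (by norm_num)
  have h : ∫ ω, net.arrivalStat (env.a 0 ω) ∂μ = ∑ i,
      (((1 / 2) * (net.outBound i ^ 2 + net.inBound i ^ 2) +
        net.correctorLip * (net.outBound i + net.inBound i)) +
      ((net.inBound i + net.correctorLip) * (∫ ω, ∑ c, env.a 0 ω i c ∂μ) +
        (1 / 2) * ∫ ω, (∑ c, env.a 0 ω i c) ^ 2 ∂μ)) := by
    have e : (fun ω => net.arrivalStat (env.a 0 ω)) = fun ω => ∑ i,
        (((1 / 2) * (net.outBound i ^ 2 + net.inBound i ^ 2) +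
          net.correctorLip * (net.outBound i + net.inBound i)) +
        ((net.inBound i + net.correctorLip) * (∑ c, env.a 0 ω i c) +
          (1 / 2) * (∑ c, env.a 0 ω i c) ^ 2)) := by
      ext ω
      exact Finset.sum_congr rfl fun i _ => by ring
    have i1 : ∀ i, Integrable (fun ω => (net.inBound i + net.correctorLip) *
        (∑ c, env.a 0 ω i c)) μ := fun i => (h1 i).const_mul _
    have i2 : ∀ i, Integrable (fun ω => (1 / 2) * (∑ c, env.a 0 ω i c) ^ 2) μ := fun i =>
      (h2 i).const_mul _
    have i3 : ∀ i, Integrable (fun ω => (net.inBound i + net.correctorLip) *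
        (∑ c, env.a 0 ω i c) + (1 / 2) * (∑ c, env.a 0 ω i c) ^ 2) μ := fun i =>
      (i1 i).add (i2 i)
    have i4 : ∀ i, Integrable (fun ω => ((1 / 2) * (net.outBound i ^ 2 + net.inBound i ^ 2) +
        net.correctorLip * (net.outBound i + net.inBound i)) +
        ((net.inBound i + net.correctorLip) * (∑ c, env.a 0 ω i c) +
          (1 / 2) * (∑ c, env.a 0 ω i c) ^ 2)) μ := fun i => (integrable_const _).add (i3 i)
    rw [e, integral_finsetSum _ fun i _ => i4 i]
    refine Finset.sum_congr rfl fun i _ => ?_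
    rw [integral_add (integrable_const _) (i3 i), integral_add (i1 i) (i2 i), integral_const_mul,
      integral_const_mul, integral_const, probReal_univ, one_smul]
  have hK := net.correctorLip_nonneg
  have h3 : ∑ i, net.correctorLip * (net.outBound i + net.inBound i + A) ≤
      (n + 1) * (net.correctorLip * ∑ i, (net.outBound i + net.inBound i + A)) := by
    rw [← Finset.mul_sum]
    have h0 : 0 ≤ net.correctorLip * ∑ i, (net.outBound i + net.inBound i + A) :=
      mul_nonneg hK (Finset.sum_nonneg fun i _ =>
        add_nonneg (add_nonneg (net.outBound_nonneg i) (net.inBound_nonneg i)) hA)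
    nlinarith [(Nat.cast_nonneg n : (0 : ℝ) ≤ n)]
  rw [h, Network.boundConstant, mul_add]
  refine le_trans ?_ (add_le_add (net.sum_sq_le_driftConstant A) h3)
  rw [← Finset.sum_add_distrib]
  refine Finset.sum_le_sum fun i _ => ?_
  have h4 := env.integral_sum_le hA i
  have h5 := env.integral_sum_sq_le i
  have h6 := net.inBound_nonneg i
  have h7 := mul_le_mul_of_nonneg_left h4 h6
  have h8 := mul_le_mul_of_nonneg_left h4 hK
  nlinarith

/-- The noise in the drift: arrivals, next state, and the statistic of the arrivals. -/
def driftNoise : (Node n × Commodity n M) ⊕ 𝒮 ⊕ Unit → ℕ → Ω → ℝ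
  | .inl p => fun t ω => env.a t ω p.1 p.2 - lam p.1 p.2
  | .inr (.inl s) => env.stateNoise s
  | .inr (.inr _) => env.arrivalNoise net.arrivalStat

theorem exists_isNoise_driftNoise :
    ∃ v : (Node n × Commodity n M) ⊕ 𝒮 ⊕ Unit → ℝ,
      ∀ k, IsNoise μ env.ℱ (env.driftNoise k) (v k) := by
  refine Classical.skolem.1 ?_
  rintro (p | s | u)
  · exact ⟨_, env.isNoise_entry p.1 p.2⟩
  · exact ⟨_, env.isNoise_state s⟩
  · exact ⟨_, env.isNoise_arrival net.measurable_arrivalStat env.memLp_arrivalStat⟩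

end Environment

namespace MaxWeightProcess

variable {env : Environment net A lam μ} {w : net.Cost} {V : ℝ} (X : MaxWeightProcess env w V)

/-- Cost of a slot. -/
def cost (t : ℕ) (ω : Ω) : ℝ := w.total (X.dec t ω).kpr (X.dec t ω).ktr

/-- The Lyapunov function, corrected for the memory of the channel. -/
def potential (t : ℕ) (ω : Ω) : ℝ :=
  lyap (X.Q t ω) - net.corrector w V (X.Q t ω) (env.S t ω)

/-- Coefficients of the noise in the drift of the potential. -/
def coef : (Node n × Commodity n M) ⊕ 𝒮 ⊕ Unit → ℕ → Ω → ℝ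
  | .inl p => fun t ω => X.Q t ω p.1 p.2
  | .inr (.inl s) => fun t ω =>
      -(∑ i, net.txValue (X.Q t ω) i ((X.dec t ω).ktr i) s ((X.dec t ω).com i) +
        net.corrector w V (X.Q t ω) s)
  | .inr (.inr _) => fun _ _ => 1

theorem cost_nonneg (t : ℕ) (ω : Ω) : 0 ≤ X.cost t ω :=
  Finset.sum_nonneg (s := Finset.univ) fun i _ => add_nonneg (w.pr_nonneg i _) (w.tr_nonneg i _)

/-- The decisions of a max-weight process attain `slotValue`, up to the noise of the next state. -/
theorem value_eq (t : ℕ) (ω : Ω) :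
    (X.dec t ω).value (X.Q t ω) (env.S (t + 1) ω) =
      net.slotValue w V (X.Q t ω) (env.S t ω) + V * X.cost t ω +
      ∑ s, (∑ i, net.txValue (X.Q t ω) i ((X.dec t ω).ktr i) s ((X.dec t ω).com i)) *
        env.stateNoise s t ω := by
  rw [env.sum_mul_stateNoise fun s =>
    ∑ i, net.txValue (X.Q t ω) i ((X.dec t ω).ktr i) s ((X.dec t ω).com i),
    net.slotValue_eq w V (X.Q t ω) (env.S t ω) (X.dec t ω).kpr (X.dec t ω).ktr (X.dec t ω).job
      (X.dec t ω).com (X.pr_max t ω) (X.tr_max t ω), cost, Network.Decision.value]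
  simp_rw [net.txWeight_eq, Finset.mul_sum, Finset.sum_add_distrib]
  rw [Finset.sum_comm (f := fun i s => net.P (env.S t ω) s *
    net.txValue (X.Q t ω) i ((X.dec t ω).ktr i) s ((X.dec t ω).com i))]
  ring

variable [IsProbabilityMeasure μ]

/-- Drift of the potential, path by path: the noise has been split off, and the remaining terms
compare the arrival rates with the mean value of a slot. -/
theorem potential_succ_le (hA : 0 ≤ A) (t : ℕ) (ω : Ω) :
    X.potential (t + 1) ω + V * X.cost t ω ≤ X.potential t ω + (n + 1) * net.boundConstant A +
      pairing (X.Q t ω) lam - net.meanValue w V (X.Q t ω) +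
      ∑ k, X.coef k t ω * env.driftNoise k t ω := by
  have h1 := lyap_step (X.dec t ω) (X.weight t ω).nonneg (X.weight (t + 1) ω).nonneg
    (env.a_nonneg t ω) (X.fwd_spec t ω) (X.Q_succ_le t ω)
  have h2 := size_step_le (Q' := X.Q (t + 1) ω) (X.dec t ω) (X.weight t ω).nonneg
    (env.a_nonneg t ω) (X.fwd_spec t ω) (X.Q_succ_le t ω) (X.le_Q_succ t ω)
  have h3 := (abs_le.1 (net.abs_corrector_sub_le w V (X.Q (t + 1) ω) (X.Q t ω)
    (env.S (t + 1) ω))).1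
  have h4 := mul_le_mul_of_nonneg_left h2 net.correctorLip_nonneg
  have h5 := net.corrector_poisson w V (X.Q t ω) (env.S t ω)
  have h6 := env.sum_mul_stateNoise (fun s => net.corrector w V (X.Q t ω) s) t ω
  have h7 := X.value_eq t ω
  have h8 := env.integral_arrivalStat_le hA
  have h9 : ∑ k, X.coef k t ω * env.driftNoise k t ω =
      (pairing (X.Q t ω) (env.a t ω) - pairing (X.Q t ω) lam) +
      (-(∑ s, (∑ i, net.txValue (X.Q t ω) i ((X.dec t ω).ktr i) s ((X.dec t ω).com i)) *
        env.stateNoise s t ω) - ∑ s, net.corrector w V (X.Q t ω) s * env.stateNoise s t ω) +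
      (net.arrivalStat (env.a t ω) - ∫ ω, net.arrivalStat (env.a 0 ω) ∂μ) := by
    rw [Fintype.sum_sum_type, Fintype.sum_sum_type]
    simp only [coef, Environment.driftNoise, Environment.arrivalNoise, Fintype.sum_prod_type,
      pairing, mul_sub, Finset.sum_sub_distrib, neg_add_rev, add_mul, Finset.sum_add_distrib,
      neg_mul, Finset.sum_neg_distrib, Finset.univ_unique, Finset.sum_singleton, one_mul]
    ring
  have h10 : net.arrivalStat (env.a t ω) =
      ∑ i, (1 / 2) * (net.outBound i ^ 2 + (net.inBound i + ∑ c, env.a t ω i c) ^ 2) +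
      net.correctorLip * ∑ i, (net.outBound i + net.inBound i + ∑ c, env.a t ω i c) := by
    rw [Network.arrivalStat, Finset.sum_add_distrib, Finset.mul_sum]
  unfold potential
  rw [h9, h10]
  linarith

omit [IsProbabilityMeasure μ] in
theorem stronglyMeasurable_Q_comp (t : ℕ) {f : RateMatrix n M → ℝ} (hf : Continuous f) :
    StronglyMeasurable[env.ℱ t] fun ω => f (X.Q t ω) :=
  (hf.measurable.comp (X.Q_adapted t)).stronglyMeasurable

omit [IsProbabilityMeasure μ] in
theorem stronglyMeasurable_coef (k) (t : ℕ) : StronglyMeasurable[env.ℱ t] (X.coef k t) := by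
  rcases k with p | s | u
  · exact X.stronglyMeasurable_Q_comp t (f := fun q => q p.1 p.2) (by fun_prop)
  · refine (StronglyMeasurable.add (Finset.stronglyMeasurable_fun_sum _ fun i _ => ?_)
      (X.stronglyMeasurable_Q_comp t (net.continuous_corrector w V s))).neg
    have h : Measurable fun p : RateMatrix n M × (Fin (net.Ktr i + 1) × Commodity n M) =>
        net.txValue p.1 i p.2.1 s p.2.2 :=
      measurable_from_prod_countable_left fun y => (net.continuous_txValue i y.1 s y.2).measurable
    exact (h.comp ((X.Q_adapted t).prodMk
      ((X.ktr_adapted t i).prodMk (X.com_adapted t i)))).stronglyMeasurable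
  · exact stronglyMeasurable_const

omit [IsProbabilityMeasure μ] in
theorem stronglyMeasurable_potential (t : ℕ) : StronglyMeasurable[env.ℱ t] (X.potential t) := by
  refine StronglyMeasurable.sub ?_ ?_
  · exact X.stronglyMeasurable_Q_comp t (f := fun q : RateMatrix n M => (1 / 2) * ∑ i, ∑ c, q i c ^ 2)
      (by fun_prop)
  · exact env.stronglyMeasurable_state le_rfl
      (h := fun s ω => net.corrector w V (X.Q t ω) s)
      fun s => X.stronglyMeasurable_Q_comp t (net.continuous_corrector w V s)

omit [IsProbabilityMeasure μ] in
theorem stronglyMeasurable_cost (t : ℕ) : StronglyMeasurable[env.ℱ t] (X.cost t) := by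
  have h0 : X.cost t = fun ω => ∑ i, (w.pr i ((X.dec t ω).kpr i) + w.tr i ((X.dec t ω).ktr i)) :=
    rfl
  rw [h0]
  refine Finset.stronglyMeasurable_fun_sum _ fun i _ => ?_
  have h1 : StronglyMeasurable[env.ℱ t] fun ω => w.pr i ((X.dec t ω).kpr i) :=
    ((Measurable.of_discrete (f := w.pr i)).comp (X.kpr_adapted t i)).stronglyMeasurable
  have h2 : StronglyMeasurable[env.ℱ t] fun ω => w.tr i ((X.dec t ω).ktr i) :=
    ((Measurable.of_discrete (f := w.tr i)).comp (X.ktr_adapted t i)).stronglyMeasurable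
  exact h1.add h2

omit [IsProbabilityMeasure μ] in
theorem exists_abs_coef_le : ∃ C, 0 < C ∧ ∀ k t ω, |X.coef k t ω| ≤ C * (1 + size (X.Q t ω)) := by
  obtain ⟨K, hK0, hK⟩ := net.exists_abs_corrector_le w V
  have hO : 0 ≤ ∑ i, net.maxOut i * 2 :=
    Finset.sum_nonneg fun i _ => mul_nonneg (net.maxOut_nonneg i) zero_le_two
  refine ⟨1 + K + ∑ i, net.maxOut i * 2, by positivity, fun k t ω => ?_⟩
  have hs := size_nonneg (X.Q t ω)
  rcases k with p | s | u
  · have := abs_le_size (X.Q t ω) p.1 p.2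
    simp only [coef]
    nlinarith [mul_nonneg hO hs]
  · simp only [coef, abs_neg]
    refine (abs_add_le _ _).trans ?_
    have h1 : |∑ i, net.txValue (X.Q t ω) i ((X.dec t ω).ktr i) s ((X.dec t ω).com i)| ≤
        (∑ i, net.maxOut i * 2) * size (X.Q t ω) := by
      rw [abs_of_nonneg (Finset.sum_nonneg fun i _ => net.txValue_nonneg _ _ _ _ _),
        Finset.sum_mul]
      exact Finset.sum_le_sum fun i _ => net.txValue_le _ _ _ _ _
    have h2 := hK (X.Q t ω) s
    nlinarith
  · simp only [coef, abs_one]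
    nlinarith [mul_nonneg hO hs, mul_nonneg hK0.le hs]

/-- Backlogs grow at most linearly. -/
theorem ae_size_le : ∀ᵐ ω ∂μ, ∃ C, 0 < C ∧ ∀ t : ℕ, size (X.Q t ω) ≤ C * (t + 1) := by
  filter_upwards [env.tendsto_avg_pairing (fun _ _ => 1)] with ω hω
  obtain ⟨R, hR⟩ := hω.bddAbove_range
  have hR' : ∀ t : ℕ, ∑ τ ∈ Finset.range t, pairing (fun _ _ => 1) (env.a τ ω) ≤ |R| * t := by
    intro t
    rcases Nat.eq_zero_or_pos t with rfl | ht
    · simp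
    · have h1 : (∑ τ ∈ Finset.range t, pairing (fun _ _ => 1) (env.a τ ω)) / (t : ℝ) ≤ R :=
        hR ⟨t, rfl⟩
      rw [div_le_iff₀ (by positivity)] at h1
      exact h1.trans (mul_le_mul_of_nonneg_right (le_abs_self R) (Nat.cast_nonneg t))
  set D : ℝ := ∑ i, (net.outBound i + net.inBound i) with hD
  have hD0 : 0 ≤ D := Finset.sum_nonneg fun i _ =>
    add_nonneg (net.outBound_nonneg i) (net.inBound_nonneg i)
  have hstep : ∀ t, size (X.Q t ω) ≤ size (X.Q 0 ω) + t * D +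
      ∑ τ ∈ Finset.range t, pairing (fun _ _ => 1) (env.a τ ω) := by
    intro t
    induction t with
    | zero => simp
    | succ t ih =>
      have h1 := size_step_le (Q' := X.Q (t + 1) ω) (X.dec t ω) (X.weight t ω).nonneg
        (env.a_nonneg t ω) (X.fwd_spec t ω) (X.Q_succ_le t ω) (X.le_Q_succ t ω)
      have h2 : size (X.Q (t + 1) ω) ≤ size (X.Q t ω) + size (X.Q (t + 1) ω - X.Q t ω) := by
        simp only [size, ← Finset.sum_add_distrib, Pi.sub_apply]
        refine Finset.sum_le_sum fun i _ => Finset.sum_le_sum fun c _ => ?_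
        have := abs_sub_abs_le_abs_sub (X.Q (t + 1) ω i c) (X.Q t ω i c)
        linarith
      have h3 : ∑ i, (net.outBound i + net.inBound i + ∑ c, env.a t ω i c) =
          D + pairing (fun _ _ => 1) (env.a t ω) := by
        simp [pairing, hD, Finset.sum_add_distrib]
      rw [Finset.sum_range_succ]
      push_cast
      linarith
  refine ⟨size (X.Q 0 ω) + D + |R| + 1, by have := size_nonneg (X.Q 0 ω); positivity, fun t => ?_⟩
  have h1 := hstep t
  have h2 := hR' t
  have h3 := size_nonneg (X.Q 0 ω)
  have h4 : (0 : ℝ) ≤ t := Nat.cast_nonneg t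
  nlinarith [mul_nonneg h3 h4, abs_nonneg R]

omit [IsProbabilityMeasure μ] in
/-- The potential is a quadratic function of the backlogs, up to a constant. -/
theorem exists_potential_bounds : ∃ C, 0 < C ∧ ∀ t ω,
    size (X.Q t ω) ^ 2 ≤ C * (X.potential t ω + C) ∧
    X.potential t ω + C ≤ 4 * C * (1 + size (X.Q t ω) ^ 2) := by
  obtain ⟨K, hK0, hK⟩ := net.exists_abs_corrector_le w V
  set m : ℝ := (Fintype.card (Node n × Commodity n M) : ℝ) with hm
  have hm1 : 1 ≤ m := by
    rw [hm]; exact_mod_cast Fintype.card_pos_iff.2 ⟨(0, 0, 0)⟩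
  refine ⟨4 * m + K + K ^ 2 * m, by positivity, fun t ω => ?_⟩
  set x := size (X.Q t ω) with hx
  have hx0 : 0 ≤ x := size_nonneg _
  have h1 := abs_le.1 (hK (X.Q t ω) (env.S t ω))
  have h2 := size_sq_le (X.Q t ω)
  have h3 := lyap_le (X.Q t ω)
  rw [← hx, ← hm] at h2
  rw [← hx] at h3 h1
  have hK2 : 0 ≤ K ^ 2 * m := by positivity
  unfold potential
  set l := lyap (X.Q t ω)
  set ψ := net.corrector w V (X.Q t ω) (env.S t ω)
  have h4 : x ^ 2 ≤ 4 * m * (l - K * x + K ^ 2 * m) := by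
    nlinarith [sq_nonneg (x - 2 * K * m)]
  constructor
  · have h6 : l - K * x + K ^ 2 * m ≤ l - ψ + (4 * m + K + K ^ 2 * m) := by linarith [h1.2]
    have h7 : 0 ≤ l - K * x + K ^ 2 * m :=
      nonneg_of_mul_nonneg_right ((sq_nonneg x).trans h4) (by positivity)
    calc x ^ 2 ≤ 4 * m * (l - K * x + K ^ 2 * m) := h4
      _ ≤ (4 * m + K + K ^ 2 * m) * (l - ψ + (4 * m + K + K ^ 2 * m)) :=
        mul_le_mul (by linarith) h6 h7 (by positivity)
  · have h5 : K * x ≤ K * (1 + x ^ 2) :=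
      mul_le_mul_of_nonneg_left (by nlinarith [sq_nonneg (x - 1)]) hK0.le
    have h6 : x ^ 2 ≤ m * x ^ 2 := le_mul_of_one_le_left (sq_nonneg x) hm1
    have h7 : 0 ≤ K * x ^ 2 := by positivity
    have h8 : 0 ≤ K ^ 2 * m * x ^ 2 := by positivity
    linarith [h1.1, sq_nonneg x]

end MaxWeightProcess

end MaxWeight

/-! ### Performance of such processes -/

section CostBounds

variable {n M : ℕ} {𝒮 : Type} [Fintype 𝒮] {net : Network n M 𝒮}

/-- A bound for the cost of a slot. -/
def Network.Cost.bound (w : net.Cost) : ℝ := ∑ i, (∑ k, w.pr i k + ∑ k, w.tr i k)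

theorem Network.Cost.total_le_bound (w : net.Cost) (kpr : ∀ i, Fin (net.Kpr i + 1))
    (ktr : ∀ i, Fin (net.Ktr i + 1)) : w.total kpr ktr ≤ w.bound :=
  Finset.sum_le_sum fun i _ => add_le_add
    (Finset.single_le_sum (fun k _ => w.pr_nonneg i k) (Finset.mem_univ (kpr i)))
    (Finset.single_le_sum (fun k _ => w.tr_nonneg i k) (Finset.mem_univ (ktr i)))

theorem Network.Cost.total_nonneg (w : net.Cost) (kpr : ∀ i, Fin (net.Kpr i + 1))
    (ktr : ∀ i, Fin (net.Ktr i + 1)) : 0 ≤ w.total kpr ktr :=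
  Finset.sum_nonneg fun i _ => add_nonneg (w.pr_nonneg i (kpr i)) (w.tr_nonneg i (ktr i))

theorem Network.Cost.bound_nonneg (w : net.Cost) : 0 ≤ w.bound :=
  (w.total_nonneg (fun _ => 0) fun _ => 0).trans (w.total_le_bound _ _)

end CostBounds

section Performance

variable {n M : ℕ} {𝒮 : Type} [Fintype 𝒮] {net : Network n M 𝒮} {A : ℝ} {lam : RateMatrix n M}
  {Ω : Type*} [mΩ : MeasurableSpace Ω] {μ : Measure Ω} [IsProbabilityMeasure μ]

namespace MaxWeightProcess

variable {env : Environment net A lam μ} {w : net.Cost} {V : ℝ} (X : MaxWeightProcess env w V)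

/-- The noise accumulated in the potential. -/
def noiseSum (t : ℕ) (ω : Ω) : ℝ :=
  ∑ τ ∈ Finset.range t, ∑ k, X.coef k τ ω * env.driftNoise k τ ω

omit [IsProbabilityMeasure μ] in
theorem noiseSum_eq (t : ℕ) (ω : Ω) : X.noiseSum t ω =
    ∑ k, ∑ τ ∈ Finset.range t, X.coef k τ ω * env.driftNoise k τ ω := Finset.sum_comm

/-- Telescoped drift. -/
theorem potential_le (hA : 0 ≤ A) {δ H : ℝ}
    (hq : ∀ q : RateMatrix n M, IsWeight q →
      pairing q lam + δ * size q ≤ net.meanValue w V q + H) (t : ℕ) (ω : Ω) :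
    X.potential t ω + (δ * ∑ τ ∈ Finset.range t, size (X.Q τ ω) +
      V * ∑ τ ∈ Finset.range t, X.cost τ ω) ≤
      X.potential 0 ω + t * ((n + 1) * net.boundConstant A + H) + X.noiseSum t ω := by
  induction t with
  | zero => simp [noiseSum]
  | succ t ih =>
    have h1 := X.potential_succ_le hA t ω
    have h2 := hq (X.Q t ω) (X.weight t ω)
    simp only [noiseSum] at ih ⊢
    rw [Finset.sum_range_succ, Finset.sum_range_succ, Finset.sum_range_succ]
    push_cast
    linarith

/-- Rate stability does not need any slack: the potential grows more slowly than `t ^ 2`. -/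
theorem rateStable (hA : 0 ≤ A) (hV : 0 ≤ V) {H : ℝ}
    (hq : ∀ q : RateMatrix n M, IsWeight q → pairing q lam ≤ net.meanValue w V q + H) :
    ∀ᵐ ω ∂μ, ∀ i c, Tendsto (fun t : ℕ => X.Q t ω i c / t) atTop (𝓝 0) := by
  obtain ⟨v, hv⟩ := env.exists_isNoise_driftNoise
  obtain ⟨C, hC0, hC⟩ := X.exists_abs_coef_le
  obtain ⟨K, hK0, hK⟩ := net.exists_abs_corrector_le w V
  have hnoise : ∀ᵐ ω ∂μ, ∀ k, Tendsto (fun t : ℕ => (∑ τ ∈ Finset.range t,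
      X.coef k τ ω * env.driftNoise k τ ω) / ((t : ℝ) + 1) ^ 2) atTop (𝓝 0) := by
    refine ae_all_iff.2 fun k => (hv k).tendsto_sum_div (X.stronglyMeasurable_coef k)
      (monotone_add_one_pow 2) (fun t => by positivity) (tendsto_add_one_pow two_ne_zero) ?_
    filter_upwards [X.ae_size_le] with ω ⟨D, hD0, hD⟩
    refine (summable_one_div_add_one_sq.mul_left ((C * (1 + D)) ^ 2)).of_nonneg_of_le
      (fun t => sq_nonneg _) fun t => ?_
    have h1 : |X.coef k t ω| ≤ C * (1 + D) * ((t : ℝ) + 1) := by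
      refine (hC k t ω).trans ?_
      rw [mul_assoc]
      refine mul_le_mul_of_nonneg_left ?_ hC0.le
      have := hD t
      nlinarith [(Nat.cast_nonneg t : (0 : ℝ) ≤ t)]
    rw [div_pow, ← sq_abs, mul_one_div, div_le_div_iff₀ (by positivity) (by positivity)]
    have h2 := pow_le_pow_left₀ (abs_nonneg _) h1 2
    rw [mul_pow] at h2
    have h3 := mul_le_mul_of_nonneg_right h2 (sq_nonneg ((t : ℝ) + 1))
    linarith
  filter_upwards [hnoise, X.ae_size_le] with ω hω ⟨D, hD0, hD⟩ i c
  set R : ℝ := |X.potential 0 ω| + |(n + 1) * net.boundConstant A + H| + K * (1 + D) with hR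
  have hbound : ∀ t : ℕ, (X.Q t ω i c / ((t : ℝ) + 1)) ^ 2 ≤
      2 * (R / ((t : ℝ) + 1) + X.noiseSum t ω / ((t : ℝ) + 1) ^ 2) := by
    intro t
    have h1 := X.potential_le hA (δ := 0) (by simpa using hq) t ω
    have h2 : 0 ≤ V * ∑ τ ∈ Finset.range t, X.cost τ ω :=
      mul_nonneg hV (Finset.sum_nonneg fun τ _ => X.cost_nonneg τ ω)
    have h3 := (abs_le.1 (hK (X.Q t ω) (env.S t ω))).2
    have h4 := sq_le_lyap (X.Q t ω) i c
    have h5 : lyap (X.Q t ω) = X.potential t ω + net.corrector w V (X.Q t ω) (env.S t ω) := by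
      unfold potential; ring
    have h6 : K * (1 + size (X.Q t ω)) ≤ K * (1 + D) * ((t : ℝ) + 1) := by
      rw [mul_assoc]
      refine mul_le_mul_of_nonneg_left ?_ hK0.le
      have := hD t
      nlinarith [(Nat.cast_nonneg t : (0 : ℝ) ≤ t)]
    have h7 : (t : ℝ) * ((n + 1) * net.boundConstant A + H) ≤
        ((t : ℝ) + 1) * |(n + 1) * net.boundConstant A + H| := by
      have := le_abs_self ((n + 1) * net.boundConstant A + H)
      have := abs_nonneg ((n + 1) * net.boundConstant A + H)
      nlinarith [(Nat.cast_nonneg t : (0 : ℝ) ≤ t)]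
    have h8 : X.potential 0 ω ≤ ((t : ℝ) + 1) * |X.potential 0 ω| := by
      have := le_abs_self (X.potential 0 ω)
      have := abs_nonneg (X.potential 0 ω)
      nlinarith [(Nat.cast_nonneg t : (0 : ℝ) ≤ t)]
    have h9 : X.Q t ω i c ^ 2 ≤ 2 * (((t : ℝ) + 1) * R + X.noiseSum t ω) := by
      rw [hR]; linarith
    rw [div_pow, div_le_iff₀ (by positivity)]
    refine h9.trans (le_of_eq ?_)
    field_simp
  have hlim : Tendsto (fun t : ℕ => 2 * (R / ((t : ℝ) + 1) +
      X.noiseSum t ω / ((t : ℝ) + 1) ^ 2)) atTop (𝓝 0) := by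
    have h1 : Tendsto (fun t : ℕ => R / ((t : ℝ) + 1)) atTop (𝓝 0) :=
      Tendsto.const_div_atTop (by simpa using tendsto_add_one_pow one_ne_zero) R
    have h2 : Tendsto (fun t : ℕ => X.noiseSum t ω / ((t : ℝ) + 1) ^ 2) atTop (𝓝 0) := by
      have := tendsto_finsetSum Finset.univ fun k _ => hω k
      simp only [Finset.sum_const_zero] at this
      refine this.congr fun t => ?_
      rw [noiseSum_eq, Finset.sum_div]
    simpa using (h1.add h2).const_mul 2
  have hsq : Tendsto (fun t : ℕ => (X.Q t ω i c / ((t : ℝ) + 1)) ^ 2) atTop (𝓝 0) :=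
    squeeze_zero (fun t => sq_nonneg _) hbound hlim
  refine tendsto_div_of_tendsto_div_succ ?_
  have := hsq.sqrt
  rw [Real.sqrt_zero] at this
  refine this.congr fun t => ?_
  rw [Real.sqrt_sq (div_nonneg ((X.weight t ω).nonneg i c) (by positivity))]

/-- With slack, the noise averages out, since `∑ size (Q t) ^ 2 / (t + 1) ^ 2 < ∞`. -/
theorem ae_tendsto_noiseSum_div (hA : 0 ≤ A) (hV : 0 ≤ V) {ε H : ℝ} (hε : 0 < ε)
    (hq : ∀ q : RateMatrix n M, IsWeight q →
      pairing q lam + ε * size q ≤ net.meanValue w V q + H) :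
    ∀ᵐ ω ∂μ, Tendsto (fun t : ℕ => X.noiseSum t ω / (t : ℝ)) atTop (𝓝 0) := by
  obtain ⟨v, hv⟩ := env.exists_isNoise_driftNoise
  obtain ⟨C, hC0, hC⟩ := X.exists_abs_coef_le
  obtain ⟨K, hK0, hK⟩ := X.exists_potential_bounds
  set R : ℝ := |(n + 1) * net.boundConstant A + H| with hR
  have hsum : ∀ᵐ ω ∂μ, Summable fun t : ℕ => (size (X.Q t ω) / ((t : ℝ) + 1)) ^ 2 := by
    refine ae_summable_sq_of_drift hv (X := fun t ω => size (X.Q t ω))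
      (U := fun t ω => X.potential t ω + K) (β := X.coef) (C := C + 4 * K + R) (ε := ε)
      (fun t => X.stronglyMeasurable_Q_comp t continuous_size)
      (fun t => (X.stronglyMeasurable_potential t).add stronglyMeasurable_const)
      X.stronglyMeasurable_coef (by positivity) hε (fun t ω => size_nonneg _)
      (fun k t ω => ?_) (fun t ω => ?_) (fun t ω => ?_) fun t ω => ?_
    · refine (hC k t ω).trans (mul_le_mul_of_nonneg_right ?_
        (add_nonneg zero_le_one (size_nonneg _)))
      have := abs_nonneg ((n + 1) * net.boundConstant A + H)
      linarith
    · have h1 := (hK t ω).1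
      have h2 : 0 ≤ X.potential t ω + K :=
        nonneg_of_mul_nonneg_right ((sq_nonneg _).trans h1) hK0
      refine h1.trans (mul_le_mul_of_nonneg_right ?_ h2)
      have := abs_nonneg ((n + 1) * net.boundConstant A + H)
      linarith
    · refine (hK t ω).2.trans (mul_le_mul_of_nonneg_right ?_ (by positivity))
      have := abs_nonneg ((n + 1) * net.boundConstant A + H)
      linarith
    · have h1 := X.potential_succ_le hA t ω
      have h2 := hq (X.Q t ω) (X.weight t ω)
      have h3 := mul_nonneg hV (X.cost_nonneg t ω)
      have h4 := le_abs_self ((n + 1) * net.boundConstant A + H)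
      linarith
  have hnoise : ∀ᵐ ω ∂μ, ∀ k, Tendsto (fun t : ℕ => (∑ τ ∈ Finset.range t,
      X.coef k τ ω * env.driftNoise k τ ω) / (t : ℝ)) atTop (𝓝 0) := by
    refine ae_all_iff.2 fun k => (hv k).tendsto_avg (X.stronglyMeasurable_coef k) ?_
    filter_upwards [hsum] with ω hω
    refine ((summable_one_div_add_one_sq.add hω).mul_left (2 * C ^ 2)).of_nonneg_of_le
      (fun t => sq_nonneg _) fun t => ?_
    have h1 := pow_le_pow_left₀ (abs_nonneg _) (hC k t ω) 2
    rw [sq_abs] at h1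
    rw [div_pow, div_pow, ← add_div, ← mul_div_assoc]
    refine div_le_div_of_nonneg_right (h1.trans ?_) (by positivity)
    rw [mul_pow, mul_comm 2 (C ^ 2), mul_assoc]
    exact mul_le_mul_of_nonneg_left (by nlinarith [sq_nonneg (1 - size (X.Q t ω))]) (sq_nonneg C)
  filter_upwards [hnoise] with ω hω
  have := tendsto_finsetSum Finset.univ fun k _ => hω k
  simp only [Finset.sum_const_zero] at this
  refine this.congr fun t => ?_
  rw [noiseSum_eq, Finset.sum_div]

/-- The time averages of backlogs and costs obey the drift bound, up to a vanishing error `r` that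
does not depend on the comparison. -/
theorem exists_average_le (hA : 0 ≤ A) (hV : 0 ≤ V) {ε H₀ : ℝ} (hε : 0 < ε)
    (hq₀ : ∀ q : RateMatrix n M, IsWeight q →
      pairing q lam + ε * size q ≤ net.meanValue w V q + H₀) :
    ∀ᵐ ω ∂μ, ∃ r : ℕ → ℝ, Tendsto r atTop (𝓝 0) ∧ ∀ δ H : ℝ,
      (∀ q : RateMatrix n M, IsWeight q →
        pairing q lam + δ * size q ≤ net.meanValue w V q + H) → ∀ t : ℕ, 0 < t →
      δ * ((∑ τ ∈ Finset.range t, size (X.Q τ ω)) / t) +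
        V * ((∑ τ ∈ Finset.range t, X.cost τ ω) / t) ≤ (n + 1) * net.boundConstant A + H + r t := by
  obtain ⟨K, hK0, hK⟩ := X.exists_potential_bounds
  filter_upwards [X.ae_tendsto_noiseSum_div hA hV hε hq₀] with ω hω
  refine ⟨fun t => (X.potential 0 ω + K) / t + X.noiseSum t ω / t, ?_, fun δ H hq t ht => ?_⟩
  · simpa using (tendsto_const_div_atTop_nhds_zero_nat (X.potential 0 ω + K)).add hω
  · have h1 := X.potential_le hA hq t ω
    have h2 : 0 ≤ X.potential t ω + K :=
      nonneg_of_mul_nonneg_right ((sq_nonneg _).trans (hK t ω).1) hK0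
    have ht' : (0 : ℝ) < t := by exact_mod_cast ht
    have h3 : δ * ((∑ τ ∈ Finset.range t, size (X.Q τ ω)) / t) +
        V * ((∑ τ ∈ Finset.range t, X.cost τ ω) / t) =
        (δ * ∑ τ ∈ Finset.range t, size (X.Q τ ω) + V * ∑ τ ∈ Finset.range t, X.cost τ ω) / t := by
      ring
    have h4 : (n + 1) * net.boundConstant A + H + ((X.potential 0 ω + K) / t + X.noiseSum t ω / t)
        = (t * ((n + 1) * net.boundConstant A + H) + (X.potential 0 ω + K) +
          X.noiseSum t ω) / t := by
      field_simp
      ring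
    rw [h3, h4]
    exact div_le_div_of_nonneg_right (by linarith) ht'.le

/-- Expected costs when the backlogs are bounded in every slot. -/
theorem expected_cost_le (hA : 0 ≤ A) {H : ℝ}
    (hb : ∀ t, ∃ C, ∀ ω, size (X.Q t ω) ≤ C)
    (hq : ∀ q : RateMatrix n M, IsWeight q → pairing q lam ≤ net.meanValue w V q + H) :
    ∃ C, ∀ t : ℕ, V * ∑ τ ∈ Finset.range t, ∫ ω, X.cost τ ω ∂μ ≤
      t * ((n + 1) * net.boundConstant A + H) + C := by
  obtain ⟨v, hv⟩ := env.exists_isNoise_driftNoise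
  obtain ⟨C, hC0, hC⟩ := X.exists_abs_coef_le
  obtain ⟨K, hK0, hK⟩ := X.exists_potential_bounds
  have hp0 : ∀ t ω, 0 ≤ X.potential t ω + K := fun t ω =>
    nonneg_of_mul_nonneg_right ((sq_nonneg _).trans (hK t ω).1) hK0
  have hU : ∀ t, Integrable (X.potential t) μ := fun t => by
    obtain ⟨D, hD⟩ := hb t
    refine Integrable.of_bound ((X.stronglyMeasurable_potential t).mono
      (env.ℱ.le t)).aestronglyMeasurable (K + 4 * K * (1 + D ^ 2))
      (Eventually.of_forall fun ω => ?_)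
    have h1 := hp0 t ω
    have h2 := (hK t ω).2
    have h3 := mul_le_mul_of_nonneg_left (pow_le_pow_left₀ (size_nonneg _) (hD ω) 2)
      (show 0 ≤ 4 * K by positivity)
    have h4 : 0 ≤ 4 * K * (1 + D ^ 2) := by positivity
    rw [Real.norm_eq_abs, abs_le]
    constructor <;> linarith
  have hcost : ∀ t, Integrable (X.cost t) μ := fun t => by
    refine Integrable.of_bound ((X.stronglyMeasurable_cost t).mono
      (env.ℱ.le t)).aestronglyMeasurable w.bound
      (Eventually.of_forall fun ω => ?_)
    rw [Real.norm_of_nonneg (X.cost_nonneg t ω)]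
    exact w.total_le_bound _ _
  have hbd : ∀ k t, ∃ D, ∀ ω, |X.coef k t ω| ≤ D := fun k t => by
    obtain ⟨D, hD⟩ := hb t
    exact ⟨C * (1 + D), fun ω => (hC k t ω).trans
      (mul_le_mul_of_nonneg_left (by linarith [hD ω]) hC0.le)⟩
  have hni : ∀ k t, Integrable (fun ω => X.coef k t ω * env.driftNoise k t ω) μ := fun k t => by
    obtain ⟨D, hD⟩ := hbd k t
    exact (hv k).integrable_mul (X.stronglyMeasurable_coef k t) hD
  have hN : ∀ t, ∫ ω, X.noiseSum t ω ∂μ = 0 := fun t => by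
    simp only [noiseSum]
    rw [integral_finsetSum _ fun τ _ => integrable_finsetSum _ fun k _ => hni k τ]
    refine Finset.sum_eq_zero fun τ _ => ?_
    rw [integral_finsetSum _ fun k _ => hni k τ]
    exact Finset.sum_eq_zero fun k _ =>
      (hv k).integral_mul_eq_zero (X.stronglyMeasurable_coef k τ) (hni k τ)
  have hNi : ∀ t, Integrable (X.noiseSum t) μ := fun t =>
    integrable_finsetSum _ fun τ _ => integrable_finsetSum _ fun k _ => hni k τ
  refine ⟨∫ ω, X.potential 0 ω ∂μ + K, fun t => ?_⟩
  have h1 : ∀ ω, V * ∑ τ ∈ Finset.range t, X.cost τ ω ≤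
      X.potential 0 ω + (K + t * ((n + 1) * net.boundConstant A + H)) + X.noiseSum t ω := fun ω => by
    have := X.potential_le hA (δ := 0) (by simpa using hq) t ω
    linarith [hp0 t ω]
  have h2 := integral_mono ((integrable_finsetSum (Finset.range t) fun τ _ => hcost τ).const_mul V)
    (((hU 0).add (integrable_const (K + t * ((n + 1) * net.boundConstant A + H)))).add (hNi t)) h1
  rw [integral_const_mul, integral_finsetSum _ fun τ _ => hcost τ,
    integral_add' ((hU 0).add (integrable_const _)) (hNi t),
    integral_add' (hU 0) (integrable_const _), hN, integral_const, probReal_univ, one_smul] at h2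
  linarith

end MaxWeightProcess

end Performance

/-! ### Converse: the rates that a control can carry -/

section Converse

variable {n M : ℕ} {𝒮 : Type} [Fintype 𝒮] {net : Network n M 𝒮} {A : ℝ} {lam : RateMatrix n M}
  {Ω : Type*} [mΩ : MeasurableSpace Ω] {μ : Measure Ω}

/-- If at prices `q` the arrivals exceed what the resources of every slot can be worth by no more
than a sublinear residual, then the price of the arrival rates is at most the mean value of a
slot plus `V` times the average cost. -/
theorem Environment.ae_pairing_le [IsProbabilityMeasure μ] (env : Environment net A lam μ)
    (w : net.Cost) (V : ℝ)
    {kpr : ℕ → Ω → ∀ i, Fin (net.Kpr i + 1)} {ktr : ℕ → Ω → ∀ i, Fin (net.Ktr i + 1)}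
    {share : ℕ → Ω → Node n → Commodity n M → ℝ}
    (hktr : ∀ t i, Measurable[env.ℱ t] fun ω => ktr t ω i)
    (hshare : ∀ t i c, Measurable[env.ℱ t] fun ω => share t ω i c)
    (h0 : ∀ t ω i c, 0 ≤ share t ω i c) (h1 : ∀ t ω i, ∑ c, share t ω i c ≤ 1)
    (q : RateMatrix n M) {R : ℕ → Ω → ℝ}
    (hR : ∀ᵐ ω ∂μ, Tendsto (fun t : ℕ => R t ω / t) atTop (𝓝 0))
    (hle : ∀ ω (t : ℕ), ∑ τ ∈ Finset.range t, pairing q (env.a τ ω) ≤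
      ∑ τ ∈ Finset.range t, ∑ i, (∑ c, share τ ω i c *
        net.txValue q i (ktr τ ω i) (env.S (τ + 1) ω) c +
        net.Rpr i (kpr τ ω i) * ⨆ b, procWeight net q i b) + R t ω) :
    ∀ᵐ ω ∂μ, ∃ r : ℕ → ℝ, Tendsto r atTop (𝓝 0) ∧ ∀ t : ℕ, 0 < t →
      pairing q lam ≤ net.meanValue w V q +
        V * ((∑ τ ∈ Finset.range t, w.total (kpr τ ω) (ktr τ ω)) / t) + r t := by
  set β : 𝒮 → ℕ → Ω → ℝ := fun s t ω =>
    ∑ i, ∑ c, share t ω i c * net.txValue q i (ktr t ω i) s c with hβ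
  have hβm : ∀ s t, StronglyMeasurable[env.ℱ t] (β s t) := fun s t => by
    refine Finset.stronglyMeasurable_fun_sum _ fun i _ =>
      Finset.stronglyMeasurable_fun_sum _ fun c _ => ?_
    exact (hshare t i c).stronglyMeasurable.mul
      ((Measurable.of_discrete (f := fun k => net.txValue q i k s c)).comp
        (hktr t i)).stronglyMeasurable
  have hβb : ∀ s t ω, |β s t ω| ≤ ∑ i, net.maxOut i * 2 * size q := fun s t ω => by
    rw [abs_of_nonneg (Finset.sum_nonneg fun i _ => Finset.sum_nonneg fun c _ =>
      mul_nonneg (h0 t ω i c) (net.txValue_nonneg _ _ _ _ _))]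
    refine Finset.sum_le_sum fun i _ => ?_
    calc ∑ c, share t ω i c * net.txValue q i (ktr t ω i) s c
        ≤ ∑ c, share t ω i c * (net.maxOut i * 2 * size q) := Finset.sum_le_sum fun c _ =>
          mul_le_mul_of_nonneg_left (net.txValue_le _ _ _ _ _) (h0 t ω i c)
      _ = (∑ c, share t ω i c) * (net.maxOut i * 2 * size q) := by rw [Finset.sum_mul]
      _ ≤ _ := mul_le_of_le_one_left (mul_nonneg (mul_nonneg (net.maxOut_nonneg i) zero_le_two)
          (size_nonneg q)) (h1 t ω i)
  have hnoise : ∀ᵐ ω ∂μ, ∀ s, Tendsto (fun t : ℕ => (∑ τ ∈ Finset.range t,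
      β s τ ω * env.stateNoise s τ ω) / (t : ℝ)) atTop (𝓝 0) :=
    ae_all_iff.2 fun s => (env.isNoise_state s).tendsto_avg_of_bounded (hβm s) (hβb s)
  filter_upwards [hnoise, hR, env.tendsto_avg_pairing q,
    env.tendsto_avg_state fun s => net.slotValue w V q s] with ω hω1 hω2 hω3 hω4
  refine ⟨fun t => (pairing q lam - (∑ τ ∈ Finset.range t, pairing q (env.a τ ω)) / (t : ℝ)) +
    ((∑ τ ∈ Finset.range t, net.slotValue w V q (env.S τ ω)) / (t : ℝ) - net.meanValue w V q) +
    ∑ s, (∑ τ ∈ Finset.range t, β s τ ω * env.stateNoise s τ ω) / (t : ℝ) + R t ω / t, ?_, ?_⟩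
  · have e1 := hω3.const_sub (pairing q lam)
    have e2 := hω4.sub_const (net.meanValue w V q)
    have e3 := tendsto_finsetSum (Finset.univ : Finset 𝒮) fun s _ => hω1 s
    rw [sub_self] at e1
    have e4 : ∑ s, net.stationary s * net.slotValue w V q s - net.meanValue w V q = 0 := sub_self _
    rw [e4] at e2
    rw [Finset.sum_const_zero] at e3
    simpa using ((e1.add e2).add e3).add hω2
  · intro t ht
    have ht' : (0 : ℝ) < t := by exact_mod_cast ht
    have hslot : ∀ τ, ∑ i, (∑ c, share τ ω i c *
        net.txValue q i (ktr τ ω i) (env.S (τ + 1) ω) c +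
        net.Rpr i (kpr τ ω i) * ⨆ b, procWeight net q i b) ≤
        net.slotValue w V q (env.S τ ω) + V * w.total (kpr τ ω) (ktr τ ω) +
          ∑ s, β s τ ω * env.stateNoise s τ ω := fun τ => by
      rw [env.sum_mul_stateNoise fun s => β s τ ω]
      have h2 := net.le_slotValue w V q (env.S τ ω) (kpr τ ω) (ktr τ ω) (share τ ω) (h0 τ ω)
        (h1 τ ω)
      have h3 : ∑ s, net.P (env.S τ ω) s * β s τ ω =
          ∑ i, ∑ c, share τ ω i c * txWeight net q (env.S τ ω) i (ktr τ ω i) c := by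
        simp only [hβ, Network.txWeight_eq, Finset.mul_sum]
        rw [Finset.sum_comm]
        refine Finset.sum_congr rfl fun i _ => ?_
        rw [Finset.sum_comm]
        exact Finset.sum_congr rfl fun c _ => Finset.sum_congr rfl fun s _ => by ring
      rw [h3]
      rw [Finset.sum_add_distrib] at h2 ⊢
      linarith
    have h4 := (hle ω t).trans (add_le_add_left (Finset.sum_le_sum fun τ _ => hslot τ) _)
    rw [Finset.sum_add_distrib, Finset.sum_add_distrib, ← Finset.mul_sum, Finset.sum_comm
      (f := fun τ s => β s τ ω * env.stateNoise s τ ω)] at h4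
    have h5 := div_le_div_of_nonneg_right h4 ht'.le
    rw [add_div, add_div, add_div, mul_div_assoc] at h5
    beta_reduce
    rw [← Finset.sum_div]
    linarith

namespace ControlAlgorithm

variable {env : Environment net A lam μ} (alg : ControlAlgorithm env)

/-- Price of the arrivals that carry the label `x`, before slot `t`. -/
def labelArrivals (q : RateMatrix n M) (ω : Ω) (t : ℕ) (x : ℝ) : ℝ :=
  ∑ τ ∈ Finset.range t, ∑ i, ∑ c,
    (alg.arrived τ ω i c).indicator (fun _ => net.scale c.2 * q i c) x

/-- Largest decrease, before slot `t`, that the price of the copies of label `x` can have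
undergone. -/
def labelDecrease (q : RateMatrix n M) (ω : Ω) (t : ℕ) (x : ℝ) : ℝ :=
  ∑ τ ∈ Finset.range t, ∑ i, (∑ c, ∑ v, (alg.sent τ ω i c v).indicator
      (fun _ => net.scale c.2 * net.partitionValue q i c (env.S (τ + 1) ω) v) x +
    ∑ b, (alg.processed τ ω i b).indicator
      (fun _ => net.scale b.2.castSucc * (net.r b.2 * procWeight net q i b)) x)

theorem arrived_unique {ω : Ω} {τ τ' : ℕ} {i i' : Node n} {c c' : Commodity n M} {x : ℝ}
    (h : x ∈ alg.arrived τ ω i c) (h' : x ∈ alg.arrived τ' ω i' c') :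
    τ = τ' ∧ i = i' ∧ c = c' := by
  by_contra hne
  have : (τ, i, c) ≠ (τ', i', c') := fun e => hne (by simpa [Prod.ext_iff] using e)
  exact Set.disjoint_left.1 (alg.arrived_disjoint ω this) h h'

theorem labelArrivals_eq_zero {q : RateMatrix n M} {ω : Ω} {t : ℕ} {x : ℝ}
    (h : ∀ τ < t, ∀ i c, x ∉ alg.arrived τ ω i c) : alg.labelArrivals q ω t x = 0 :=
  Finset.sum_eq_zero fun τ hτ => Finset.sum_eq_zero fun i _ => Finset.sum_eq_zero fun c _ =>
    Set.indicator_of_notMem (h τ (Finset.mem_range.1 hτ) i c) _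

/-- Every copy of a label is worth at least the arrivals of that label minus the possible decrease:
this is what makes keeping many copies useless, whichever of them is delivered first. -/
theorem labelArrivals_le_aux {q : RateMatrix n M} (hq : IsWeight q) (ω : Ω) (x : ℝ) (t : ℕ) :
    (∀ j c, x ∈ alg.held t ω j c → (∃ τ < t, ∃ i c, x ∈ alg.arrived τ ω i c) ∧
      alg.labelArrivals q ω t x ≤ alg.labelDecrease q ω t x + net.scale c.2 * q j c) ∧
    (x ∈ alg.delivered t ω → (∃ τ < t, ∃ i c, x ∈ alg.arrived τ ω i c) ∧
      alg.labelArrivals q ω t x ≤ alg.labelDecrease q ω t x) ∧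
    ((∃ τ < t, ∃ i c, x ∈ alg.arrived τ ω i c) →
      x ∈ alg.delivered t ω ∨ ∃ j c, x ∈ alg.held t ω j c) := by
  induction t with
  | zero => simp [alg.held_zero, alg.delivered_zero]
  | succ t ih =>
    obtain ⟨ih1, ih2, ih3⟩ := ih
    have hs0 : ∀ i c v, 0 ≤ (alg.sent t ω i c v).indicator
        (fun _ => net.scale c.2 * net.partitionValue q i c (env.S (t + 1) ω) v) x :=
      fun i c v => Set.indicator_nonneg (fun _ _ => mul_nonneg (net.scale_pos _).le
        (net.partitionValue_nonneg _ _ _ _ _)) _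
    have hp0 : ∀ i b, 0 ≤ (alg.processed t ω i b).indicator
        (fun _ => net.scale b.2.castSucc * (net.r b.2 * procWeight net q i b)) x :=
      fun i b => Set.indicator_nonneg (fun _ _ => mul_nonneg (net.scale_pos _).le
        (mul_nonneg (net.r_pos _).le (net.procWeight_nonneg _ _ _))) _
    have hS0 : ∀ i, 0 ≤ ∑ c, ∑ v, (alg.sent t ω i c v).indicator
        (fun _ => net.scale c.2 * net.partitionValue q i c (env.S (t + 1) ω) v) x := fun i =>
      Finset.sum_nonneg fun c _ => Finset.sum_nonneg fun v _ => hs0 i c v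
    have hP0 : ∀ i, 0 ≤ ∑ b, (alg.processed t ω i b).indicator
        (fun _ => net.scale b.2.castSucc * (net.r b.2 * procWeight net q i b)) x := fun i =>
      Finset.sum_nonneg fun b _ => hp0 i b
    have hdec : alg.labelDecrease q ω t x ≤ alg.labelDecrease q ω (t + 1) x := by
      unfold labelDecrease
      rw [Finset.sum_range_succ]
      exact le_add_of_nonneg_right (Finset.sum_nonneg fun i _ => add_nonneg (hS0 i) (hP0 i))
    have hdec_sent : ∀ i c v, x ∈ alg.sent t ω i c v → alg.labelDecrease q ω t x +
        net.scale c.2 * net.partitionValue q i c (env.S (t + 1) ω) v ≤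
        alg.labelDecrease q ω (t + 1) x := fun i c v hx => by
      unfold labelDecrease
      rw [Finset.sum_range_succ]
      refine add_le_add_right ?_ _
      have e1 := Finset.single_le_sum (fun v _ => hs0 i c v) (Finset.mem_univ v)
      rw [Set.indicator_of_mem hx] at e1
      have e2 := Finset.single_le_sum (f := fun c => ∑ v, (alg.sent t ω i c v).indicator
        (fun _ => net.scale c.2 * net.partitionValue q i c (env.S (t + 1) ω) v) x)
        (fun c _ => Finset.sum_nonneg fun v _ => hs0 i c v) (Finset.mem_univ c)
      have e3 := Finset.single_le_sum (fun i _ => add_nonneg (hS0 i) (hP0 i)) (Finset.mem_univ i)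
      refine e1.trans (e2.trans (le_trans ?_ e3))
      exact le_add_of_nonneg_right (hP0 i)
    have hdec_proc : ∀ i b, x ∈ alg.processed t ω i b → alg.labelDecrease q ω t x +
        net.scale b.2.castSucc * (net.r b.2 * procWeight net q i b) ≤
        alg.labelDecrease q ω (t + 1) x := fun i b hx => by
      unfold labelDecrease
      rw [Finset.sum_range_succ]
      refine add_le_add_right ?_ _
      have e1 := Finset.single_le_sum (fun b _ => hp0 i b) (Finset.mem_univ b)
      rw [Set.indicator_of_mem hx] at e1
      have e3 := Finset.single_le_sum (fun i _ => add_nonneg (hS0 i) (hP0 i)) (Finset.mem_univ i)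
      refine e1.trans (le_trans ?_ e3)
      exact le_add_of_nonneg_left (hS0 i)
    have harr_old : (∃ τ < t, ∃ i c, x ∈ alg.arrived τ ω i c) →
        (∃ τ < t + 1, ∃ i c, x ∈ alg.arrived τ ω i c) ∧
        alg.labelArrivals q ω (t + 1) x = alg.labelArrivals q ω t x := by
      rintro ⟨τ, hτ, i, c, hx⟩
      refine ⟨⟨τ, hτ.trans (Nat.lt_succ_self t), i, c, hx⟩, ?_⟩
      unfold labelArrivals
      rw [Finset.sum_range_succ, add_eq_left]
      refine Finset.sum_eq_zero fun i' _ => Finset.sum_eq_zero fun c' _ =>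
        Set.indicator_of_notMem (fun hx' => ?_) _
      exact hτ.ne (alg.arrived_unique hx hx').1
    have havail : ∀ j c, x ∈ alg.available t ω j c →
        (∃ τ < t + 1, ∃ i c, x ∈ alg.arrived τ ω i c) ∧ alg.labelArrivals q ω (t + 1) x ≤
          alg.labelDecrease q ω (t + 1) x + net.scale c.2 * q j c := by
      intro j c hx
      rw [alg.available_eq] at hx
      rcases hx with ((hx | hx) | hx) | hx
      · obtain ⟨h1, h2⟩ := ih1 j c hx
        obtain ⟨h3, h4⟩ := harr_old h1
        exact ⟨h3, by rw [h4]; linarith⟩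
      · obtain ⟨i, hx⟩ := Set.mem_iUnion.1 hx
        obtain ⟨v, hv, hx⟩ := Set.mem_iUnion₂.1 (alg.retained_subset t ω i j c hx)
        obtain ⟨h1, h2⟩ := ih1 i c (alg.sent_subset t ω i c v hx)
        obtain ⟨h3, h4⟩ := harr_old h1
        refine ⟨h3, ?_⟩
        have h5 := hdec_sent i c v hx
        have h6 : q i c - q j c ≤ net.partitionValue q i c (env.S (t + 1) ω) v :=
          (le_max_left _ _).trans (net.diffWeight_le_partitionValue q c hv)
        have h7 := mul_le_mul_of_nonneg_left h6 (net.scale_pos c.2).le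
        rw [h4]; linarith
      · obtain ⟨m, hm, hx⟩ := Set.mem_iUnion₂.1 hx
        obtain ⟨h1, h2⟩ := ih1 j _ (alg.processed_subset t ω j (c.1, m) hx)
        obtain ⟨h3, h4⟩ := harr_old h1
        refine ⟨h3, ?_⟩
        have h5 := hdec_proc j (c.1, m) hx
        have h6 : q j (c.1, m.castSucc) - net.ξ m * q j (c.1, m.succ) ≤
            net.r m * procWeight net q j (c.1, m) := by
          have hr := (net.r_pos m).ne'
          have : net.r m * procWeight net q j (c.1, m) =
              max (q j (c.1, m.castSucc) - net.ξ m * q j (c.1, m.succ)) 0 := by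
            unfold procWeight; field_simp
          rw [this]; exact le_max_left _ _
        have h7 := mul_le_mul_of_nonneg_left h6 (net.scale_pos m.castSucc).le
        have hm' : m.succ = c.2 := hm
        have hc : c = (c.1, m.succ) := by rw [hm']
        rw [h4, ← hm', net.scale_succ]
        have h8 : q j c = q j (c.1, m.succ) := by rw [← hc]
        rw [h8]
        simp only at h2 h5
        linarith
      · refine ⟨⟨t, Nat.lt_succ_self t, j, c, hx⟩, ?_⟩
        have h1 : alg.labelArrivals q ω t x = 0 := alg.labelArrivals_eq_zero
          fun τ hτ i' c' hx' => hτ.ne (alg.arrived_unique hx' hx).1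
        have h2 : alg.labelArrivals q ω (t + 1) x = net.scale c.2 * q j c := by
          have h3 : alg.labelArrivals q ω (t + 1) x = alg.labelArrivals q ω t x + ∑ i, ∑ c,
              (alg.arrived t ω i c).indicator (fun _ => net.scale c.2 * q i c) x := by
            unfold labelArrivals; rw [Finset.sum_range_succ]
          rw [h3, h1, zero_add, Finset.sum_eq_single j, Finset.sum_eq_single c,
            Set.indicator_of_mem hx]
          · exact fun c' _ hc' => Set.indicator_of_notMem
              (fun hx' => hc' (alg.arrived_unique hx' hx).2.2) _
          · simp
          · exact fun i' _ hi' => Finset.sum_eq_zero fun c' _ => Set.indicator_of_notMem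
              (fun hx' => hi' (alg.arrived_unique hx' hx).2.1) _
          · simp
        have h4 : 0 ≤ alg.labelDecrease q ω (t + 1) x := by
          refine Finset.sum_nonneg fun τ _ => Finset.sum_nonneg fun i _ => add_nonneg ?_ ?_
          · exact Finset.sum_nonneg fun c _ => Finset.sum_nonneg fun v _ =>
              Set.indicator_nonneg (fun _ _ => mul_nonneg (net.scale_pos _).le
                (net.partitionValue_nonneg _ _ _ _ _)) _
          · exact Finset.sum_nonneg fun b _ =>
              Set.indicator_nonneg (fun _ _ => mul_nonneg (net.scale_pos _).le
                (mul_nonneg (net.r_pos _).le (net.procWeight_nonneg _ _ _))) _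
        rw [h2]; linarith
    refine ⟨fun j c hx => havail j c (alg.held_succ t ω j c hx), fun hx => ?_, ?_⟩
    · rw [alg.delivered_succ] at hx
      rcases hx with hx | hx
      · obtain ⟨h1, h2⟩ := ih2 hx
        obtain ⟨h3, h4⟩ := harr_old h1
        exact ⟨h3, by rw [h4]; linarith⟩
      · obtain ⟨d, hx⟩ := Set.mem_iUnion.1 hx
        have := havail d _ hx
        rwa [hq.final, mul_zero, add_zero] at this
    · have hloss : ∀ i c, x ∈ alg.held t ω i c ∪ alg.arrived t ω i c →
          x ∈ alg.delivered (t + 1) ω ∨ ∃ j c, x ∈ alg.held (t + 1) ω j c := fun i c hx => by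
        rcases alg.no_loss t ω i c hx with h | h
        · exact Or.inl h
        · obtain ⟨j, h⟩ := Set.mem_iUnion.1 h
          obtain ⟨c', h⟩ := Set.mem_iUnion.1 h
          exact Or.inr ⟨j, c', h⟩
      rintro ⟨τ, hτ, i, c, hx⟩
      rcases (Nat.lt_succ_iff.1 hτ).lt_or_eq with hτ | rfl
      · rcases ih3 ⟨τ, hτ, i, c, hx⟩ with h | ⟨j, c', h⟩
        · left; rw [alg.delivered_succ]; exact Or.inl h
        · exact hloss j c' (Or.inl h)
      · exact hloss i c (Or.inr hx)

/-- Whether a label has been delivered or not, one of its copies accounts for its arrivals. -/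
theorem labelArrivals_le {q : RateMatrix n M} (hq : IsWeight q) (ω : Ω) (x : ℝ) (t : ℕ) :
    alg.labelArrivals q ω t x ≤ alg.labelDecrease q ω t x +
      ∑ i, ∑ c, (alg.held t ω i c).indicator (fun _ => net.scale c.2 * q i c) x := by
  obtain ⟨h1, h2, h3⟩ := alg.labelArrivals_le_aux hq ω x t
  have hh0 : ∀ i c, 0 ≤ (alg.held t ω i c).indicator (fun _ => net.scale c.2 * q i c) x :=
    fun i c => Set.indicator_nonneg (fun _ _ => mul_nonneg (net.scale_pos _).le (hq.nonneg i c)) _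
  have hd0 : 0 ≤ alg.labelDecrease q ω t x := by
    refine Finset.sum_nonneg fun τ _ => Finset.sum_nonneg fun i _ => add_nonneg ?_ ?_
    · exact Finset.sum_nonneg fun c _ => Finset.sum_nonneg fun v _ =>
        Set.indicator_nonneg (fun _ _ => mul_nonneg (net.scale_pos _).le
          (net.partitionValue_nonneg _ _ _ _ _)) _
    · exact Finset.sum_nonneg fun b _ =>
        Set.indicator_nonneg (fun _ _ => mul_nonneg (net.scale_pos _).le
          (mul_nonneg (net.r_pos _).le (net.procWeight_nonneg _ _ _))) _
  have hH0 := Finset.sum_nonneg fun i (_ : i ∈ Finset.univ) =>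
    Finset.sum_nonneg fun c (_ : c ∈ Finset.univ) => hh0 i c
  by_cases hx : ∃ τ < t, ∃ i c, x ∈ alg.arrived τ ω i c
  · rcases h3 hx with h | ⟨j, c, h⟩
    · exact (h2 h).2.trans (le_add_of_nonneg_right hH0)
    · refine (h1 j c h).2.trans (add_le_add_right ?_ _)
      have e1 := Finset.single_le_sum (fun c _ => hh0 j c) (Finset.mem_univ c)
      rw [Set.indicator_of_mem h] at e1
      exact e1.trans (Finset.single_le_sum
        (fun i _ => Finset.sum_nonneg fun c _ => hh0 i c) (Finset.mem_univ j))
  · rw [alg.labelArrivals_eq_zero fun τ hτ i c hx' => hx ⟨τ, hτ, i, c, hx'⟩]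
    exact add_nonneg hd0 hH0

theorem volume_held_lt_top (t : ℕ) (ω : Ω) (i : Node n) (c : Commodity n M) :
    volume (alg.held t ω i c) < ⊤ := by
  have hsub : alg.held t ω i c ⊆ ⋃ τ ∈ Finset.range t, ⋃ p : Node n × Commodity n M,
      alg.arrived τ ω p.1 p.2 := fun x hx => by
    obtain ⟨τ, hτ, i, c, h⟩ := ((alg.labelArrivals_le_aux (q := 0) ⟨by simp, by simp⟩ ω x t).1
      i c hx).1
    exact Set.mem_biUnion (Finset.mem_coe.2 (Finset.mem_range.2 hτ))
      (Set.mem_iUnion.2 ⟨(i, c), h⟩)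
  refine (measure_mono hsub).trans_lt (measure_biUnion_lt_top (Finset.finite_toSet _)
    fun τ _ => ?_)
  refine lt_of_le_of_lt (measure_iUnion_fintype_le _ _) (ENNReal.sum_lt_top.2 fun p _ => ?_)
  rw [alg.arrived_size]
  exact ENNReal.ofReal_lt_top

/-- The price of the arrivals is covered by the values of the slots and by what is still held. -/
theorem sum_pairing_le {q : RateMatrix n M} (hq : IsWeight q) (ω : Ω) (t : ℕ) :
    ∑ τ ∈ Finset.range t, pairing q (env.a τ ω) ≤
      ∑ τ ∈ Finset.range t, ∑ i, (∑ c, alg.share τ ω i c *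
        net.txValue q i (alg.ktr τ ω i) (env.S (τ + 1) ω) c +
        net.Rpr i (alg.kpr τ ω i) * ⨆ b, procWeight net q i b) +
      pairing q (alg.backlog t ω) := by
  have hI : ∀ (s : Set ℝ) (a : ℝ), MeasurableSet s → volume s < ⊤ →
      Integrable (s.indicator fun _ => a) := fun s a hs hv =>
    (integrableOn_const hv.ne).integrable_indicator hs
  have hav : ∀ τ i c, volume (alg.arrived τ ω i c) < ⊤ := fun τ i c => by
    rw [alg.arrived_size]; exact ENNReal.ofReal_lt_top
  have i1 : ∀ τ i c, Integrable ((alg.arrived τ ω i c).indicator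
      fun _ => net.scale c.2 * q i c) := fun τ i c => hI _ _ (alg.arrived_meas τ ω i c) (hav τ i c)
  have i2 : ∀ τ i c v, Integrable ((alg.sent τ ω i c v).indicator
      fun _ => net.scale c.2 * net.partitionValue q i c (env.S (τ + 1) ω) v) := fun τ i c v =>
    hI _ _ (alg.sent_meas τ ω i c v)
      ((measure_mono (alg.sent_subset τ ω i c v)).trans_lt (alg.volume_held_lt_top τ ω i c))
  have i3 : ∀ τ i b, Integrable ((alg.processed τ ω i b).indicator
      fun _ => net.scale b.2.castSucc * (net.r b.2 * procWeight net q i b)) := fun τ i b =>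
    hI _ _ (alg.processed_meas τ ω i b)
      ((measure_mono (alg.processed_subset τ ω i b)).trans_lt (alg.volume_held_lt_top τ ω i _))
  have i4 : ∀ i c, Integrable ((alg.held t ω i c).indicator
      fun _ => net.scale c.2 * q i c) := fun i c =>
    hI _ _ (alg.held_meas t ω i c) (alg.volume_held_lt_top t ω i c)
  have j1 : Integrable (alg.labelArrivals q ω t) :=
    integrable_finsetSum _ fun τ _ => integrable_finsetSum _ fun i _ =>
      integrable_finsetSum _ fun c _ => i1 τ i c
  have j2a : ∀ τ i, Integrable fun x => ∑ c, ∑ v, (alg.sent τ ω i c v).indicator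
      (fun _ => net.scale c.2 * net.partitionValue q i c (env.S (τ + 1) ω) v) x := fun τ i =>
    integrable_finsetSum _ fun c _ => integrable_finsetSum _ fun v _ => i2 τ i c v
  have j2b : ∀ τ i, Integrable fun x => ∑ b, (alg.processed τ ω i b).indicator
      (fun _ => net.scale b.2.castSucc * (net.r b.2 * procWeight net q i b)) x := fun τ i =>
    integrable_finsetSum _ fun b _ => i3 τ i b
  have j2c : ∀ τ i, Integrable fun x => (∑ c, ∑ v, (alg.sent τ ω i c v).indicator
      (fun _ => net.scale c.2 * net.partitionValue q i c (env.S (τ + 1) ω) v) x +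
    ∑ b, (alg.processed τ ω i b).indicator
      (fun _ => net.scale b.2.castSucc * (net.r b.2 * procWeight net q i b)) x) := fun τ i =>
    (j2a τ i).add (j2b τ i)
  have j2 : Integrable (alg.labelDecrease q ω t) :=
    integrable_finsetSum _ fun τ _ => integrable_finsetSum _ fun i _ => j2c τ i
  have j4 : Integrable fun x => ∑ i, ∑ c,
      (alg.held t ω i c).indicator (fun _ => net.scale c.2 * q i c) x :=
    integrable_finsetSum _ fun i _ => integrable_finsetSum _ fun c _ => i4 i c
  have hmain := integral_mono j1 (j2.add j4) fun x => alg.labelArrivals_le hq ω x t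
  rw [integral_add' j2 j4] at hmain
  have k1 : ∫ x, alg.labelArrivals q ω t x = ∑ τ ∈ Finset.range t, pairing q (env.a τ ω) := by
    unfold labelArrivals
    rw [integral_finsetSum _ fun τ _ => integrable_finsetSum _ fun i _ =>
      integrable_finsetSum _ fun c _ => i1 τ i c]
    refine Finset.sum_congr rfl fun τ _ => ?_
    rw [integral_finsetSum _ fun i _ => integrable_finsetSum _ fun c _ => i1 τ i c]
    refine Finset.sum_congr rfl fun i _ => ?_
    rw [integral_finsetSum _ fun c _ => i1 τ i c]
    refine Finset.sum_congr rfl fun c _ => ?_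
    rw [integral_indicator_const _ (alg.arrived_meas τ ω i c), measureReal_def, alg.arrived_size,
      ENNReal.toReal_ofReal (div_nonneg (env.a_nonneg τ ω i c) (net.scale_pos _).le), smul_eq_mul]
    have := (net.scale_pos c.2).ne'
    field_simp
  have k4 : ∫ x, ∑ i, ∑ c, (alg.held t ω i c).indicator (fun _ => net.scale c.2 * q i c) x =
      pairing q (alg.backlog t ω) := by
    rw [integral_finsetSum _ fun i _ => integrable_finsetSum _ fun c _ => i4 i c]
    refine Finset.sum_congr rfl fun i _ => ?_
    rw [integral_finsetSum _ fun c _ => i4 i c]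
    refine Finset.sum_congr rfl fun c _ => ?_
    rw [integral_indicator_const _ (alg.held_meas t ω i c), smul_eq_mul, backlog]
    ring
  rw [k1, k4] at hmain
  refine hmain.trans (add_le_add_left ?_ _)
  unfold labelDecrease
  rw [integral_finsetSum _ fun τ _ => integrable_finsetSum _ fun i _ => j2c τ i]
  refine Finset.sum_le_sum fun τ _ => ?_
  rw [integral_finsetSum _ fun i _ => j2c τ i]
  refine Finset.sum_le_sum fun i _ => ?_
  rw [integral_add (j2a τ i) (j2b τ i), integral_finsetSum _ fun b _ => i3 τ i b,
    integral_finsetSum _ fun c _ => integrable_finsetSum _ fun v _ => i2 τ i c v]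
  refine add_le_add (Finset.sum_le_sum fun c _ => ?_) ?_
  · rw [integral_finsetSum _ fun v _ => i2 τ i c v, Network.txValue, Finset.mul_sum]
    refine Finset.sum_le_sum fun v _ => ?_
    rw [integral_indicator_const _ (alg.sent_meas τ ω i c v), smul_eq_mul]
    have := mul_le_mul_of_nonneg_right (alg.sent_size τ ω i c v)
      (net.partitionValue_nonneg q i c (env.S (τ + 1) ω) v)
    linarith
  · have hle : ∀ b, procWeight net q i b ≤ ⨆ b, procWeight net q i b := fun b =>
      le_ciSup (Set.finite_range _).bddAbove b
    have := net.nonempty_job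
    have h0 : 0 ≤ ⨆ b, procWeight net q i b := Real.iSup_nonneg fun b =>
      net.procWeight_nonneg q i b
    calc ∑ b, ∫ x, (alg.processed τ ω i b).indicator
          (fun _ => net.scale b.2.castSucc * (net.r b.2 * procWeight net q i b)) x
        = ∑ b, net.scale b.2.castSucc * volume.real (alg.processed τ ω i b) * net.r b.2 *
            procWeight net q i b := Finset.sum_congr rfl fun b _ => by
          rw [integral_indicator_const _ (alg.processed_meas τ ω i b), smul_eq_mul]; ring
      _ ≤ ∑ b, net.scale b.2.castSucc * volume.real (alg.processed τ ω i b) * net.r b.2 *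
            ⨆ b, procWeight net q i b := Finset.sum_le_sum fun b _ =>
          mul_le_mul_of_nonneg_left (hle b) (mul_nonneg (mul_nonneg (net.scale_pos _).le
            measureReal_nonneg) (net.r_pos _).le)
      _ ≤ _ := by
          rw [← Finset.sum_mul]
          exact mul_le_mul_of_nonneg_right (alg.processed_size τ ω i) h0

end ControlAlgorithm

end Converse

/-! ### The converse for control algorithms and for the closure of their rates -/

section ConverseAlgorithms

variable {n M : ℕ} {𝒮 : Type} [Fintype 𝒮] {net : Network n M 𝒮} {A : ℝ} {lam : RateMatrix n M}
  {Ω : Type*} [mΩ : MeasurableSpace Ω] {μ : Measure Ω}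

theorem tendsto_pairing_div {x : ℕ → RateMatrix n M} (q : RateMatrix n M)
    (h : ∀ i c, Tendsto (fun t : ℕ => x t i c / t) atTop (𝓝 0)) :
    Tendsto (fun t : ℕ => pairing q (x t) / t) atTop (𝓝 0) := by
  have h1 := tendsto_finsetSum (Finset.univ : Finset (Node n)) fun i _ =>
    tendsto_finsetSum (Finset.univ : Finset (Commodity n M)) fun c _ => (h i c).const_mul (q i c)
  simp only [mul_zero, Finset.sum_const_zero] at h1
  refine h1.congr fun t => ?_
  rw [pairing, Finset.sum_div]
  refine Finset.sum_congr rfl fun i _ => ?_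
  rw [Finset.sum_div]
  exact Finset.sum_congr rfl fun c _ => by ring

namespace ControlAlgorithm

variable {env : Environment net A lam μ} (alg : ControlAlgorithm env)

theorem stronglyMeasurable_total (w : net.Cost) (t : ℕ) :
    StronglyMeasurable[env.ℱ t] fun ω => w.total (alg.kpr t ω) (alg.ktr t ω) := by
  refine Finset.stronglyMeasurable_fun_sum _ fun i _ => StronglyMeasurable.add ?_ ?_
  · exact ((Measurable.of_discrete (f := w.pr i)).comp (alg.kpr_adapted t i)).stronglyMeasurable
  · exact ((Measurable.of_discrete (f := w.tr i)).comp (alg.ktr_adapted t i)).stronglyMeasurable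

theorem integrable_total [IsProbabilityMeasure μ] (w : net.Cost) (t : ℕ) :
    Integrable (fun ω => w.total (alg.kpr t ω) (alg.ktr t ω)) μ := by
  refine Integrable.of_bound ((alg.stronglyMeasurable_total w t).mono
    (env.ℱ.le t)).aestronglyMeasurable w.bound (Eventually.of_forall fun ω => ?_)
  rw [Real.norm_of_nonneg (w.total_nonneg _ _)]
  exact w.total_le_bound _ _

theorem average_mem_Icc [IsProbabilityMeasure μ] (w : net.Cost) (t : ℕ) :
    (∑ τ ∈ Finset.range t, ∫ ω, w.total (alg.kpr τ ω) (alg.ktr τ ω) ∂μ) / (t : ℝ) ∈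
      Set.Icc 0 w.bound := by
  constructor
  · exact div_nonneg (Finset.sum_nonneg fun τ _ => integral_nonneg fun ω => w.total_nonneg _ _)
      (Nat.cast_nonneg t)
  · refine div_le_of_le_mul₀ (Nat.cast_nonneg t) w.bound_nonneg ?_
    calc _ ≤ ∑ τ ∈ Finset.range t, w.bound := Finset.sum_le_sum fun τ _ => by
          have := integral_mono (alg.integrable_total w τ) (integrable_const (μ := μ) w.bound)
            fun ω => w.total_le_bound _ _
          simpa using this
      _ = _ := by simp [mul_comm]

theorem isBoundedUnder_average [IsProbabilityMeasure μ] (w : net.Cost) :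
    IsBoundedUnder (· ≤ ·) atTop (fun t : ℕ =>
      (∑ τ ∈ Finset.range t, ∫ ω, w.total (alg.kpr τ ω) (alg.ktr τ ω) ∂μ) / (t : ℝ)) ∧
    IsBoundedUnder (· ≥ ·) atTop (fun t : ℕ =>
      (∑ τ ∈ Finset.range t, ∫ ω, w.total (alg.kpr τ ω) (alg.ktr τ ω) ∂μ) / (t : ℝ)) :=
  ⟨isBoundedUnder_of ⟨_, fun t => (alg.average_mem_Icc w t).2⟩,
    isBoundedUnder_of ⟨_, fun t => (alg.average_mem_Icc w t).1⟩⟩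

theorem averageCost_le_bound [IsProbabilityMeasure μ] (w : net.Cost) :
    alg.averageCost w ≤ w.bound :=
  limsup_le_of_le (alg.isBoundedUnder_average w).2.isCoboundedUnder_le
    (Eventually.of_forall fun t => (alg.average_mem_Icc w t).2)

theorem averageCost_nonneg [IsProbabilityMeasure μ] (w : net.Cost) :
    0 ≤ alg.averageCost w :=
  le_limsup_of_frequently_le (Frequently.of_forall fun t => (alg.average_mem_Icc w t).1)
    (alg.isBoundedUnder_average w).1

/-- The price of the rates that an algorithm stabilizes is at most the mean value of a slot plus
`V` times the average cost of the algorithm. -/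
theorem pairing_le [IsProbabilityMeasure μ] (h : alg.RateStable) (w : net.Cost) {V : ℝ}
    (hV : 0 ≤ V) {q : RateMatrix n M} (hq : IsWeight q) :
    pairing q lam ≤ net.meanValue w V q + V * alg.averageCost w := by
  set avg : ℕ → Ω → ℝ := fun t ω =>
    (∑ τ ∈ Finset.range t, w.total (alg.kpr τ ω) (alg.ktr τ ω)) / (t : ℝ) with havg
  set L := pairing q lam - net.meanValue w V q with hL
  have havg0 : ∀ t ω, 0 ≤ avg t ω := fun t ω =>
    div_nonneg (Finset.sum_nonneg fun τ _ => w.total_nonneg _ _) (Nat.cast_nonneg t)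
  have hint : ∀ t, Integrable (avg t) μ := fun t =>
    (integrable_finsetSum _ fun τ _ => alg.integrable_total w τ).div_const _
  -- the inequality holds on almost every path up to a vanishing error; its positive part is bounded,
  -- so that taking expectations is possible
  have hae : ∀ᵐ ω ∂μ, Tendsto (fun t => max (L - V * avg t ω) 0) atTop (𝓝 0) := by
    filter_upwards [env.ae_pairing_le w V alg.ktr_adapted alg.share_adapted alg.share_nonneg
      alg.share_sum q (R := fun t ω => pairing q (alg.backlog t ω))
      (by filter_upwards [h] with ω hω using tendsto_pairing_div q hω)
      fun ω t => alg.sum_pairing_le hq ω t] with ω ⟨r, hr, hle⟩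
    have h1 : Tendsto (fun t => max (r t) 0) atTop (𝓝 0) := by
      simpa using hr.max (tendsto_const_nhds (x := (0 : ℝ)))
    refine squeeze_zero' (Eventually.of_forall fun t => le_max_right _ _) ?_ h1
    filter_upwards [eventually_gt_atTop 0] with t ht
    have := hle t ht
    exact max_le_max_right _ (by rw [hL]; linarith)
  have hlim : Tendsto (fun t => ∫ ω, max (L - V * avg t ω) 0 ∂μ) atTop (𝓝 (∫ _, (0 : ℝ) ∂μ)) := by
    refine tendsto_integral_of_dominated_convergence (fun _ => |L|) (fun t => ?_)
      (integrable_const _) (fun t => Eventually.of_forall fun ω => ?_) hae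
    · exact (((integrable_const L).sub ((hint t).const_mul V)).pos_part).aestronglyMeasurable
    · rw [Real.norm_of_nonneg (le_max_right _ _)]
      exact max_le ((sub_le_self _ (mul_nonneg hV (havg0 t ω))).trans (le_abs_self L))
        (abs_nonneg L)
  rw [integral_zero] at hlim
  have hm : ∀ t, L ≤ V * ((∑ τ ∈ Finset.range t,
      ∫ ω, w.total (alg.kpr τ ω) (alg.ktr τ ω) ∂μ) / (t : ℝ)) +
      ∫ ω, max (L - V * avg t ω) 0 ∂μ := fun t => by
    have h1 : ∫ ω, (L - V * avg t ω) ∂μ ≤ ∫ ω, max (L - V * avg t ω) 0 ∂μ :=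
      integral_mono ((integrable_const L).sub ((hint t).const_mul V))
        ((integrable_const L).sub ((hint t).const_mul V)).pos_part
        fun ω => le_max_left (L - V * avg t ω) 0
    have h2 : ∫ ω, avg t ω ∂μ = (∑ τ ∈ Finset.range t,
        ∫ ω, w.total (alg.kpr τ ω) (alg.ktr τ ω) ∂μ) / (t : ℝ) := by
      rw [havg]
      simp only
      rw [integral_div, integral_finsetSum _ fun τ _ => alg.integrable_total w τ]
    rw [integral_sub (integrable_const L) ((hint t).const_mul V), integral_const_mul, h2] at h1
    simp only [integral_const, probReal_univ, one_smul] at h1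
    linarith
  have hη : ∀ η > 0, L ≤ V * (alg.averageCost w + η) := fun η hη => by
    have h1 : ∀ᶠ t : ℕ in atTop, (∑ τ ∈ Finset.range t,
        ∫ ω, w.total (alg.kpr τ ω) (alg.ktr τ ω) ∂μ) / (t : ℝ) < alg.averageCost w + η :=
      eventually_lt_of_limsup_lt (lt_add_of_pos_right _ hη) (alg.isBoundedUnder_average w).1
    have h2 : Tendsto (fun t => V * (alg.averageCost w + η) + ∫ ω, max (L - V * avg t ω) 0 ∂μ)
        atTop (𝓝 (V * (alg.averageCost w + η))) := by
      simpa using hlim.const_add (V * (alg.averageCost w + η))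
    refine ge_of_tendsto h2 ?_
    filter_upwards [h1] with t ht
    exact (hm t).trans (add_le_add_left (mul_le_mul_of_nonneg_left ht.le hV) _)
  have hfin : L ≤ V * alg.averageCost w := by
    have h1 : Tendsto (fun η : ℝ => V * (alg.averageCost w + η)) (𝓝[>] 0)
        (𝓝 (V * alg.averageCost w)) := by
      have : Continuous fun η : ℝ => V * (alg.averageCost w + η) := by fun_prop
      simpa using (this.tendsto 0).mono_left nhdsWithin_le_nhds
    exact ge_of_tendsto h1 (eventually_mem_nhdsWithin.mono fun η h => hη η h)
  linarith

end ControlAlgorithm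

/-- The price inequalities on the closure: only the crude bound `w.bound` for the costs is uniform
over the algorithms, hence survives the limit. -/
theorem pairing_le_of_mem_capacityRegion (hlam : lam ∈ capacityRegion net) (w : net.Cost) {V : ℝ}
    (hV : 0 ≤ V) {q : RateMatrix n M} (hq : IsWeight q) :
    pairing q lam ≤ net.meanValue w V q + V * w.bound := by
  have hc : IsClosed {x : RateMatrix n M | pairing q x ≤ net.meanValue w V q + V * w.bound} :=
    isClosed_le (by unfold pairing; fun_prop) continuous_const
  refine closure_minimal ?_ hc hlam
  rintro x ⟨Ω, _, μ, _, A, env, alg, h⟩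
  exact (alg.pairing_le h w hV hq).trans
    (add_le_add_right (mul_le_mul_of_nonneg_left (alg.averageCost_le_bound w) hV) _)

theorem nonneg_of_mem_capacityRegion (hlam : lam ∈ capacityRegion net) (i : Node n)
    (c : Commodity n M) : 0 ≤ lam i c := by
  have hc : IsClosed {x : RateMatrix n M | 0 ≤ x i c} := isClosed_le continuous_const (by fun_prop)
  refine closure_minimal ?_ hc hlam
  rintro x ⟨Ω, _, μ, _, A, env, alg, h⟩
  exact env.lam_nonneg i c

end ConverseAlgorithms

/-! ### DWCNC maximises the value minus the cost in every slot -/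

section DWCNC

variable {n M : ℕ} {𝒮 : Type} [Fintype 𝒮] {net : Network n M 𝒮} {A : ℝ} {lam : RateMatrix n M}
  {Ω : Type*} [mΩ : MeasurableSpace Ω] {μ : Measure Ω}
  {env : Environment net A lam μ} {w : net.Cost} {V : ℝ}

namespace DWCNCRun

variable (run : DWCNCRun env w V)

/-- The decisions of a slot. -/
def decision (t : ℕ) (ω : Ω) : net.Decision :=
  ⟨run.kpr t ω, run.ktr t ω, run.bestPr t ω, run.bestTr t ω⟩

theorem outflow_eq (t : ℕ) (ω : Ω) (i : Node n) (c : Commodity n M) :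
    ∑ j, run.flowTr t ω i j c +
      ∑ m : Fin M, (if m.castSucc = c.2 then run.flowPr t ω i (c.1, m) else 0) =
    min (run.Q t ω i c) ((run.decision t ω).out (run.Q t ω) (env.S (t + 1) ω) (run.fwd t ω) i c) :=
  run.flow_total t ω i c

theorem inflow_nonneg (t : ℕ) (ω : Ω) (i : Node n) (c : Commodity n M) :
    0 ≤ ∑ j, run.flowTr t ω j i c +
      ∑ m : Fin M, (if m.succ = c.2 then net.ξ m * run.flowPr t ω i (c.1, m) else 0) :=
  add_nonneg (Finset.sum_nonneg fun j _ => run.flowTr_nonneg t ω j i c)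
    (Finset.sum_nonneg fun m _ => by
      split_ifs
      exacts [mul_nonneg (net.ξ_pos m).le (run.flowPr_nonneg t ω i _), le_rfl])

theorem inflow_le (t : ℕ) (ω : Ω) (i : Node n) (c : Commodity n M) :
    ∑ j, run.flowTr t ω j i c +
      ∑ m : Fin M, (if m.succ = c.2 then net.ξ m * run.flowPr t ω i (c.1, m) else 0) ≤
    (run.decision t ω).inn (run.Q t ω) (env.S (t + 1) ω) (run.fwd t ω) i c :=
  add_le_add (Finset.sum_le_sum fun j _ => run.flowTr_le t ω j i c)
    (Finset.sum_le_sum fun m _ => by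
      split_ifs
      exacts [mul_le_mul_of_nonneg_left (run.flowPr_le t ω i _) (net.ξ_pos m).le, le_rfl])

theorem Q_nonneg (t : ℕ) (ω : Ω) (i : Node n) (c : Commodity n M) : 0 ≤ run.Q t ω i c := by
  cases t with
  | zero => exact run.Q_zero_nonneg ω i c
  | succ t =>
    by_cases hc : c = (i, Fin.last M)
    · rw [hc, run.Q_final]
    · rw [run.Q_succ t ω i c hc, run.outflow_eq]
      have h1 := run.inflow_nonneg t ω i c
      have h2 := env.a_nonneg t ω i c
      have h3 := min_le_left (run.Q t ω i c)
        ((run.decision t ω).out (run.Q t ω) (env.S (t + 1) ω) (run.fwd t ω) i c)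
      linarith

theorem isWeight (t : ℕ) (ω : Ω) : IsWeight (run.Q t ω) :=
  ⟨run.Q_nonneg t ω, run.Q_final t ω⟩

/-- DWCNC as a process that maximises the value minus the cost in every slot. -/
def toMaxWeight : MaxWeightProcess env w V where
  Q := run.Q
  dec := run.decision
  fwd := run.fwd
  Q_adapted := run.Q_adapted
  kpr_adapted := run.kpr_adapted
  ktr_adapted := run.ktr_adapted
  com_adapted := run.bestTr_adapted
  weight := run.isWeight
  pr_max := run.pr_max
  tr_max := run.tr_max
  fwd_spec := run.fwd_spec
  Q_succ_le t ω i c := by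
    by_cases hc : c = (i, Fin.last M)
    · subst hc
      rw [run.Q_final]
      exact add_nonneg (add_nonneg (le_max_right _ _) (Network.Decision.inn_nonneg _ _ _ _ _ _))
        (env.a_nonneg t ω i _)
    · rw [run.Q_succ t ω i c hc, run.outflow_eq]
      have h1 := run.inflow_le t ω i c
      have h2 : run.Q t ω i c - min (run.Q t ω i c)
          ((run.decision t ω).out (run.Q t ω) (env.S (t + 1) ω) (run.fwd t ω) i c) ≤
          max (run.Q t ω i c -
            (run.decision t ω).out (run.Q t ω) (env.S (t + 1) ω) (run.fwd t ω) i c) 0 := by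
        rcases min_choice (run.Q t ω i c)
          ((run.decision t ω).out (run.Q t ω) (env.S (t + 1) ω) (run.fwd t ω) i c) with h | h
        · rw [h, sub_self]; exact le_max_right _ _
        · rw [h]; exact le_max_left _ _
      linarith
  le_Q_succ t ω i c := by
    by_cases hc : c = (i, Fin.last M)
    · subst hc
      rw [run.Q_final, run.Q_final, zero_sub, neg_nonpos]
      exact Network.Decision.out_nonneg _ _ _ _ _ _
    · rw [run.Q_succ t ω i c hc, run.outflow_eq]
      have h1 := run.inflow_nonneg t ω i c
      have h2 := env.a_nonneg t ω i c
      have h3 := min_le_right (run.Q t ω i c)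
        ((run.decision t ω).out (run.Q t ω) (env.S (t + 1) ω) (run.fwd t ω) i c)
      linarith

/-- Value of the transmissions of DWCNC at arbitrary prices. -/
theorem sum_flowTr_le (q : RateMatrix n M) (t : ℕ) (ω : Ω) (i : Node n) :
    ∑ j, ∑ c, (q i c - q j c) * run.flowTr t ω i j c ≤
      net.txValue q i (run.ktr t ω i) (env.S (t + 1) ω) (run.bestTr t ω i) := by
  have h1 : ∀ j, ∑ c, (q i c - q j c) * run.flowTr t ω i j c ≤
      diffWeight q i j (run.bestTr t ω i) * ∑ v, (if run.fwd t ω i v = some j then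
        net.partitionRate i (run.ktr t ω i) (env.S (t + 1) ω) v else 0) := fun j => by
    rw [← Network.Decision.sum_txAssigned (env.S (t + 1) ω) i (run.ktr t ω i)
      (run.bestTr t ω i) (run.fwd t ω i) j fun c => diffWeight q i j c]
    refine Finset.sum_le_sum fun c _ => ?_
    exact (mul_le_mul_of_nonneg_right (le_max_left _ 0) (run.flowTr_nonneg t ω i j c)).trans
      (mul_le_mul_of_nonneg_left (run.flowTr_le t ω i j c) (le_max_right _ _))
  refine (Finset.sum_le_sum fun j _ => h1 j).trans ?_
  simp only [Finset.mul_sum]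
  rw [Finset.sum_comm, Network.txValue]
  refine Finset.sum_le_sum fun v _ => ?_
  have hp := net.partitionRate_nonneg i (run.ktr t ω i) (env.S (t + 1) ω) v
  cases hf : run.fwd t ω i v with
  | none =>
    simpa using mul_nonneg hp (net.partitionValue_nonneg q i (run.bestTr t ω i) _ v)
  | some j =>
    have hj := Network.Decision.mem_receiverSet_of_fwd (run.decision t ω) (run.fwd_spec t ω) hf
    simp only [Option.some.injEq, mul_ite, mul_zero, Finset.sum_ite_eq, Finset.mem_univ, if_true]
    rw [mul_comm]
    exact mul_le_mul_of_nonneg_left (net.diffWeight_le_partitionValue q _ hj) hp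

/-- Value of the processing of DWCNC at arbitrary prices. -/
theorem sum_flowPr_le (q : RateMatrix n M) (t : ℕ) (ω : Ω) (i : Node n) :
    ∑ b : Job n M, (q i (b.1, b.2.castSucc) - net.ξ b.2 * q i (b.1, b.2.succ)) *
        run.flowPr t ω i b ≤
      net.Rpr i (run.kpr t ω i) * ⨆ b, procWeight net q i b := by
  have hr : ∀ b : Job n M, q i (b.1, b.2.castSucc) - net.ξ b.2 * q i (b.1, b.2.succ) ≤
      net.r b.2 * procWeight net q i b := fun b => by
    have hr := (net.r_pos b.2).ne'
    have : net.r b.2 * procWeight net q i b =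
        max (q i (b.1, b.2.castSucc) - net.ξ b.2 * q i (b.1, b.2.succ)) 0 := by
      unfold procWeight; field_simp
    rw [this]; exact le_max_left _ _
  have hle : ∀ b, procWeight net q i b ≤ ⨆ b, procWeight net q i b := fun b =>
    le_ciSup (Set.finite_range _).bddAbove b
  calc _ ≤ ∑ b : Job n M, net.r b.2 * procWeight net q i b *
        procAssigned net (run.Q t ω) i (run.kpr t ω i) (run.bestPr t ω i) b :=
        Finset.sum_le_sum fun b _ =>
          (mul_le_mul_of_nonneg_right (hr b) (run.flowPr_nonneg t ω i b)).trans
            (mul_le_mul_of_nonneg_left (run.flowPr_le t ω i b)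
              (mul_nonneg (net.r_pos _).le (net.procWeight_nonneg _ _ _)))
    _ ≤ net.r (run.bestPr t ω i).2 * procWeight net q i (run.bestPr t ω i) *
        (net.Rpr i (run.kpr t ω i) / net.r (run.bestPr t ω i).2) := by
        rw [Network.Decision.sum_procAssigned (run.Q t ω) i (run.kpr t ω i) (run.bestPr t ω i)
          fun b => net.r b.2 * procWeight net q i b]
        split_ifs
        · exact le_rfl
        · exact mul_nonneg (mul_nonneg (net.r_pos _).le (net.procWeight_nonneg _ _ _))
            (div_nonneg (net.Rpr_nonneg _ _) (net.r_pos _).le)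
    _ = net.Rpr i (run.kpr t ω i) * procWeight net q i (run.bestPr t ω i) := by
        have := (net.r_pos (run.bestPr t ω i).2).ne'
        field_simp
    _ ≤ _ := mul_le_mul_of_nonneg_left (hle _) (net.Rpr_nonneg _ _)

/-- Along the paths of DWCNC, the price of the arrivals is covered by the values of the slots and by
the backlogs. -/
theorem sum_pairing_le {q : RateMatrix n M} (hq : IsWeight q) (ω : Ω) (t : ℕ) :
    ∑ τ ∈ Finset.range t, pairing q (env.a τ ω) ≤
      ∑ τ ∈ Finset.range t, ∑ i, (∑ c, (if c = run.bestTr τ ω i then 1 else 0) *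
        net.txValue q i (run.ktr τ ω i) (env.S (τ + 1) ω) c +
        net.Rpr i (run.kpr τ ω i) * ⨆ b, procWeight net q i b) +
      pairing q (run.Q t ω) := by
  induction t with
  | zero =>
    simp only [Finset.range_zero, Finset.sum_empty, zero_add]
    exact Finset.sum_nonneg fun i _ => Finset.sum_nonneg fun c _ =>
      mul_nonneg (hq.nonneg i c) (run.Q_nonneg 0 ω i c)
  | succ t ih =>
    rw [Finset.sum_range_succ, Finset.sum_range_succ]
    have h1 : pairing q (run.Q (t + 1) ω) = pairing q (run.Q t ω) + pairing q (env.a t ω) -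
        ((∑ i, ∑ c, ∑ j, q i c * run.flowTr t ω i j c -
            ∑ i, ∑ c, ∑ j, q i c * run.flowTr t ω j i c) +
          ∑ i, ∑ b : Job n M, (q i (b.1, b.2.castSucc) - net.ξ b.2 * q i (b.1, b.2.succ)) *
            run.flowPr t ω i b) := by
      have e1 : ∀ i, ∑ b : Job n M,
          (q i (b.1, b.2.castSucc) - net.ξ b.2 * q i (b.1, b.2.succ)) * run.flowPr t ω i b =
          ∑ c : Commodity n M, ∑ m : Fin M,
            (if m.castSucc = c.2 then q i c * run.flowPr t ω i (c.1, m) else 0) -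
          ∑ c : Commodity n M, ∑ m : Fin M,
            (if m.succ = c.2 then q i c * (net.ξ m * run.flowPr t ω i (c.1, m)) else 0) :=
          fun i => by
        rw [Network.Decision.sum_stage Fin.castSucc fun c m => q i c * run.flowPr t ω i (c.1, m),
          Network.Decision.sum_stage Fin.succ
            fun c m => q i c * (net.ξ m * run.flowPr t ω i (c.1, m)), ← Finset.sum_sub_distrib]
        exact Finset.sum_congr rfl fun b _ => by ring
      simp only [e1, pairing]
      simp only [← Finset.sum_sub_distrib, ← Finset.sum_add_distrib]
      refine Finset.sum_congr rfl fun i _ => Finset.sum_congr rfl fun c _ => ?_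
      by_cases hc : c = (i, Fin.last M)
      · subst hc; simp [hq.final]
      · rw [run.Q_succ t ω i c hc]
        simp only [Finset.sum_sub_distrib, ← Finset.mul_sum, ← mul_ite_zero]
        ring
    have h2 : ∑ i, ∑ c, ∑ j, q i c * run.flowTr t ω i j c -
        ∑ i, ∑ c, ∑ j, q i c * run.flowTr t ω j i c =
        ∑ i, ∑ j, ∑ c, (q i c - q j c) * run.flowTr t ω i j c := by
      have e2 : ∑ i, ∑ c, ∑ j, q i c * run.flowTr t ω j i c =
          ∑ i, ∑ j, ∑ c, q j c * run.flowTr t ω i j c := by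
        rw [Finset.sum_comm (f := fun i j => ∑ c, q j c * run.flowTr t ω i j c)]
        exact Finset.sum_congr rfl fun i _ => Finset.sum_comm
      rw [e2, ← Finset.sum_sub_distrib]
      refine Finset.sum_congr rfl fun i _ => ?_
      rw [Finset.sum_comm, ← Finset.sum_sub_distrib]
      refine Finset.sum_congr rfl fun j _ => ?_
      rw [← Finset.sum_sub_distrib]
      exact Finset.sum_congr rfl fun c _ => by ring
    have h3 := Finset.sum_le_sum fun i (_ : i ∈ Finset.univ) => run.sum_flowTr_le q t ω i
    have h4 := Finset.sum_le_sum fun i (_ : i ∈ Finset.univ) => run.sum_flowPr_le q t ω i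
    have h5 : ∑ i, (∑ c, (if c = run.bestTr t ω i then 1 else 0) *
        net.txValue q i (run.ktr t ω i) (env.S (t + 1) ω) c +
        net.Rpr i (run.kpr t ω i) * ⨆ b, procWeight net q i b) =
        ∑ i, net.txValue q i (run.ktr t ω i) (env.S (t + 1) ω) (run.bestTr t ω i) +
        ∑ i, net.Rpr i (run.kpr t ω i) * ⨆ b, procWeight net q i b := by
      rw [← Finset.sum_add_distrib]
      exact Finset.sum_congr rfl fun i _ => by simp
    rw [h5, h1, h2]
    linarith

/-- The converse along the paths of DWCNC. -/
theorem ae_pairing_le [IsProbabilityMeasure μ]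
    (h : ∀ᵐ ω ∂μ, ∀ i c, Tendsto (fun t : ℕ => run.Q t ω i c / t) atTop (𝓝 0)) (V' : ℝ)
    {q : RateMatrix n M} (hq : IsWeight q) :
    ∀ᵐ ω ∂μ, ∃ r : ℕ → ℝ, Tendsto r atTop (𝓝 0) ∧ ∀ t : ℕ, 0 < t →
      pairing q lam ≤ net.meanValue w V' q + V' * run.averageCost t ω + r t :=
  env.ae_pairing_le w V' (kpr := run.kpr) (ktr := run.ktr)
    (share := fun t ω i c => if c = run.bestTr t ω i then 1 else 0) run.ktr_adapted
    (fun t i c => (Measurable.of_discrete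
      (f := fun c' : Commodity n M => if c = c' then (1 : ℝ) else 0)).comp
        (run.bestTr_adapted t i))
    (fun t ω i c => by split_ifs <;> norm_num) (fun t ω i => by simp) q
    (R := fun t ω => pairing q (run.Q t ω))
    (by filter_upwards [h] with ω hω using tendsto_pairing_div q hω)
    fun ω t => run.sum_pairing_le hq ω t

end DWCNCRun

end DWCNC

/-! ### Cutting a set of labels into pieces of given sizes -/

/-- A subset of prescribed volume exists by the intermediate value theorem for the volume of
`E ∩ (-r, r]`. -/
theorem exists_subset_volume_eq_min {E : Set ℝ} (hE : MeasurableSet E) (hv : volume E ≠ ⊤)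
    (x : ENNReal) : ∃ F ⊆ E, MeasurableSet F ∧ volume F = min x (volume E) := by
  rcases le_or_gt (volume E) x with hx | hx
  · exact ⟨E, subset_rfl, hE, by rw [min_eq_right hx]⟩
  have hx' : x ≠ ⊤ := (hx.trans_le le_top).ne
  have hint : ∀ a b : ℝ, IntervalIntegrable (E.indicator fun _ => (1 : ℝ)) volume a b :=
    fun a b => ((integrableOn_const hv).integrable_indicator hE).intervalIntegrable
  set g : ℝ → ℝ := fun r => ∫ y in (-r)..r, E.indicator (fun _ => (1 : ℝ)) y with hg
  have hcont : Continuous g := by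
    have h1 := intervalIntegral.continuous_primitive hint 0
    have h2 : g = fun r => (∫ y in (0 : ℝ)..r, E.indicator (fun _ => (1 : ℝ)) y) -
        ∫ y in (0 : ℝ)..(-r), E.indicator (fun _ => (1 : ℝ)) y := by
      ext r
      exact (intervalIntegral.integral_interval_sub_left (hint _ _) (hint _ _)).symm
    rw [h2]
    exact h1.sub (h1.comp continuous_neg)
  have hgv : ∀ r, 0 ≤ r → g r = volume.real (E ∩ Set.Ioc (-r) r) := fun r hr => by
    rw [hg]
    simp only
    rw [intervalIntegral.integral_of_le (by linarith), integral_indicator_const _ hE, smul_eq_mul,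
      mul_one, measureReal_restrict_apply hE]
  have hlim := tendsto_measure_iUnion_atTop (μ := volume)
    (s := fun N : ℕ => E ∩ Set.Ioc (-(N : ℝ)) N) fun N N' h =>
      Set.inter_subset_inter_right _ (Set.Ioc_subset_Ioc
        (neg_le_neg (Nat.cast_le.2 h)) (Nat.cast_le.2 h))
  have hU : ⋃ N : ℕ, E ∩ Set.Ioc (-(N : ℝ)) N = E := by
    rw [← Set.inter_iUnion, Set.inter_eq_left]
    intro y _
    obtain ⟨N, hN⟩ := exists_nat_gt |y|
    have := abs_lt.1 hN
    exact Set.mem_iUnion.2 ⟨N, this.1, this.2.le⟩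
  rw [hU] at hlim
  obtain ⟨N, hN⟩ := (hlim.eventually_const_lt hx).exists
  have hN' : x.toReal ≤ g N := by
    rw [hgv N (Nat.cast_nonneg N)]
    exact ENNReal.toReal_mono
      ((measure_mono Set.inter_subset_left).trans_lt hv.lt_top).ne hN.le
  have h0 : g 0 ≤ x.toReal := by
    have : g 0 = 0 := by rw [hgv 0 le_rfl]; simp
    rw [this]; exact ENNReal.toReal_nonneg
  obtain ⟨r, hr, hgr⟩ := intermediate_value_Icc (Nat.cast_nonneg N) hcont.continuousOn ⟨h0, hN'⟩
  refine ⟨E ∩ Set.Ioc (-r) r, Set.inter_subset_left, hE.inter measurableSet_Ioc, ?_⟩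
  rw [min_eq_left hx.le, ← ENNReal.ofReal_toReal hx', ← hgr, hgv r hr.1, measureReal_def,
    ENNReal.ofReal_toReal ((measure_mono Set.inter_subset_left).trans_lt hv.lt_top).ne]

/-- Pieces are cut off one after the other, each of the prescribed size or all of what is left. -/
theorem exists_pieces {ι : Type*} [DecidableEq ι] (s : Finset ι) {E : Set ℝ}
    (hE : MeasurableSet E) (hv : volume E ≠ ⊤) (x : ι → ENNReal) :
    ∃ F : ι → Set ℝ, (∀ k, MeasurableSet (F k) ∧ F k ⊆ E ∧ volume (F k) ≤ x k ∧
      (x k = 0 → F k = ∅)) ∧ volume (E \ ⋃ k ∈ s, F k) ≤ volume E - ∑ k ∈ s, x k := by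
  induction s using Finset.induction_on with
  | empty => exact ⟨fun _ => ∅, by simp, by simp⟩
  | insert a s ha ih =>
    obtain ⟨F, hF, hr⟩ := ih
    have hm : MeasurableSet (E \ ⋃ k ∈ s, F k) :=
      hE.diff (s.measurableSet_biUnion fun k _ => (hF k).1)
    obtain ⟨G, hGE, hG, hGv⟩ := exists_subset_volume_eq_min hm
      ((measure_mono Set.sdiff_subset).trans_lt hv.lt_top).ne (x a)
    have hG' : volume G ≠ ⊤ :=
      ((measure_mono (hGE.trans Set.sdiff_subset)).trans_lt hv.lt_top).ne
    refine ⟨Function.update F a (if x a = 0 then ∅ else G), fun k => ?_, ?_⟩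
    · rcases eq_or_ne k a with rfl | hk
      · rw [Function.update_self]
        split_ifs with h
        · simp
        · exact ⟨hG, hGE.trans Set.sdiff_subset, hGv.le.trans (min_le_left _ _), fun h' => absurd h' h⟩
      · rw [Function.update_of_ne hk]; exact hF k
    · have h1 : E \ ⋃ k ∈ insert a s, Function.update F a (if x a = 0 then ∅ else G) k =
          (E \ ⋃ k ∈ s, F k) \ (if x a = 0 then ∅ else G) := by
        rw [Finset.set_biUnion_insert, Function.update_self, Set.union_comm, ← Set.sdiff_sdiff]
        congr 2
        refine Set.iUnion₂_congr fun k hk => ?_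
        rw [Function.update_of_ne fun h : k = a => ha (h ▸ hk)]
      rw [h1, Finset.sum_insert ha, add_comm, ← tsub_tsub]
      refine le_trans ?_ (tsub_le_tsub_right hr (x a))
      split_ifs with h
      · rw [h, Set.sdiff_empty, tsub_zero]
      · rw [measure_sdiff hGE hG.nullMeasurableSet hG', hGv]
        rcases le_total (x a) (volume (E \ ⋃ k ∈ s, F k)) with h' | h'
        · rw [min_eq_left h']
        · rw [min_eq_right h', tsub_self]; exact zero_le

open Classical in
/-- Pieces of the set `E` of sizes `x k`, as far as `E` suffices; empty if `E` is not measurable or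
not of finite volume. -/
def pieces {ι : Type*} [Fintype ι] (E : Set ℝ) (x : ι → ENNReal) : ι → Set ℝ :=
  if h : MeasurableSet E ∧ volume E ≠ ⊤ then
    (exists_pieces Finset.univ h.1 h.2 x).choose else fun _ => ∅

section Pieces

variable {ι : Type*} [Fintype ι] (E : Set ℝ) (x : ι → ENNReal)

theorem pieces_spec (k : ι) : MeasurableSet (pieces E x k) ∧ pieces E x k ⊆ E ∧
    volume (pieces E x k) ≤ x k ∧ (x k = 0 → pieces E x k = ∅) := by
  classical
  unfold pieces
  split_ifs with h
  · exact (exists_pieces Finset.univ h.1 h.2 x).choose_spec.1 k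
  · simp

variable {E}

theorem volume_diff_pieces_le (hE : MeasurableSet E) (hv : volume E ≠ ⊤) :
    volume (E \ ⋃ k, pieces E x k) ≤ volume E - ∑ k, x k := by
  classical
  have h := (exists_pieces Finset.univ hE hv x).choose_spec.2
  simp only [pieces, dif_pos (And.intro hE hv)]
  convert h using 4
  simp

end Pieces

/-- Disjoint intervals of labels of length `len i c` for the arrivals of every slot; consecutive intervals start
at multiples of a bound of their lengths. -/
def labelInterval {n M : ℕ} (len : Node n → Commodity n M → ℝ) (t : ℕ) (i : Node n)
    (c : Commodity n M) : Set ℝ :=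
  Set.Ico ((∑ i, ∑ c, len i c) * (Encodable.encode (t, i, c) : ℝ))
    ((∑ i, ∑ c, len i c) * (Encodable.encode (t, i, c) : ℝ) + len i c)

theorem pairwise_disjoint_labelInterval {n M : ℕ} {len : Node n → Commodity n M → ℝ}
    (h : ∀ i c, 0 ≤ len i c) : Pairwise (Function.onFun Disjoint
      fun p : ℕ × Node n × Commodity n M => labelInterval len p.1 p.2.1 p.2.2) := by
  have hle : ∀ i c, len i c ≤ ∑ i, ∑ c, len i c := fun i c =>
    (Finset.single_le_sum (f := fun c => len i c) (fun c _ => h i c) (Finset.mem_univ c)).trans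
      (Finset.single_le_sum (f := fun i => ∑ c, len i c)
        (fun i _ => Finset.sum_nonneg fun c _ => h i c) (Finset.mem_univ i))
  have h0 : 0 ≤ ∑ i, ∑ c, len i c :=
    Finset.sum_nonneg fun i _ => Finset.sum_nonneg fun c _ => h i c
  have key : ∀ p p' : ℕ × Node n × Commodity n M, Encodable.encode p < Encodable.encode p' →
      Disjoint (labelInterval len p.1 p.2.1 p.2.2) (labelInterval len p'.1 p'.2.1 p'.2.2) := by
    intro p p' hlt
    refine Set.disjoint_left.2 fun y hy hy' => ?_
    have h1 := hy.2
    have h2 := hy'.1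
    have h3 : (Encodable.encode p : ℝ) + 1 ≤ Encodable.encode p' := by exact_mod_cast hlt
    have h4 := mul_le_mul_of_nonneg_left h3 h0
    have h5 := hle p.2.1 p.2.2
    simp only [Prod.mk.eta] at h1 h2
    linarith
  intro p p' hne
  rcases lt_or_gt_of_ne (fun e => hne (Encodable.encode_injective e)) with h | h
  · exact key p p' h
  · exact (key p' p h).symm

/-! ### Max-weight processes as control algorithms -/

section ToControl

variable {n M : ℕ} {𝒮 : Type} [Fintype 𝒮] {net : Network n M 𝒮} {A : ℝ} {lam : RateMatrix n M}
  {Ω : Type*} [mΩ : MeasurableSpace Ω] {μ : Measure Ω}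

namespace MaxWeightProcess

variable {env : Environment net A lam μ} {w : net.Cost} {V : ℝ} (X : MaxWeightProcess env w V)

/-- Amount (at the scale of labels) of commodity `c` that node `i` sends in partition `v` to the
node that takes over (`some v`), or processes (`none`). -/
def pieceSize (t : ℕ) (ω : Ω) (i : Node n) (c : Commodity n M) : Option (Fin n) → ℝ
  | some v => (if c = (X.dec t ω).com i ∧ (X.fwd t ω i v).isSome then
      net.partitionRate i ((X.dec t ω).ktr i) (env.S (t + 1) ω) v else 0) / net.scale c.2
  | none => (∑ m : Fin M, if m.castSucc = c.2 then
      procAssigned net (X.Q t ω) i ((X.dec t ω).kpr i) ((X.dec t ω).job i) (c.1, m) else 0) /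
        net.scale c.2

theorem pieceSize_nonneg (t : ℕ) (ω : Ω) (i : Node n) (c : Commodity n M) (k : Option (Fin n)) :
    0 ≤ X.pieceSize t ω i c k := by
  cases k with
  | none =>
    refine div_nonneg (Finset.sum_nonneg fun m _ => ?_) (net.scale_pos _).le
    split_ifs
    exacts [Network.Decision.procAssigned_nonneg _ _ _ _ _, le_rfl]
  | some v =>
    refine div_nonneg ?_ (net.scale_pos _).le
    split_ifs
    exacts [net.partitionRate_nonneg _ _ _ _, le_rfl]

theorem sum_pieceSize (t : ℕ) (ω : Ω) (i : Node n) (c : Commodity n M) :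
    ∑ k, X.pieceSize t ω i c k =
      (X.dec t ω).out (X.Q t ω) (env.S (t + 1) ω) (X.fwd t ω) i c / net.scale c.2 := by
  rw [Fintype.sum_option, Network.Decision.out, add_div, add_comm]
  simp only [pieceSize]
  congr 1
  rw [← Finset.sum_div]
  congr 1
  simp only [txAssigned]
  by_cases hc : c = (X.dec t ω).com i
  · simp only [hc, if_true, true_and]
    rw [Finset.sum_comm]
    refine Finset.sum_congr rfl fun v _ => ?_
    cases X.fwd t ω i v <;> simp
  · simp [hc]

/-- What a node sends and processes of the information `held`. -/
def cut (t : ℕ) (ω : Ω) (held : Node n → Commodity n M → Set ℝ) (i : Node n)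
    (c : Commodity n M) : Option (Fin n) → Set ℝ :=
  pieces (held i c) fun k => ENNReal.ofReal (X.pieceSize t ω i c k)

/-- What node `j` takes over from node `i`. -/
def taken (t : ℕ) (ω : Ω) (held : Node n → Commodity n M → Set ℝ) (i j : Node n)
    (c : Commodity n M) : Set ℝ :=
  ⋃ v ∈ {v : Fin n | X.fwd t ω i v = some j}, X.cut t ω held i c (some v)

/-- Labels of the arrivals when these are the same in every slot. -/
def arrivalLabels (_ : MaxWeightProcess env w V) : ℕ → Node n → Commodity n M → Set ℝ :=
  labelInterval fun i c => lam i c / net.scale c.2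

/-- Information held by the nodes: what they send or process leaves them. -/
def held : ℕ → Ω → Node n → Commodity n M → Set ℝ
  | 0, _ => fun _ _ => ∅
  | t + 1, ω => fun i c => if c = (i, Fin.last M) then ∅ else
      (held t ω i c \ ⋃ k, X.cut t ω (held t ω) i c k) ∪
        (⋃ j, X.taken t ω (held t ω) j i c) ∪
        (⋃ m ∈ {m : Fin M | m.succ = c.2}, X.cut t ω (held t ω) i (c.1, m.castSucc) none) ∪
        X.arrivalLabels t i c

theorem held_succ (t : ℕ) (ω : Ω) (i : Node n) (c : Commodity n M) :
    X.held (t + 1) ω i c = if c = (i, Fin.last M) then ∅ else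
      (X.held t ω i c \ ⋃ k, X.cut t ω (X.held t ω) i c k) ∪
        (⋃ j, X.taken t ω (X.held t ω) j i c) ∪
        (⋃ m ∈ {m : Fin M | m.succ = c.2}, X.cut t ω (X.held t ω) i (c.1, m.castSucc) none) ∪
        X.arrivalLabels t i c := rfl

/-- All that a node can have at the end of a slot. -/
def available (t : ℕ) (ω : Ω) (i : Node n) (c : Commodity n M) : Set ℝ :=
  X.held t ω i c ∪ (⋃ j, X.taken t ω (X.held t ω) j i c) ∪
    (⋃ m ∈ {m : Fin M | m.succ = c.2}, X.cut t ω (X.held t ω) i (c.1, m.castSucc) none) ∪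
    X.arrivalLabels t i c

/-- Information delivered before a slot. -/
def delivered : ℕ → Ω → Set ℝ
  | 0, _ => ∅
  | t + 1, ω => delivered t ω ∪ ⋃ d, X.available t ω d (d, Fin.last M)

theorem cut_spec (t : ℕ) (ω : Ω) (held : Node n → Commodity n M → Set ℝ) (i : Node n)
    (c : Commodity n M) (k : Option (Fin n)) :
    MeasurableSet (X.cut t ω held i c k) ∧ X.cut t ω held i c k ⊆ held i c ∧
      volume (X.cut t ω held i c k) ≤ ENNReal.ofReal (X.pieceSize t ω i c k) ∧
      (X.pieceSize t ω i c k = 0 → X.cut t ω held i c k = ∅) := by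
  obtain ⟨h1, h2, h3, h4⟩ := pieces_spec (held i c)
    (fun k => ENNReal.ofReal (X.pieceSize t ω i c k)) k
  exact ⟨h1, h2, h3, fun h => h4 (by simp [h])⟩

theorem measurableSet_taken (t : ℕ) (ω : Ω) (held : Node n → Commodity n M → Set ℝ) (i j : Node n)
    (c : Commodity n M) : MeasurableSet (X.taken t ω held i j c) :=
  MeasurableSet.iUnion fun _ => MeasurableSet.iUnion fun _ => (X.cut_spec t ω held i c _).1

theorem measurableSet_held (t : ℕ) (ω : Ω) (i : Node n) (c : Commodity n M) :
    MeasurableSet (X.held t ω i c) := by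
  induction t generalizing i c with
  | zero => exact MeasurableSet.empty
  | succ t ih =>
    rw [held_succ]
    split_ifs
    · exact MeasurableSet.empty
    · exact ((((ih i c).diff (MeasurableSet.iUnion fun k => (X.cut_spec t ω _ i c k).1)).union
        (MeasurableSet.iUnion fun j => X.measurableSet_taken t ω _ j i c)).union
        (MeasurableSet.iUnion fun m => MeasurableSet.iUnion fun _ =>
          (X.cut_spec t ω _ i _ none).1)).union measurableSet_Ico

theorem held_final (t : ℕ) (ω : Ω) (d : Node n) : X.held t ω d (d, Fin.last M) = ∅ := by
  cases t <;> simp [held]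

/-- The backlogs dominate what the nodes hold. -/
theorem volume_held_le (hsucc : ∀ t ω i c, c ≠ (i, Fin.last M) →
      max (X.Q t ω i c - (X.dec t ω).out (X.Q t ω) (env.S (t + 1) ω) (X.fwd t ω) i c) 0 +
        (X.dec t ω).inn (X.Q t ω) (env.S (t + 1) ω) (X.fwd t ω) i c + lam i c ≤
      X.Q (t + 1) ω i c) (hlam : ∀ i c, 0 ≤ lam i c) (t : ℕ) (ω : Ω) (i : Node n)
    (c : Commodity n M) :
    volume (X.held t ω i c) ≤ ENNReal.ofReal (X.Q t ω i c / net.scale c.2) := by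
  induction t generalizing i c with
  | zero => simp [held]
  | succ t ih =>
    rw [held_succ]
    split_ifs with hc
    · simp
    have hs := net.scale_pos c.2
    set out := (X.dec t ω).out (X.Q t ω) (env.S (t + 1) ω) (X.fwd t ω) i c with hout
    have h1 : volume (X.held t ω i c \ ⋃ k, X.cut t ω (X.held t ω) i c k) ≤
        ENNReal.ofReal (max (X.Q t ω i c - out) 0 / net.scale c.2) := by
      refine (volume_diff_pieces_le _ (X.measurableSet_held t ω i c)
        ((ih i c).trans_lt ENNReal.ofReal_lt_top).ne).trans ?_
      rw [← ENNReal.ofReal_sum_of_nonneg fun k _ => X.pieceSize_nonneg t ω i c k, X.sum_pieceSize]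
      refine (tsub_le_tsub_right (ih i c) _).trans ?_
      rw [← ENNReal.ofReal_sub _ (div_nonneg (Network.Decision.out_nonneg _ _ _ _ _ _) hs.le),
        ← sub_div]
      exact ENNReal.ofReal_le_ofReal (div_le_div_of_nonneg_right (le_max_left _ _) hs.le)
    have h2 : volume (⋃ j, X.taken t ω (X.held t ω) j i c) ≤ ENNReal.ofReal
        ((∑ j, txAssigned net j ((X.dec t ω).ktr j) ((X.dec t ω).com j) (env.S (t + 1) ω)
          (X.fwd t ω j) i c) / net.scale c.2) := by
      rw [Finset.sum_div, ENNReal.ofReal_sum_of_nonneg fun j _ =>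
        div_nonneg (Network.Decision.txAssigned_nonneg _ _ _ _ _ _ _) hs.le]
      refine (measure_iUnion_fintype_le _ _).trans (Finset.sum_le_sum fun j _ => ?_)
      have e1 : X.taken t ω (X.held t ω) j i c = ⋃ v : Fin n, if X.fwd t ω j v = some i then
          X.cut t ω (X.held t ω) j c (some v) else ∅ := by
        unfold taken
        refine Set.iUnion_congr fun v => ?_
        by_cases hv : X.fwd t ω j v = some i <;> simp [hv]
      have e2 : txAssigned net j ((X.dec t ω).ktr j) ((X.dec t ω).com j) (env.S (t + 1) ω)
          (X.fwd t ω j) i c / net.scale c.2 =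
          ∑ v, if X.fwd t ω j v = some i then X.pieceSize t ω j c (some v) else 0 := by
        unfold txAssigned pieceSize
        split_ifs with hcom
        · rw [Finset.sum_div]
          refine Finset.sum_congr rfl fun v _ => ?_
          by_cases hv : X.fwd t ω j v = some i <;> simp [hv, hcom]
        · simp [hcom]
      rw [e1, e2, ENNReal.ofReal_sum_of_nonneg fun v _ => by
        split_ifs; exacts [X.pieceSize_nonneg _ _ _ _ _, le_rfl]]
      refine (measure_iUnion_fintype_le _ _).trans (Finset.sum_le_sum fun v _ => ?_)
      split_ifs
      · exact (X.cut_spec t ω _ j c _).2.2.1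
      · simp
    have h3 : volume (⋃ m ∈ {m : Fin M | m.succ = c.2},
        X.cut t ω (X.held t ω) i (c.1, m.castSucc) none) ≤ ENNReal.ofReal
        ((∑ m : Fin M, if m.succ = c.2 then net.ξ m * procAssigned net (X.Q t ω) i
          ((X.dec t ω).kpr i) ((X.dec t ω).job i) (c.1, m) else 0) / net.scale c.2) := by
      have e1 : (⋃ m ∈ {m : Fin M | m.succ = c.2},
          X.cut t ω (X.held t ω) i (c.1, m.castSucc) none) = ⋃ m : Fin M, if m.succ = c.2 then
          X.cut t ω (X.held t ω) i (c.1, m.castSucc) none else ∅ := by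
        refine Set.iUnion_congr fun m => ?_
        by_cases hm : m.succ = c.2 <;> simp [hm]
      have hp : ∀ b, 0 ≤ procAssigned net (X.Q t ω) i
          ((X.dec t ω).kpr i) ((X.dec t ω).job i) b := fun b =>
        Network.Decision.procAssigned_nonneg _ _ _ _ _
      rw [e1, Finset.sum_div, ENNReal.ofReal_sum_of_nonneg fun m _ => div_nonneg (by
        split_ifs; exacts [mul_nonneg (net.ξ_pos m).le (hp _), le_rfl]) hs.le]
      refine (measure_iUnion_fintype_le _ _).trans (Finset.sum_le_sum fun m _ => ?_)
      split_ifs with hm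
      · refine (X.cut_spec t ω _ i _ none).2.2.1.trans (le_of_eq ?_)
        have e3 : X.pieceSize t ω i (c.1, m.castSucc) none = procAssigned net (X.Q t ω) i
            ((X.dec t ω).kpr i) ((X.dec t ω).job i) (c.1, m) / net.scale m.castSucc := by
          simp [pieceSize]
        have h4 := (net.scale_pos m.castSucc).ne'
        have h5 := (net.ξ_pos m).ne'
        rw [e3, ← hm, net.scale_succ]
        congr 1
        field_simp
      · simp
    have h4 : volume (X.arrivalLabels t i c) ≤ ENNReal.ofReal (lam i c / net.scale c.2) := by
      rw [arrivalLabels, labelInterval, Real.volume_Ico, add_sub_cancel_left]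
    have hinn : (X.dec t ω).inn (X.Q t ω) (env.S (t + 1) ω) (X.fwd t ω) i c =
      ∑ j, txAssigned net j ((X.dec t ω).ktr j) ((X.dec t ω).com j) (env.S (t + 1) ω)
          (X.fwd t ω j) i c + ∑ m : Fin M, (if m.succ = c.2 then net.ξ m *
        procAssigned net (X.Q t ω) i
          ((X.dec t ω).kpr i) ((X.dec t ω).job i) (c.1, m) else 0) := rfl
    have p2 : 0 ≤ ∑ j, txAssigned net j ((X.dec t ω).ktr j) ((X.dec t ω).com j)
        (env.S (t + 1) ω) (X.fwd t ω j) i c :=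
      Finset.sum_nonneg fun j _ => Network.Decision.txAssigned_nonneg _ _ _ _ _ _ _
    have p3 : 0 ≤ ∑ m : Fin M, (if m.succ = c.2 then net.ξ m *
        procAssigned net (X.Q t ω) i
          ((X.dec t ω).kpr i) ((X.dec t ω).job i) (c.1, m) else 0) :=
      Finset.sum_nonneg fun m _ => by
        split_ifs
        exacts [mul_nonneg (net.ξ_pos m).le (Network.Decision.procAssigned_nonneg _ _ _ _ _), le_rfl]
    have h5 := hsucc t ω i c hc
    rw [hinn] at h5
    refine (measure_union_le _ _).trans ((add_le_add ((measure_union_le _ _).trans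
      (add_le_add ((measure_union_le _ _).trans (add_le_add h1 h2)) h3)) h4).trans ?_)
    have m0 : 0 ≤ max (X.Q t ω i c - out) 0 := le_max_right _ _
    rw [← ENNReal.ofReal_add (div_nonneg m0 hs.le) (div_nonneg p2 hs.le),
      ← ENNReal.ofReal_add (add_nonneg (div_nonneg m0 hs.le) (div_nonneg p2 hs.le))
        (div_nonneg p3 hs.le),
      ← ENNReal.ofReal_add (add_nonneg (add_nonneg (div_nonneg m0 hs.le) (div_nonneg p2 hs.le))
        (div_nonneg p3 hs.le)) (div_nonneg (hlam i c) hs.le), ← add_div, ← add_div, ← add_div]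
    exact ENNReal.ofReal_le_ofReal (div_le_div_of_nonneg_right (by linarith) hs.le)

theorem mem_held_succ_or_delivered {t : ℕ} {ω : Ω} {i : Node n} {c : Commodity n M} {x : ℝ}
    (h : x ∈ X.available t ω i c)
    (h' : c ≠ (i, Fin.last M) → x ∈ X.held (t + 1) ω i c) :
    x ∈ X.delivered (t + 1) ω ∪ ⋃ j, ⋃ c', X.held (t + 1) ω j c' := by
  by_cases hc : c = (i, Fin.last M)
  · subst hc
    exact Or.inl (Or.inr (Set.mem_iUnion.2 ⟨i, h⟩))
  · exact Or.inr (Set.mem_iUnion₂.2 ⟨i, c, h' hc⟩)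

/-- No information is lost: pieces of positive size are handed over, processed or delivered, and
empty ones matter to no label. -/
theorem held_union_arrivalLabels_subset (t : ℕ) (ω : Ω) (i : Node n) (c : Commodity n M) :
    X.held t ω i c ∪ X.arrivalLabels t i c ⊆
      X.delivered (t + 1) ω ∪ ⋃ j, ⋃ c', X.held (t + 1) ω j c' := by
  rintro x (hx | hx)
  · by_cases hcut : x ∈ ⋃ k, X.cut t ω (X.held t ω) i c k
    · obtain ⟨k, hk⟩ := Set.mem_iUnion.1 hcut
      have hne : X.pieceSize t ω i c k ≠ 0 := fun h0 => by
        rw [(X.cut_spec t ω _ i c k).2.2.2 h0] at hk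
        exact hk
      cases k with
      | none =>
        have : ∃ m : Fin M, m.castSucc = c.2 := by
          by_contra hno
          push Not at hno
          exact hne (by simp [pieceSize, hno])
        obtain ⟨m, hm⟩ := this
        have hc : c = (c.1, m.castSucc) := by rw [hm]
        have hin : x ∈ ⋃ m' ∈ {m' : Fin M | m'.succ = m.succ},
            X.cut t ω (X.held t ω) i (c.1, m'.castSucc) none :=
          Set.mem_biUnion (x := m) rfl (by rw [← hc]; exact hk)
        refine X.mem_held_succ_or_delivered (i := i) (c := (c.1, m.succ))
          (Or.inl (Or.inr hin)) fun hc' => ?_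
        rw [held_succ, if_neg hc']
        exact Or.inl (Or.inr hin)
      | some v =>
        have : (X.fwd t ω i v).isSome := by
          by_contra hno
          exact hne (by simp [pieceSize, hno])
        obtain ⟨j, hj⟩ := Option.isSome_iff_exists.1 this
        have hin : x ∈ ⋃ i', X.taken t ω (X.held t ω) i' j c :=
          Set.mem_iUnion.2 ⟨i, Set.mem_biUnion (x := v) hj hk⟩
        refine X.mem_held_succ_or_delivered (i := j) (c := c)
          (Or.inl (Or.inl (Or.inr hin))) fun hc' => ?_
        rw [held_succ, if_neg hc']
        exact Or.inl (Or.inl (Or.inr hin))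
    · refine X.mem_held_succ_or_delivered (i := i) (c := c)
        (Or.inl (Or.inl (Or.inl hx))) fun hc' => ?_
      rw [held_succ, if_neg hc']
      exact Or.inl (Or.inl (Or.inl ⟨hx, hcut⟩))
  · refine X.mem_held_succ_or_delivered (i := i) (c := c) (Or.inr hx) fun hc' => ?_
    rw [held_succ, if_neg hc']
    exact Or.inr hx

theorem scale_mul_volume_cut_le (t : ℕ) (ω : Ω) (held : Node n → Commodity n M → Set ℝ)
    (i : Node n) (c : Commodity n M) (k : Option (Fin n)) :
    net.scale c.2 * volume.real (X.cut t ω held i c k) ≤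
      net.scale c.2 * X.pieceSize t ω i c k := by
  refine mul_le_mul_of_nonneg_left ?_ (net.scale_pos _).le
  exact ENNReal.toReal_le_of_le_ofReal (X.pieceSize_nonneg t ω i c k)
    (X.cut_spec t ω held i c k).2.2.1

/-- A max-weight process with constant arrivals, realised by a control algorithm that forwards
and processes single copies. -/
def toControl (ha : ∀ t ω, env.a t ω = lam) (hlam : ∀ i c, 0 ≤ lam i c) :
    ControlAlgorithm env where
  kpr t ω := (X.dec t ω).kpr
  ktr t ω := (X.dec t ω).ktr
  share t ω i c := if c = (X.dec t ω).com i then 1 else 0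
  kpr_adapted := X.kpr_adapted
  ktr_adapted := X.ktr_adapted
  share_adapted t i c := (Measurable.of_discrete
    (f := fun c' : Commodity n M => if c = c' then (1 : ℝ) else 0)).comp (X.com_adapted t i)
  share_nonneg t ω i c := by split_ifs <;> norm_num
  share_sum t ω i := by simp
  arrived t _ := X.arrivalLabels t
  held := X.held
  sent t ω i c v := X.cut t ω (X.held t ω) i c (some v)
  retained t ω := X.taken t ω (X.held t ω)
  processed t ω i b := X.cut t ω (X.held t ω) i (b.1, b.2.castSucc) none
  delivered := X.delivered
  arrived_meas t ω i c := measurableSet_Ico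
  held_meas := X.measurableSet_held
  sent_meas t ω i c v := (X.cut_spec t ω _ i c _).1
  retained_meas t ω i j c := X.measurableSet_taken t ω _ i j c
  processed_meas t ω i b := (X.cut_spec t ω _ i _ _).1
  arrived_size t ω i c := by
    rw [ha, arrivalLabels, labelInterval, Real.volume_Ico, add_sub_cancel_left]
  arrived_disjoint ω := pairwise_disjoint_labelInterval fun i c =>
    div_nonneg (hlam i c) (net.scale_pos _).le
  sent_subset t ω i c v := (X.cut_spec t ω _ i c _).2.1
  sent_size t ω i c v := by
    refine (X.scale_mul_volume_cut_le t ω _ i c _).trans ?_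
    have hp := net.partitionRate_nonneg i ((X.dec t ω).ktr i) (env.S (t + 1) ω) v
    rw [pieceSize, mul_div_cancel₀ _ (net.scale_pos _).ne']
    by_cases hc : c = (X.dec t ω).com i
    · simp only [hc, true_and, if_true, one_mul]
      split_ifs
      exacts [le_rfl, hp]
    · simp [hc]
  retained_subset t ω i j c := by
    refine Set.biUnion_mono (fun v hv => ?_) fun _ _ => subset_rfl
    exact Network.Decision.mem_receiverSet_of_fwd (X.dec t ω) (X.fwd_spec t ω) hv
  processed_subset t ω i b := (X.cut_spec t ω _ i _ _).2.1
  processed_size t ω i := by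
    calc _ ≤ ∑ b : Job n M, net.r b.2 * procAssigned net (X.Q t ω) i
          ((X.dec t ω).kpr i) ((X.dec t ω).job i) b := Finset.sum_le_sum fun b _ => by
          have h1 := X.scale_mul_volume_cut_le t ω (X.held t ω) i (b.1, b.2.castSucc) none
          have h2 : net.scale b.2.castSucc * X.pieceSize t ω i (b.1, b.2.castSucc) none =
              procAssigned net (X.Q t ω) i ((X.dec t ω).kpr i) ((X.dec t ω).job i) b := by
            rw [pieceSize, mul_div_cancel₀ _ (net.scale_pos _).ne']
            simp
          simp only [h2] at h1
          rw [mul_comm (net.r b.2)]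
          exact mul_le_mul_of_nonneg_right h1 (net.r_pos _).le
      _ ≤ _ := by
          rw [Network.Decision.sum_procAssigned (X.Q t ω) i ((X.dec t ω).kpr i)
            ((X.dec t ω).job i) fun b => net.r b.2]
          split_ifs
          · rw [mul_div_cancel₀ _ (net.r_pos _).ne']
          · exact net.Rpr_nonneg _ _
  available := X.available
  available_eq t ω i c := rfl
  held_zero ω i c := rfl
  held_succ t ω i c := by
    rw [held_succ]
    split_ifs
    · exact Set.empty_subset _
    · exact Set.union_subset_union_left _ (Set.union_subset_union_left _
        (Set.union_subset_union_left _ Set.sdiff_subset))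
  held_final := X.held_final
  delivered_zero ω := rfl
  delivered_succ t ω := rfl
  no_loss := X.held_union_arrivalLabels_subset

end MaxWeightProcess

end ToControl

/-! ### The canonical environment: the channel alone, with constant arrivals -/

section Canonical

/-- A function of a path in a finite space that depends on the first steps only is measurable, being
a function on a finite set. -/
theorem measurable_piLE_of_dependsOn {𝒮 β : Type*} [Finite 𝒮] [MeasurableSpace 𝒮]
    [MeasurableSingletonClass 𝒮] [MeasurableSpace β] {t : ℕ} {f : (ℕ → 𝒮) → β}
    (h : ∀ x y : ℕ → 𝒮, (∀ τ ≤ t, x τ = y τ) → f x = f y) :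
    Measurable[Filtration.piLE (X := fun _ => 𝒮) t] f := by
  set g : (Set.Iic t → 𝒮) → β := fun x =>
    f fun τ => if hτ : τ ≤ t then x ⟨τ, hτ⟩ else x ⟨t, Set.mem_Iic.2 le_rfl⟩ with hg
  have hfg : f = g ∘ Preorder.restrictLe t := by
    ext x
    exact h _ _ fun τ hτ => by simp [hτ, Preorder.restrictLe]
  rw [hfg]
  exact (Measurable.of_discrete (f := g)).comp (comap_measurable _)

theorem finite_range_of_dependsOn {𝒮 β : Type*} [Finite 𝒮] {t : ℕ} {f : (ℕ → 𝒮) → β}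
    (h : ∀ x y : ℕ → 𝒮, (∀ τ ≤ t, x τ = y τ) → f x = f y) : (Set.range f).Finite := by
  refine (Set.finite_range fun x : Set.Iic t → 𝒮 =>
    f fun τ => if hτ : τ ≤ t then x ⟨τ, hτ⟩ else x ⟨t, Set.mem_Iic.2 le_rfl⟩).subset ?_
  rintro _ ⟨x, rfl⟩
  exact ⟨fun τ => x τ, (h _ _ fun τ hτ => by simp [hτ]).symm⟩

variable {n M : ℕ} {𝒮 : Type} [Fintype 𝒮] {net : Network n M 𝒮} {A : ℝ} {lam : RateMatrix n M}
  {Ω : Type*} [mΩ : MeasurableSpace Ω] {μ : Measure Ω} [IsProbabilityMeasure μ]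

namespace Environment

variable (env : Environment net A lam μ)

/-- The sequence of the network states. -/
def path (ω : Ω) : ℕ → 𝒮 := fun t => env.S t ω

variable [MeasurableSpace 𝒮] [MeasurableSingletonClass 𝒮]

omit [IsProbabilityMeasure μ] [MeasurableSingletonClass 𝒮] in
theorem measurable_path_of_le {τ t : ℕ} (h : τ ≤ t) :
    Measurable[env.ℱ t] fun ω => env.path ω τ :=
  @measurable_to_countable' _ _ _ _ (env.ℱ t) _ fun s => env.ℱ.mono h _ (env.S_adapted τ s)

omit [IsProbabilityMeasure μ] [MeasurableSingletonClass 𝒮] in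
theorem measurable_path : Measurable env.path :=
  measurable_pi_lambda _ fun t => (env.measurable_path_of_le le_rfl).mono (env.ℱ.le t) le_rfl

omit [IsProbabilityMeasure μ] [MeasurableSingletonClass 𝒮] in
theorem measurableSet_preimage_path {t : ℕ} {E : Set (ℕ → 𝒮)}
    (hE : MeasurableSet[Filtration.piLE (X := fun _ => 𝒮) t] E) :
    MeasurableSet[env.ℱ t] (env.path ⁻¹' E) := by
  obtain ⟨E', hE', rfl⟩ := hE
  have : Measurable[env.ℱ t] fun ω => Preorder.restrictLe (π := fun _ => 𝒮) t (env.path ω) :=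
    @measurable_pi_lambda _ _ _ (env.ℱ t) _ _ fun τ => env.measurable_path_of_le τ.2
  exact this hE'

/-- The Markov property only concerns the law of the network states. -/
theorem markov_map_path (t : ℕ) (s : 𝒮) :
    (μ.map env.path)[({x : ℕ → 𝒮 | x (t + 1) = s}).indicator (fun _ => (1 : ℝ)) |
      Filtration.piLE (X := fun _ => 𝒮) t] =ᵐ[μ.map env.path] fun x => net.P (x t) s := by
  have := Measure.isProbabilityMeasure_map (μ := μ) env.measurable_path.aemeasurable
  have hm : MeasurableSet {x : ℕ → 𝒮 | x (t + 1) = s} :=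
    (measurable_pi_apply (X := fun _ : ℕ => 𝒮) (t + 1)) (measurableSet_singleton s)
  have hP : Measurable[Filtration.piLE (X := fun _ => 𝒮) t] fun x : ℕ → 𝒮 => net.P (x t) s :=
    measurable_piLE_of_dependsOn fun x y h => by rw [h t le_rfl]
  have hP' : Measurable fun x : ℕ → 𝒮 => net.P (x t) s :=
    hP.mono ((Filtration.piLE (X := fun _ => 𝒮)).le t) le_rfl
  have hPi : Integrable (fun x : ℕ → 𝒮 => net.P (x t) s) (μ.map env.path) := by
    refine Integrable.of_bound hP'.aestronglyMeasurable (∑ s', ∑ s, net.P s' s)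
      (Eventually.of_forall fun x => ?_)
    rw [Real.norm_of_nonneg (net.P_nonneg _ _)]
    exact (Finset.single_le_sum (f := fun s => net.P (x t) s) (fun s _ => net.P_nonneg _ s)
      (Finset.mem_univ s)).trans (Finset.single_le_sum (f := fun s' => ∑ s, net.P s' s)
        (fun s' _ => Finset.sum_nonneg fun s _ => net.P_nonneg s' s) (Finset.mem_univ (x t)))
  have h1i : Integrable (({x : ℕ → 𝒮 | x (t + 1) = s}).indicator (fun _ => (1 : ℝ)))
      (μ.map env.path) := (integrable_const 1).indicator hm
  refine (ae_eq_condExp_of_forall_setIntegral_eq ((Filtration.piLE (X := fun _ => 𝒮)).le t) h1i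
    (fun E _ _ => hPi.integrableOn) (fun E hE _ => ?_)
    hP.stronglyMeasurable.aestronglyMeasurable).symm
  have hE' := (Filtration.piLE (X := fun _ => 𝒮)).le t E hE
  rw [setIntegral_map hE' hP'.aestronglyMeasurable env.measurable_path.aemeasurable,
    setIntegral_map hE' h1i.aestronglyMeasurable env.measurable_path.aemeasurable]
  have h2 : Integrable (({ω | env.S (t + 1) ω = s}).indicator (fun _ => (1 : ℝ))) μ :=
    (integrable_const 1).indicator (env.ℱ.le _ _ (env.S_adapted (t + 1) s))
  have h3 := setIntegral_condExp (env.ℱ.le t) h2 (env.measurableSet_preimage_path hE)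
  rw [setIntegral_congr_ae (g := fun ω => net.P (env.S t ω) s)
    (env.ℱ.le t _ (env.measurableSet_preimage_path hE))
    ((env.S_markov t s).mono fun ω h _ => h)] at h3
  exact h3

/-- The environment made of the network states alone, with constant arrivals `lam'`. -/
def canonical {lam' : RateMatrix n M} (h : ∀ i c, 0 ≤ lam' i c) :
    Environment net (∑ i, ∑ c, lam' i c) lam' (μ.map env.path) where
  ℱ := Filtration.piLE (X := fun _ => 𝒮)
  S t x := x t
  S_adapted t s := by
    have : Measurable[Filtration.piLE (X := fun _ => 𝒮) t] fun x : ℕ → 𝒮 => x t :=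
      measurable_piLE_of_dependsOn fun x y h => h t le_rfl
    exact this (measurableSet_singleton s)
  S_markov := env.markov_map_path
  a _ _ := lam'
  a_nonneg _ _ := h
  a_adapted t := measurable_const
  a_indep t := by
    rw [MeasurableSpace.comap_const]
    have := Measure.isProbabilityMeasure_map (μ := μ) env.measurable_path.aemeasurable
    exact indep_bot_left _
  a_ident t := IdentDistrib.refl measurable_const.aemeasurable
  a_fourth_integrable t i := by
    have := Measure.isProbabilityMeasure_map (μ := μ) env.measurable_path.aemeasurable
    exact integrable_const _
  a_fourth t i := by
    have := Measure.isProbabilityMeasure_map (μ := μ) env.measurable_path.aemeasurable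
    rw [integral_const, probReal_univ, one_smul]
    exact pow_le_pow_left₀ (Finset.sum_nonneg fun c _ => h i c)
      (Finset.single_le_sum (f := fun i => ∑ c, lam' i c)
        (fun i _ => Finset.sum_nonneg fun c _ => h i c) (Finset.mem_univ i)) 4
  a_mean t i c := by
    have := Measure.isProbabilityMeasure_map (μ := μ) env.measurable_path.aemeasurable
    rw [integral_const, probReal_univ, one_smul]

end Environment

end Canonical

/-! ### Achievability: every rate that the prices allow is carried -/

section Achievability

variable {n M : ℕ} {𝒮 : Type} [Fintype 𝒮] (net : Network n M 𝒮)

theorem Network.exists_decision (w : net.Cost) (V : ℝ) (q : RateMatrix n M) (s : 𝒮) :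
    ∃ δ : net.Decision,
      (∀ i k b, net.Rpr i k * procWeight net q i b - V * w.pr i k ≤
        net.Rpr i (δ.kpr i) * procWeight net q i (δ.job i) - V * w.pr i (δ.kpr i)) ∧
      ∀ i k c, txWeight net q s i k c - V * w.tr i k ≤
        txWeight net q s i (δ.ktr i) (δ.com i) - V * w.tr i (δ.ktr i) := by
  have := net.nonempty_job
  choose p hp using fun i => Finite.exists_max fun p : Fin (net.Kpr i + 1) × Job n M =>
    net.Rpr i p.1 * procWeight net q i p.2 - V * w.pr i p.1
  choose p' hp' using fun i => Finite.exists_max fun p : Fin (net.Ktr i + 1) × Commodity n M =>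
    txWeight net q s i p.1 p.2 - V * w.tr i p.1
  exact ⟨⟨fun i => (p i).1, fun i => (p' i).1, fun i => (p i).2, fun i => (p' i).2⟩,
    fun i k b => hp i (k, b), fun i k c => hp' i (k, c)⟩

theorem Network.exists_isForwarding (q : RateMatrix n M) (i : Node n) (c : Commodity n M) (s : 𝒮)
    (v : Fin n) : ∃ o, IsForwarding net q i c s v o := by
  obtain ⟨j, hj, hmax⟩ := Finset.exists_max_image (net.receiverSet i s v)
    (fun j => diffWeight q i j c) (net.receiverSet_nonempty i s v)
  by_cases h : 0 < diffWeight q i j c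
  · exact ⟨some j, hj, h, hmax⟩
  · exact ⟨none, fun j' hj' => le_antisymm ((hmax j' hj').trans (not_lt.1 h))
      (diffWeight_nonneg q i j' c)⟩

/-- A decision that maximises the value minus `V` times the cost. -/
def Network.bestDecision (w : net.Cost) (V : ℝ) (q : RateMatrix n M) (s : 𝒮) : net.Decision :=
  (net.exists_decision w V q s).choose

/-- Forwarding to a receiver with the largest positive differential backlog. -/
def Network.bestForwarding (w : net.Cost) (V : ℝ) (q : RateMatrix n M) (s s' : 𝒮) (i : Node n)
    (v : Fin n) : Option (Node n) :=
  (net.exists_isForwarding q i ((net.bestDecision w V q s).com i) s' v).choose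

theorem Network.bestForwarding_spec (w : net.Cost) (V : ℝ) (q : RateMatrix n M) (s s' : 𝒮)
    (i : Node n) (v : Fin n) : IsForwarding net q i ((net.bestDecision w V q s).com i) s' v
      (net.bestForwarding w V q s s' i v) :=
  (net.exists_isForwarding q i ((net.bestDecision w V q s).com i) s' v).choose_spec

/-- Virtual backlogs along a sequence of network states: they grow by the assigned rates, even when
the transmitting queue is empty. -/
def Network.virtualQueue (w : net.Cost) (V : ℝ) (lam : RateMatrix n M) (x : ℕ → 𝒮) :
    ℕ → RateMatrix n M
  | 0 => 0
  | t + 1 => fun i c => if c = (i, Fin.last M) then 0 else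
      max (virtualQueue w V lam x t i c -
        (net.bestDecision w V (virtualQueue w V lam x t) (x t)).out (virtualQueue w V lam x t)
          (x (t + 1)) (net.bestForwarding w V (virtualQueue w V lam x t) (x t) (x (t + 1))) i c) 0 +
      (net.bestDecision w V (virtualQueue w V lam x t) (x t)).inn (virtualQueue w V lam x t)
        (x (t + 1)) (net.bestForwarding w V (virtualQueue w V lam x t) (x t) (x (t + 1))) i c +
      lam i c

variable {net}

theorem Network.virtualQueue_congr (w : net.Cost) (V : ℝ) (lam : RateMatrix n M) {x y : ℕ → 𝒮}
    {t : ℕ} (h : ∀ τ ≤ t, x τ = y τ) :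
    net.virtualQueue w V lam x t = net.virtualQueue w V lam y t := by
  induction t with
  | zero => rfl
  | succ t ih =>
    simp only [Network.virtualQueue]
    rw [ih fun τ hτ => h τ (hτ.trans (Nat.le_succ t)), h t (Nat.le_succ t), h (t + 1) le_rfl]

theorem Network.isWeight_virtualQueue (w : net.Cost) (V : ℝ) {lam : RateMatrix n M}
    (hlam : ∀ i c, 0 ≤ lam i c) (x : ℕ → 𝒮) (t : ℕ) :
    IsWeight (net.virtualQueue w V lam x t) := by
  cases t with
  | zero => exact ⟨fun _ _ => le_rfl, fun _ => rfl⟩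
  | succ t =>
    refine ⟨fun i c => ?_, fun d => ?_⟩
    · simp only [Network.virtualQueue]
      split_ifs
      · exact le_rfl
      · exact add_nonneg (add_nonneg (le_max_right _ _)
          (Network.Decision.inn_nonneg _ _ _ _ _ _)) (hlam i c)
    · simp [Network.virtualQueue]

variable {A : ℝ} {lam : RateMatrix n M} {Ω : Type*} [mΩ : MeasurableSpace Ω] {μ : Measure Ω}
  [IsProbabilityMeasure μ] [MeasurableSpace 𝒮] [MeasurableSingletonClass 𝒮]

/-- The virtual queues in the canonical environment. -/
def Environment.virtualProcess (env : Environment net A lam μ) {lam' : RateMatrix n M}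
    (h : ∀ i c, 0 ≤ lam' i c) (w : net.Cost) (V : ℝ) :
    MaxWeightProcess (env.canonical h) w V where
  Q t x := net.virtualQueue w V lam' x t
  dec t x := net.bestDecision w V (net.virtualQueue w V lam' x t) (x t)
  fwd t x := net.bestForwarding w V (net.virtualQueue w V lam' x t) (x t) (x (t + 1))
  Q_adapted t := measurable_piLE_of_dependsOn fun x y hxy => net.virtualQueue_congr w V lam' hxy
  kpr_adapted t i := measurable_piLE_of_dependsOn fun x y hxy => by
    rw [net.virtualQueue_congr w V lam' hxy, hxy t le_rfl]
  ktr_adapted t i := measurable_piLE_of_dependsOn fun x y hxy => by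
    rw [net.virtualQueue_congr w V lam' hxy, hxy t le_rfl]
  com_adapted t i := measurable_piLE_of_dependsOn fun x y hxy => by
    rw [net.virtualQueue_congr w V lam' hxy, hxy t le_rfl]
  weight t x := net.isWeight_virtualQueue w V h x t
  pr_max t x := (net.exists_decision w V (net.virtualQueue w V lam' x t) (x t)).choose_spec.1
  tr_max t x := (net.exists_decision w V (net.virtualQueue w V lam' x t) (x t)).choose_spec.2
  fwd_spec t x := net.bestForwarding_spec w V (net.virtualQueue w V lam' x t) (x t) (x (t + 1))
  Q_succ_le t x i c := by
    simp only [Network.virtualQueue]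
    split_ifs
    · exact add_nonneg (add_nonneg (le_max_right _ _)
        (Network.Decision.inn_nonneg _ _ _ _ _ _)) (h i c)
    · exact le_rfl
  le_Q_succ t x i c := by
    by_cases hc : c = (i, Fin.last M)
    · subst hc
      rw [(net.isWeight_virtualQueue w V h x t).final,
        (net.isWeight_virtualQueue w V h x (t + 1)).final, zero_sub, neg_nonpos]
      exact Network.Decision.out_nonneg _ _ _ _ _ _
    · conv_rhs => simp only [Network.virtualQueue, if_neg hc, add_assoc]
      exact (le_max_left _ 0).trans (le_add_of_nonneg_right
        (add_nonneg (Network.Decision.inn_nonneg _ _ _ _ _ _) (h i c)))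

omit [MeasurableSpace 𝒮] [MeasurableSingletonClass 𝒮] in
/-- Rates that satisfy the price inequalities with cost `c` are stabilized at costs arbitrarily
close to `c`. -/
theorem exists_averageCost_le (env : Environment net A lam μ) {lam' : RateMatrix n M}
    (h : ∀ i c, 0 ≤ lam' i c) (w : net.Cost) {V c : ℝ} (hV : 0 < V)
    (hq : ∀ q : RateMatrix n M, IsWeight q → pairing q lam' ≤ net.meanValue w V q + V * c) :
    ∃ (Ω : Type) (_ : MeasurableSpace Ω) (μ : Measure Ω) (_ : IsProbabilityMeasure μ)
      (A : ℝ) (env : Environment net A lam' μ) (alg : ControlAlgorithm env),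
      alg.RateStable ∧
        alg.averageCost w ≤ c + (n + 1) * net.boundConstant (∑ i, ∑ c, lam' i c) / V := by
  let _ : MeasurableSpace 𝒮 := ⊤
  have : MeasurableSingletonClass 𝒮 := ⟨fun _ => trivial⟩
  have hprob := Measure.isProbabilityMeasure_map (μ := μ) env.measurable_path.aemeasurable
  set X := env.virtualProcess h w V with hX
  set alg := X.toControl (fun _ _ => rfl) h with halg
  have hA : 0 ≤ ∑ i, ∑ c, lam' i c :=
    Finset.sum_nonneg fun i _ => Finset.sum_nonneg fun c _ => h i c
  refine ⟨ℕ → 𝒮, MeasurableSpace.pi, μ.map env.path, hprob, _, env.canonical h, alg, ?_, ?_⟩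
  · filter_upwards [X.rateStable hA hV.le hq] with x hx i c
    refine squeeze_zero (fun t => div_nonneg (mul_nonneg (net.scale_pos _).le measureReal_nonneg)
      (Nat.cast_nonneg t)) (fun t => div_le_div_of_nonneg_right ?_ (Nat.cast_nonneg t)) (hx i c)
    have h1 := X.volume_held_le (fun t x i c hc => by
      change _ ≤ net.virtualQueue w V lam' x (t + 1) i c
      simp only [Network.virtualQueue, if_neg hc]
      exact le_rfl) h t x i c
    have h2 := ENNReal.toReal_le_of_le_ofReal
      (div_nonneg ((X.weight t x).nonneg i c) (net.scale_pos c.2).le) h1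
    rw [le_div_iff₀' (net.scale_pos c.2)] at h2
    exact h2
  · have hb : ∀ t, ∃ C, ∀ x, size (X.Q t x) ≤ C := fun t => by
      have hfin : (Set.range fun x : ℕ → 𝒮 => size (X.Q t x)).Finite :=
        finite_range_of_dependsOn (t := t) fun x y hxy => by
          change size (net.virtualQueue w V lam' x t) = size (net.virtualQueue w V lam' y t)
          rw [net.virtualQueue_congr w V lam' hxy]
      obtain ⟨C, hC⟩ := hfin.bddAbove
      exact ⟨C, fun x => hC ⟨x, rfl⟩⟩
    obtain ⟨C, hC⟩ := X.expected_cost_le hA hb hq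
    set B := (n + 1) * net.boundConstant (∑ i, ∑ c, lam' i c) with hB
    have hlim : Tendsto (fun t : ℕ => c + B / V + C / V / (t : ℝ)) atTop (𝓝 (c + B / V)) := by
      simpa using (tendsto_const_div_atTop_nhds_zero_nat (C / V)).const_add (c + B / V)
    rw [← hlim.limsup_eq]
    refine limsup_le_limsup ?_ (alg.isBoundedUnder_average w).2.isCoboundedUnder_le
      hlim.isBoundedUnder_le
    filter_upwards [eventually_gt_atTop 0] with t ht
    have ht' : (0 : ℝ) < t := by exact_mod_cast ht
    have h1 := hC t
    change (∑ τ ∈ Finset.range t, ∫ x, X.cost τ x ∂(μ.map env.path)) / (t : ℝ) ≤ _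
    have h2 : c + B / V + C / V / (t : ℝ) = (t * (B + V * c) + C) / V / t := by
      field_simp; ring
    rw [h2]
    refine div_le_div_of_nonneg_right ?_ ht'.le
    rw [le_div_iff₀' hV]
    exact h1

end Achievability

/-! ### The minimum cost and the tradeoff -/

section Tradeoff

variable {n M : ℕ} {𝒮 : Type} [Fintype 𝒮] {net : Network n M 𝒮} {A : ℝ} {lam : RateMatrix n M}
  {Ω : Type*} [mΩ : MeasurableSpace Ω] {μ : Measure Ω} [IsProbabilityMeasure μ]

/-- The costs of the algorithms that stabilize the input rates `lam`; `minCost` is their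
infimum. -/
def stabilizingCosts (net : Network n M 𝒮) (w : net.Cost) (lam : RateMatrix n M) : Set ℝ :=
  {H | ∃ (Ω : Type) (_ : MeasurableSpace Ω) (μ : Measure Ω) (_ : IsProbabilityMeasure μ)
    (A : ℝ) (env : Environment net A lam μ) (alg : ControlAlgorithm env),
    alg.RateStable ∧ H = alg.averageCost w}

/-- The set of costs has to be nonempty, since its infimum would otherwise be the junk value `0`. -/
theorem pairing_le_minCost {w : net.Cost} {V : ℝ} (hV : 0 ≤ V)
    (hne : (stabilizingCosts net w lam).Nonempty) {q : RateMatrix n M} (hq : IsWeight q) :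
    pairing q lam ≤ net.meanValue w V q + V * minCost net w lam := by
  have hall : ∀ H ∈ stabilizingCosts net w lam, pairing q lam ≤ net.meanValue w V q + V * H := by
    rintro _ ⟨Ω, _, μ, _, A, env, alg, h, rfl⟩
    exact alg.pairing_le h w hV hq
  rcases hV.eq_or_lt with rfl | hV
  · obtain ⟨H, hH⟩ := hne
    simpa using hall H hH
  · have h1 : (pairing q lam - net.meanValue w V q) / V ≤ minCost net w lam :=
      le_csInf hne fun H hH => by
        rw [div_le_iff₀' hV]
        linarith [hall H hH]
    rw [div_le_iff₀' hV] at h1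
    linarith

/-- Prices characterise the minimum cost: if no `V > 0` and no prices refute the cost `c`, then
costs arbitrarily close to `c` are achieved. -/
theorem minCost_le (env : Environment net A lam μ) (w : net.Cost) {c : ℝ}
    (hq : ∀ V > 0, ∀ q : RateMatrix n M, IsWeight q →
      pairing q lam ≤ net.meanValue w V q + V * c) : minCost net w lam ≤ c := by
  have hbdd : BddBelow (stabilizingCosts net w lam) := ⟨0, by
    rintro _ ⟨Ω, _, μ, _, A, env, alg, h, rfl⟩
    exact alg.averageCost_nonneg w⟩
  set D := (n + 1) * net.boundConstant (∑ i, ∑ c, lam i c) with hD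
  have h1 : ∀ V > 0, minCost net w lam ≤ c + D / V := fun V hV => by
    obtain ⟨Ω, i1, μ, i2, A, env', alg, h, hle⟩ :=
      exists_averageCost_le env env.lam_nonneg w hV (hq V hV)
    exact (csInf_le hbdd ⟨Ω, i1, μ, i2, A, env', alg, h, rfl⟩).trans hle
  have h2 : Tendsto (fun V : ℝ => c + D / V) atTop (𝓝 c) := by
    simpa using (tendsto_const_nhds.div_atTop tendsto_id : Tendsto (fun V : ℝ => D / V)
      atTop (𝓝 0)).const_add c
  -- the excess `D / V` of the achieved cost vanishes as `V → ∞`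
  exact ge_of_tendsto h2 ((eventually_gt_atTop 0).mono fun V hV => h1 V hV)

/-- Rates that satisfy the price inequalities with the largest cost of a slot are stabilized by some
algorithm, so that `minCost` is a genuine infimum. -/
theorem stabilizingCosts_nonempty (env : Environment net A lam μ) (w : net.Cost)
    {lam' : RateMatrix n M} (h : ∀ i c, 0 ≤ lam' i c)
    (hq : ∀ q : RateMatrix n M, IsWeight q →
      pairing q lam' ≤ net.meanValue w 1 q + 1 * w.bound) :
    (stabilizingCosts net w lam').Nonempty := by
  obtain ⟨Ω, i1, μ, i2, A, env', alg, h, -⟩ := exists_averageCost_le env h w one_pos hq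
  exact ⟨_, Ω, i1, μ, i2, A, env', alg, h, rfl⟩

theorem pairing_add_const (q : RateMatrix n M) (hq : IsWeight q) (lam : RateMatrix n M) (ε : ℝ) :
    pairing q (fun i c => lam i c + ε) = pairing q lam + ε * size q := by
  rw [hq.size_eq, pairing, pairing, Finset.mul_sum, ← Finset.sum_add_distrib]
  refine Finset.sum_congr rfl fun i _ => ?_
  rw [Finset.mul_sum, ← Finset.sum_add_distrib]
  exact Finset.sum_congr rfl fun c _ => by ring

theorem limsup_coe_le {f r : ℕ → ℝ} {a : ℝ} (hr : Tendsto r atTop (𝓝 0))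
    (h : ∀ᶠ t in atTop, f t ≤ a + r t) :
    limsup (fun t => (f t : EReal)) atTop ≤ (a : EReal) := by
  have h1 : Tendsto (fun t => ((a + r t : ℝ) : EReal)) atTop (𝓝 (a : EReal)) :=
    (continuous_coe_real_ereal.tendsto a).comp (by simpa using hr.const_add a)
  rw [← h1.limsup_eq]
  exact limsup_le_limsup (h.mono fun t ht => EReal.coe_le_coe_iff.2 ht)

variable {env : Environment net A lam μ} {w : net.Cost} {V : ℝ}

namespace DWCNCRun

variable (run : DWCNCRun env w V)

/-- The costs of DWCNC are in the long run at least the minimum cost: prices that refute a smaller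
cost refute it along almost every path. -/
theorem ae_minCost_lt
    (h : ∀ᵐ ω ∂μ, ∀ i c, Tendsto (fun t : ℕ => run.Q t ω i c / t) atTop (𝓝 0)) :
    ∀ᵐ ω ∂μ, ∀ k : ℕ, ∀ᶠ t in atTop,
      minCost net w lam - 2 * (1 / ((k : ℝ) + 1)) < run.averageCost t ω := by
  refine ae_all_iff.2 fun k => ?_
  have hk : (0 : ℝ) < 1 / ((k : ℝ) + 1) := Nat.one_div_pos_of_nat
  obtain ⟨V', hV', q, hq, hlt⟩ : ∃ V' > 0, ∃ q : RateMatrix n M, IsWeight q ∧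
      net.meanValue w V' q + V' * (minCost net w lam - 1 / ((k : ℝ) + 1)) < pairing q lam := by
    by_contra hno
    push Not at hno
    linarith [minCost_le env w hno]
  filter_upwards [run.ae_pairing_le h V' hq] with ω ⟨r, hr, hle⟩
  have h1 : ∀ᶠ t in atTop, r t < V' * (1 / ((k : ℝ) + 1)) :=
    hr.eventually_lt_const (mul_pos hV' hk)
  filter_upwards [h1, eventually_gt_atTop 0] with t ht ht0
  have h2 := hle t ht0
  refine lt_of_mul_lt_mul_left ?_ hV'.le
  linarith

omit [IsProbabilityMeasure μ] in
theorem averageBacklog_eq (t : ℕ) (ω : Ω) : run.averageBacklog t ω =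
    (∑ τ ∈ Finset.range t, size (run.toMaxWeight.Q τ ω)) / t := by
  rw [averageBacklog]
  congr 1
  exact Finset.sum_congr rfl fun τ _ => (run.isWeight τ ω).size_eq.symm

end DWCNCRun

end Tradeoff

end WirelessComputing

end

open WirelessComputing in
theorem theorem2 {n M : ℕ} {𝒮 : Type} [Fintype 𝒮] (net : Network n M 𝒮) (A : ℝ) (hA : 0 ≤ A) :
    ∃ B : ℝ, (net.MemorylessChannel → B = net.driftConstant A) ∧
      ∀ (w : net.Cost) (V : ℝ), 0 ≤ V →
      ∀ (Ω : Type*) [MeasurableSpace Ω] (μ : Measure Ω) [IsProbabilityMeasure μ]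
        (lam : RateMatrix n M) (env : Environment net A lam μ) (run : DWCNCRun env w V),
        (∃ ε > 0, (fun i c => lam i c + ε) ∈ capacityRegion net) →
        (∀ᵐ ω ∂μ, ∀ i c, Tendsto (fun t : ℕ => run.Q t ω i c / t) atTop (𝓝 0)) ∧
        (0 < V → ∀ᵐ ω ∂μ,
          limsup (fun t : ℕ => (run.averageCost t ω : EReal)) atTop ≤
            ((minCost net w lam + (n + 1) * B / V : ℝ) : EReal)) ∧
        ∀ ε > 0, (fun i c => lam i c + ε) ∈ capacityRegion net → ∀ᵐ ω ∂μ,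
          limsup (fun t : ℕ => (run.averageBacklog t ω : EReal)) atTop ≤
            ((((n + 1) * B + V * (minCost net w (fun i c => lam i c + ε) - minCost net w lam))
              / ε : ℝ) : EReal) := by
  refine ⟨net.boundConstant A, fun h => ?_, ?_⟩
  · rw [Network.boundConstant, net.correctorLip_eq_zero h, zero_mul, add_zero]
  intro w V hV Ω _ μ _ lam env run ⟨ε, hε, hmem⟩
  have hslack : ∀ ε > 0, (fun i c => lam i c + ε) ∈ capacityRegion net → ∀ V ≥ 0,
      ∀ q : RateMatrix n M, IsWeight q →
        pairing q lam + ε * size q ≤ net.meanValue w V q + V * w.bound :=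
    fun ε _ hmem V hV q hq => by
      rw [← pairing_add_const q hq]
      exact pairing_le_of_mem_capacityRegion hmem w hV hq
  have hplain : ∀ V ≥ 0, ∀ q : RateMatrix n M, IsWeight q →
      pairing q lam ≤ net.meanValue w V q + V * w.bound := fun V hV q hq =>
    (le_add_of_nonneg_right (mul_nonneg hε.le (size_nonneg q))).trans (hslack ε hε hmem V hV q hq)
  have hstable : ∀ᵐ ω ∂μ, ∀ i c, Tendsto (fun t : ℕ => run.Q t ω i c / t) atTop (𝓝 0) :=
    run.toMaxWeight.rateStable hA hV (hplain V hV)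
  have hne := stabilizingCosts_nonempty env w env.lam_nonneg (hplain 1 zero_le_one)
  have havg := run.toMaxWeight.exists_average_le hA hV hε (hslack ε hε hmem V hV)
  refine ⟨hstable, fun hV' => ?_, fun ε hε hmem => ?_⟩
  · filter_upwards [havg] with ω ⟨r, hr, hle⟩
    refine limsup_coe_le (r := fun t => r t / V) (by simpa using hr.div_const V) ?_
    filter_upwards [eventually_gt_atTop 0] with t ht
    -- compare with the minimum cost at the rates `lam`, without slack
    have h1 := hle 0 (V * minCost net w lam)
      (fun q hq => by simpa using pairing_le_minCost hV hne hq) t ht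
    rw [zero_mul, zero_add] at h1
    have h2 : minCost net w lam + (n + 1) * net.boundConstant A / V + r t / V =
        ((n + 1) * net.boundConstant A + V * minCost net w lam + r t) / V := by
      field_simp; ring
    rw [h2, le_div_iff₀' hV']
    exact h1
  · have hne' := stabilizingCosts_nonempty env w (nonneg_of_mem_capacityRegion hmem)
      fun q hq => pairing_le_of_mem_capacityRegion hmem w zero_le_one hq
    filter_upwards [havg, run.ae_minCost_lt hstable] with ω ⟨r, hr, hle⟩ hcost
    set a := (n + 1) * net.boundConstant A +
      V * (minCost net w (fun i c => lam i c + ε) - minCost net w lam) with ha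
    have hk : ∀ k : ℕ, limsup (fun t : ℕ => (run.averageBacklog t ω : EReal)) atTop ≤
        (((a + V * (2 * (1 / ((k : ℝ) + 1)))) / ε : ℝ) : EReal) := fun k => by
      refine limsup_coe_le (r := fun t => r t / ε) (by simpa using hr.div_const ε) ?_
      filter_upwards [eventually_gt_atTop 0, hcost k] with t ht hct
      -- compare with the minimum cost at the rates `lam + ε`: the excess `ε` weighs the backlogs
      have h1 := hle ε (V * minCost net w (fun i c => lam i c + ε)) (fun q hq => by
        rw [← pairing_add_const q hq]
        exact pairing_le_minCost hV hne' hq) t ht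
      rw [← run.averageBacklog_eq] at h1
      have h2 : V * (minCost net w lam - 2 * (1 / ((k : ℝ) + 1))) ≤ V *
          ((∑ τ ∈ Finset.range t, run.toMaxWeight.cost τ ω) / t) :=
        mul_le_mul_of_nonneg_left hct.le hV
      rw [← add_div, le_div_iff₀' hε]
      linarith
    have hlim : Tendsto (fun k : ℕ => (((a + V * (2 * (1 / ((k : ℝ) + 1)))) / ε : ℝ) : EReal))
        atTop (𝓝 ((a / ε : ℝ) : EReal)) := by
      refine (continuous_coe_real_ereal.tendsto _).comp ?_
      simpa using (((tendsto_one_div_add_atTop_nhds_zero_nat (𝕜 := ℝ)).const_mul 2).const_mul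
        V |>.const_add a).div_const ε
    exact ge_of_tendsto' hlim hk
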